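/- Let $G$ be a compact connected Lie group with Lie algebra $\mathfrak g$, let $S^1=\mathbb R/2\pi\mathbb Z$, let $\Omega G$ be the Fréchet Lie group of smooth maps $\gamma\colon S^1\to G$ with $\gamma(0)=1$, with Lie algebra $\Omega\mathfrak g$, and let $L\mathfrak g=C^\infty(S^1,\mathfrak g)$. Bundles are smooth principal bundles; manifolds $M$ are smooth and finite-dimensional. A framed $G$-bundle $\widetilde P\to M\times S^1$ is a $G$-bundle with a smooth section $s_0$ over $M\times\{0\}$, with image $\widetilde P_0$; a connection $\tilde A$ on it is framed if $s_0^*\tilde A=0$. A Higgs field on an $\Omega G$-bundle $P\to M$ is a smooth map $\Phi\colon P\to L\mathfrak g$ with $\Phi(p\gamma)=\mathrm{ad}(\gamma^{-1})\Phi(p)+\gamma^{-1}\partial\gamma$. Let $\mathrm{Bun}_{\Omega G}$ be the category of $\Omega G$-bundles over manifolds and bundle maps, $\mathrm{frBun}_G$ the category of framed $G$-bundles over manifolds of the form $M\times S^1$ with the bundle maps that preserve the framing and cover a map of the form $f\times\mathrm{id}$. Let $\mathrm{Bun}^c_{\Omega G}$ be the category of $\Omega G$-bundles with connection and Higgs field,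 and $\mathrm{frBun}^c_G$ that of framed $G$-bundles over manifolds $M\times S^1$ with framed connection, the morphisms being those of $\mathrm{Bun}_{\Omega G}$ and $\mathrm{frBun}_G$ that preserve these data. For an $\Omega G$-bundle $\pi\colon P\to M$ let $\mathcal C(P)=(P\times G\times S^1)/\Omega G\to M\times S^1$, $[p,g,\theta]\mapsto(\pi(p),\theta)$, where $(p,g,\theta)\gamma=(p\gamma,\gamma(\theta)^{-1}g,\theta)$, with the $G$-action $[p,g,\theta]h=[p,gh,\theta]$ and the framing $s_0(\pi(p),0)=[p,1,0]$. For a framed $G$-bundle $\tilde\pi\colon\widetilde P\to M\times S^1$ let $\mathcal C^{-1}(\widetilde P)\to M$ have as its fibre over $m$ the smooth maps $f\colon S^1\to\widetilde P$ with $\tilde\pi(f(\theta))=(m,\theta)$ and $f(0)\in\widetilde P_0$, with the pointwise action of $\Omega G$. These are functors between $\mathrm{Bun}_{\Omega G}$ and $\mathrm{frBun}_G$ which, with natural isomorphisms $\alpha\colon\mathcal C^{-1}\circ\mathcal C\cong\mathrm{id}$, $\alpha_P^{-1}(p)=(\theta\mapsto[p,1,\theta])$, and $\beta\colon\mathcal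 C\circ\mathcal C^{-1}\cong\mathrm{id}$, $\beta_{\widetilde P}([f,g,\theta])=f(\theta)g$, form an equivalence of categories. If $P$ has connection $A$ and Higgs field $\Phi$, then the form $\mathrm{ad}(g^{-1})A(\theta)+\Theta+\mathrm{ad}(g^{-1})\Phi\,d\theta$ on $P\times G\times S^1$, with $\Theta$ the left-invariant Maurer–Cartan form of $G$, descends to a framed connection on $\mathcal C(P)$. If $\tilde A$ is a framed connection on $\widetilde P$, then $A(X)(\theta)=\tilde A(X(\theta))$ and $\Phi(f)=\tilde A(\partial f)$ are a connection and a Higgs field on $\mathcal C^{-1}(\widetilde P)$. With these data $\mathcal C$ and $\mathcal C^{-1}$ become functors $$\mathcal C\colon\mathrm{Bun}^c_{\Omega G}\to\mathrm{frBun}^c_G,\qquad \mathcal C^{-1}\colon\mathrm{frBun}^c_G\to\mathrm{Bun}^c_{\Omega G},$$ which form an equivalence of categories with the same natural isomorphisms $\alpha$ and $\beta$. -/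

import Mathlib

open CategoryTheory Diffeology
open scoped Manifold ContDiff Topology

universe u

noncomputable section

namespace Caloron

/-! ### Diffeologies

Smoothness on possibly infinite-dimensional spaces is expressed through smooth families (plots)
parametrised by `ℝⁿ`, using Mathlib's diffeological spaces. Finite-dimensional manifolds and
Fréchet manifolds (in particular the loop group `ΩG` and Fréchet principal `ΩG`-bundles) embed fully
faithfully into diffeological spaces: a map between them is smooth if and only if it sends smooth
families to smooth families. -/

/-- The Euclidean space `ℝⁿ`. -/
abbrev Eu (n : ℕ) : Type := EuclideanSpace ℝ (Fin n)

/-- Near any point of an open set the identity extends to a smooth map into the open set. -/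
theorem exists_smooth_retract {n : ℕ} {s : Set (Eu n)} (hs : IsOpen s) {x : Eu n} (hx : x ∈ s) :
    ∃ f : Eu n → Eu n, (∀ y, f y ∈ s) ∧ ContDiff ℝ ∞ f ∧ ∀ᶠ y in 𝓝 x, f y = y := by
  obtain ⟨ε, hε, hb⟩ := Metric.isOpen_iff.1 hs x hx
  let φ : ContDiffBump x := ⟨ε / 4, ε / 2, by positivity, by linarith⟩
  refine ⟨fun y => x + φ y • (y - x), fun y => hb ?_, ?_, ?_⟩
  · rw [Metric.mem_ball, dist_eq_norm, add_sub_cancel_left, norm_smul, Real.norm_eq_abs,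
      abs_of_nonneg φ.nonneg]
    by_cases h : dist y x < ε / 2
    · rw [dist_eq_norm] at h
      calc φ y * ‖y - x‖ ≤ 1 * ‖y - x‖ := by
            gcongr
            exact φ.le_one
        _ < ε := by linarith
    · rw [φ.zero_of_le_dist (not_lt.1 h)]
      simpa using hε
  · exact contDiff_const.add (φ.contDiff.smul (contDiff_id.sub contDiff_const))
  · filter_upwards [φ.eventuallyEq_one] with y hy
    rw [hy]
    simp

/-- A diffeology whose locality axiom is phrased through germs. -/
abbrev mkDiffeology {X : Type*} (P : ∀ n : ℕ, (Eu n → X) → Prop)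
    (hconst : ∀ (n : ℕ) (x : X), P n fun _ => x)
    (hcomp : ∀ (n m : ℕ) (p : Eu m → X) (f : Eu n → Eu m), P m p → ContDiff ℝ ∞ f → P n (p ∘ f))
    (hloc : ∀ (n : ℕ) (p : Eu n → X), (∀ x, ∃ q, P n q ∧ p =ᶠ[𝓝 x] q) → P n p) :
    DiffeologicalSpace X where
  plots n := {p | P n p}
  constant_plots x := hconst _ x
  plot_reparam hp hf := hcomp _ _ _ _ hp hf
  locality {n p} hp := by
    refine hloc n p fun x => ?_
    obtain ⟨s, hs, hx, h⟩ := hp x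
    obtain ⟨f, hf, hf', hfx⟩ := exists_smooth_retract hs hx
    exact ⟨p ∘ f, h hf hf', hfx.mono fun y hy => by simp [hy]⟩

theorem isPlot_of_locally {X : Type*} [DiffeologicalSpace X] {n : ℕ} {p : Eu n → X}
    (h : ∀ x, ∃ q, IsPlot q ∧ p =ᶠ[𝓝 x] q) : IsPlot p := by
  refine DiffeologicalSpace.locality fun x => ?_
  obtain ⟨q, hq, hpq⟩ := h x
  obtain ⟨s, hs, hso, hx⟩ := eventually_nhds_iff.1 hpq
  refine ⟨s, hso, hx, fun {m f} hfs hf => ?_⟩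
  have : p ∘ f = q ∘ f := funext fun y => hs _ (hfs y)
  rw [this]
  exact isPlot_reparam hq hf

/-- The product diffeology. -/
instance prodDiffeology {X Y : Type*} [DiffeologicalSpace X] [DiffeologicalSpace Y] :
    DiffeologicalSpace (X × Y) :=
  mkDiffeology (fun _ p => (IsPlot fun x => (p x).1) ∧ IsPlot fun x => (p x).2)
    (fun _ _ => ⟨isPlot_const, isPlot_const⟩)
    (fun _ _ _ _ hp hf => ⟨isPlot_reparam hp.1 hf, isPlot_reparam hp.2 hf⟩)
    (fun _ _ h => ⟨isPlot_of_locally fun x => (h x).elim fun q hq =>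
        ⟨fun y => (q y).1, hq.1.1, hq.2.mono fun _ hy => congrArg Prod.fst hy⟩,
      isPlot_of_locally fun x => (h x).elim fun q hq =>
        ⟨fun y => (q y).2, hq.1.2, hq.2.mono fun _ hy => congrArg Prod.snd hy⟩⟩)

/-- The subspace diffeology. -/
instance subtypeDiffeology {X : Type*} [DiffeologicalSpace X] (S : X → Prop) :
    DiffeologicalSpace {x // S x} :=
  mkDiffeology (fun _ p => IsPlot fun x => (p x : X))
    (fun _ _ => isPlot_const)
    (fun _ _ _ _ hp hf => isPlot_reparam hp hf)
    (fun _ _ h => isPlot_of_locally fun x => (h x).elim fun q hq =>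
        ⟨fun y => (q y : X), hq.1, hq.2.mono fun _ hy => congrArg Subtype.val hy⟩)

/-- The quotient diffeology: plots are the maps that locally lift to plots. -/
instance quotientDiffeology {X : Type*} [DiffeologicalSpace X] (s : Setoid X) :
    DiffeologicalSpace (Quotient s) :=
  mkDiffeology
    (fun n p => ∀ x, ∃ q : Eu n → X, IsPlot q ∧ p =ᶠ[𝓝 x] fun y => Quotient.mk s (q y))
    (fun n x => fun _ => ⟨fun _ => x.out, isPlot_const,
      Filter.Eventually.of_forall fun _ => (Quotient.out_eq x).symm⟩)
    (fun n m p f hp hf x => by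
      obtain ⟨q, hq, h⟩ := hp (f x)
      exact ⟨q ∘ f, isPlot_reparam hq hf, hf.continuous.continuousAt.eventually h⟩)
    (fun n p h x => by
      obtain ⟨q, hq, h1⟩ := h x
      obtain ⟨r, hr, h2⟩ := hq x
      exact ⟨r, hr, h1.trans h2⟩)

/-- Smooth maps between diffeological spaces, `C^∞(X, Y)`. -/
structure SmoothMap (X Y : Type*) [DiffeologicalSpace X] [DiffeologicalSpace Y] where
  toFun : X → Y
  smooth : DSmooth toFun

instance {X Y : Type*} [DiffeologicalSpace X] [DiffeologicalSpace Y] :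
    FunLike (SmoothMap X Y) X Y where
  coe := SmoothMap.toFun
  coe_injective f g h := by cases f; cases g; congr

/-- The functional diffeology on `C^∞(X, Y)`: a family `p` of smooth maps is a plot if and only if
`(a, x) ↦ p a x` is smooth. -/
instance smoothMapDiffeology {X Y : Type*} [DiffeologicalSpace X] [DiffeologicalSpace Y] :
    DiffeologicalSpace (SmoothMap X Y) :=
  mkDiffeology (fun n p => DSmooth fun z : Eu n × X => p z.1 z.2)
    (fun _ f _ _ hq => f.smooth _ _ hq.2)
    (fun _ _ _ _ hp hf _ q hq => hp _ (fun a => (_, (q a).2)) ⟨hf.dSmooth _ _ hq.1, hq.2⟩)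
    (fun n p h m q hq => isPlot_of_locally fun a => by
      obtain ⟨r, hr, hpr⟩ := h (q a).1
      refine ⟨_, hr m q hq, ?_⟩
      have hc : Continuous fun b => (q b).1 := (IsPlot.contDiff hq.1).continuous
      filter_upwards [hc.continuousAt.eventually hpr] with b hb
      simp only [Function.comp]
      rw [hb])

/-! ### Manifolds, the circle, the group and its loop group -/

/-- Smooth finite-dimensional manifolds (Hausdorff, second countable, without boundary). -/
structure Man : Type (u + 1) where
  carrier : Type u
  dim : ℕ
  [top : TopologicalSpace carrier]
  [charted : ChartedSpace (EuclideanSpace ℝ (Fin dim)) carrier]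
  [isManifold : IsManifold (𝓡 dim) ∞ carrier]
  [t2 : T2Space carrier]
  [secondCountable : SecondCountableTopology carrier]

instance : CoeSort Man.{u} (Type u) := ⟨Man.carrier⟩

attribute [instance] Man.top Man.charted Man.isManifold Man.t2 Man.secondCountable

/-- The plots of a manifold are the smooth maps from Euclidean spaces. -/
instance manDiffeology (M : Man.{u}) : DiffeologicalSpace M :=
  mkDiffeology (fun n p => ContMDiff (𝓡 n) (𝓡 M.dim) ∞ p)
    (fun _ _ => contMDiff_const)
    (fun _ _ _ _ hp hf => hp.comp hf.contMDiff)
    (fun _ _ h x => (h x).elim fun _ hq => (hq.1 x).congr_of_eventuallyEq hq.2)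

/-- The circle `ℝ / 2πℤ`. -/
abbrev S1 : Type := Real.Angle

/-- The smooth structure of the circle: the quotient of that of `ℝ`. -/
instance circleDiffeology : DiffeologicalSpace S1 :=
  mkDiffeology
    (fun n p => ∀ x, ∃ f : Eu n → ℝ, ContDiff ℝ ∞ f ∧ p =ᶠ[𝓝 x] fun y => ((f y : ℝ) : Real.Angle))
    (fun n θ => fun _ => ⟨fun _ => θ.toReal, contDiff_const,
      Filter.Eventually.of_forall fun _ => (Real.Angle.coe_toReal θ).symm⟩)
    (fun n m p f hp hf x => by
      obtain ⟨q, hq, h⟩ := hp (f x)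
      exact ⟨q ∘ f, hq.comp hf, hf.continuous.continuousAt.eventually h⟩)
    (fun n p h x => by
      obtain ⟨q, hq, h1⟩ := h x
      obtain ⟨r, hr, h2⟩ := hq x
      exact ⟨r, hr, h1.trans h2⟩)

/-- The pull-back of `dθ` along a smooth map `θ : ℝⁿ → S¹`, at `x`, on the vector `v`. (The
representative in `(-π, π]` of `θ y - θ x` is smooth for `y` near `x`.) -/
def dAngle {n : ℕ} (θ : Eu n → S1) (x v : Eu n) : ℝ :=
  fderiv ℝ (fun y => (θ y - θ x).toReal) x v

section Lie

variable (G : Man.{u})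

/-- The Lie algebra `𝔤 = T₁G` as a vector space; Mathlib's tangent space of `G` at `1` is by
definition the model space of `G`. -/
abbrev LieAlg (G : Man.{u}) : Type := EuclideanSpace ℝ (Fin G.dim)

variable {G} [Group G]

/-- The adjoint action of `g` on `𝔤`: the derivative at `1` of conjugation by `g`. -/
def Ad (g : G) (ξ : LieAlg G) : LieAlg G :=
  mfderiv (𝓡 G.dim) (𝓡 G.dim) (fun h : G => g * h * g⁻¹) 1 ξ

/-- The pull-back of the left-invariant Maurer-Cartan form `Θ` of `G` along a smooth map
`κ : ℝⁿ → G`, at `x`, on the vector `v`: left translation to `1` of the derivative of `κ`. -/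
def maurerCartan {n : ℕ} (κ : Eu n → G) (x v : Eu n) : LieAlg G :=
  mfderiv (𝓡 n) (𝓡 G.dim) (fun y => (κ x)⁻¹ * κ y) x v

/-- The logarithmic derivative `γ⁻¹∂γ` of a loop, where `∂` is the derivative along the circle. -/
def logDeriv (γ : S1 → G) (θ : S1) : LieAlg G :=
  mfderiv 𝓘(ℝ, ℝ) (𝓡 G.dim) (fun t : ℝ => (γ θ)⁻¹ * γ (θ + (t : Real.Angle))) 0 (1 : ℝ)

variable (G)

/-- The based loop group `ΩG`: smooth maps `γ : S¹ → G` with `γ(0) = 1`. -/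
def LoopGroup : Type u := {γ : SmoothMap S1 G // γ 0 = 1}

instance : DiffeologicalSpace (LoopGroup G) :=
  inferInstanceAs (DiffeologicalSpace {γ : SmoothMap S1 G // γ 0 = 1})

instance : CoeFun (LoopGroup G) fun _ => S1 → G := ⟨fun γ => γ.1⟩

variable {G}

theorem LoopGroup.apply_zero (γ : LoopGroup G) : γ 0 = 1 := γ.2

theorem LoopGroup.ext {γ δ : LoopGroup G} (h : ∀ θ, γ θ = δ θ) : γ = δ :=
  Subtype.ext (DFunLike.ext _ _ h)

variable [LieGroup (𝓡 G.dim) ∞ G]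

instance : Group (LoopGroup G) where
  mul γ δ := ⟨⟨fun θ => γ θ * δ θ, fun n p hp =>
    ContMDiff.mul (I := 𝓡 G.dim) (γ.1.smooth n p hp) (δ.1.smooth n p hp)⟩,
    show γ.1 0 * δ.1 0 = 1 by rw [γ.2, δ.2, one_mul]⟩
  one := ⟨⟨fun _ => 1, fun _ _ _ => isPlot_const⟩, rfl⟩
  inv γ := ⟨⟨fun θ => (γ θ)⁻¹, fun n p hp =>
    ContMDiff.inv (I := 𝓡 G.dim) (γ.1.smooth n p hp)⟩, show (γ.1 0)⁻¹ = 1 by rw [γ.2, inv_one]⟩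
  mul_assoc _ _ _ := LoopGroup.ext fun _ => mul_assoc _ _ _
  one_mul _ := LoopGroup.ext fun _ => one_mul _
  mul_one _ := LoopGroup.ext fun _ => mul_one _
  inv_mul_cancel _ := LoopGroup.ext fun _ => inv_mul_cancel _

@[simp] theorem LoopGroup.mul_apply (γ δ : LoopGroup G) (θ : S1) : (γ * δ) θ = γ θ * δ θ := rfl
@[simp] theorem LoopGroup.one_apply (θ : S1) : (1 : LoopGroup G) θ = 1 := rfl
@[simp] theorem LoopGroup.inv_apply (γ : LoopGroup G) (θ : S1) : (γ⁻¹) θ = (γ θ)⁻¹ := rfl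

end Lie

/-! ### Principal bundles -/

/-- The data of a principal `K`-bundle over `B`: total space, projection and right action. -/
structure BundleData (K B : Type u) : Type (u + 1) where
  Total : Type u
  [diff : DiffeologicalSpace Total]
  proj : Total → B
  act : Total → K → Total

attribute [instance] BundleData.diff

/-- Smooth principal `K`-bundles over `B`: there is a smooth fibre-preserving right action and
the bundle is locally on `B` smoothly and equivariantly isomorphic to the trivial bundle. -/
structure BundleData.IsPrincipal {K B : Type u} [Group K] [DiffeologicalSpace K]
    [TopologicalSpace B] [DiffeologicalSpace B] (P : BundleData K B) : Prop where
  act_one : ∀ p, P.act p 1 = p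
  act_mul : ∀ p k l, P.act p (k * l) = P.act (P.act p k) l
  proj_act : ∀ p k, P.proj (P.act p k) = P.proj p
  smooth_proj : DSmooth P.proj
  smooth_act : DSmooth fun z : P.Total × K => P.act z.1 z.2
  locally_trivial : ∀ b : B, ∃ U : Set B, IsOpen U ∧ b ∈ U ∧
    ∃ t : {p : P.Total // P.proj p ∈ U} ≃ {b : B // b ∈ U} × K, DSmooth t ∧ DSmooth t.symm ∧
      (∀ p, ((t p).1 : B) = P.proj p.1) ∧
      ∀ (p : {p : P.Total // P.proj p ∈ U}) (k : K) (h : P.proj (P.act p.1 k) ∈ U),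
        (t ⟨P.act p.1 k, h⟩).2 = (t p).2 * k

namespace BundleData.IsPrincipal

variable {K B : Type u} [Group K] [DiffeologicalSpace K]
    [TopologicalSpace B] [DiffeologicalSpace B] {P : BundleData K B}

theorem proj_surjective (hP : P.IsPrincipal) : Function.Surjective P.proj := by
  intro b
  obtain ⟨U, -, hb, t, -, -, h, -⟩ := hP.locally_trivial b
  refine ⟨(t.symm (⟨b, hb⟩, 1)).1, ?_⟩
  rw [← h, Equiv.apply_symm_apply]

theorem exists_act_eq (hP : P.IsPrincipal) {p q : P.Total} (hpq : P.proj p = P.proj q) :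
    ∃ k, q = P.act p k := by
  obtain ⟨U, -, hb, t, -, -, h, ht⟩ := hP.locally_trivial (P.proj p)
  have hq : P.proj q ∈ U := hpq ▸ hb
  refine ⟨(t ⟨p, hb⟩).2⁻¹ * (t ⟨q, hq⟩).2, ?_⟩
  have hb' : P.proj (P.act p ((t ⟨p, hb⟩).2⁻¹ * (t ⟨q, hq⟩).2)) ∈ U := by
    rw [hP.proj_act]
    exact hb
  have : t ⟨q, hq⟩ = t ⟨P.act p ((t ⟨p, hb⟩).2⁻¹ * (t ⟨q, hq⟩).2), hb'⟩ := by
    refine Prod.ext (Subtype.ext ?_) ?_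
    · rw [h, h, hP.proj_act, hpq]
    · rw [ht ⟨p, hb⟩, mul_inv_cancel_left]
  exact congrArg Subtype.val (t.injective this)

end BundleData.IsPrincipal

section Objects

variable (G : Man.{u}) [Group G] [LieGroup (𝓡 G.dim) ∞ G]

/-- An `ΩG`-bundle over a manifold. -/
structure LoopBundle : Type (u + 1) where
  base : Man.{u}
  bundle : BundleData (LoopGroup G) base
  principal : bundle.IsPrincipal

/-- A framing over `M × {0}` of a bundle over `M × S¹`: a smooth section `s` over `M × {0}`,
written as a map on `M`. -/
structure IsFraming {G M : Man.{u}} (P : BundleData G (M × S1)) (s : M → P.Total) : Prop where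
  smooth : DSmooth s
  section_ : ∀ m, P.proj (s m) = (m, 0)

/-- A framed `G`-bundle over `M × S¹`, for a manifold `M`. -/
structure FramedBundle : Type (u + 1) where
  base : Man.{u}
  bundle : BundleData G (base × S1)
  principal : bundle.IsPrincipal
  frame : base → bundle.Total
  framing : IsFraming bundle frame

variable {G}

/-- `ΩG`-bundle maps: smooth equivariant maps covering a smooth map of the bases. -/
@[ext] structure LoopBundle.Hom (P Q : LoopBundle G) : Type u where
  toFun : P.bundle.Total → Q.bundle.Total
  baseMap : P.base → Q.base
  smooth : DSmooth toFun
  smooth_base : ContMDiff (𝓡 P.base.dim) (𝓡 Q.base.dim) ∞ baseMap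
  equivariant : ∀ p γ, toFun (P.bundle.act p γ) = Q.bundle.act (toFun p) γ
  covers : ∀ p, Q.bundle.proj (toFun p) = baseMap (P.bundle.proj p)

/-- Maps of framed bundles: smooth equivariant maps covering a map of the form `f × id` with `f`
smooth, and preserving the framings. -/
@[ext] structure FramedBundle.Hom (P Q : FramedBundle G) : Type u where
  toFun : P.bundle.Total → Q.bundle.Total
  baseMap : P.base → Q.base
  smooth : DSmooth toFun
  smooth_base : ContMDiff (𝓡 P.base.dim) (𝓡 Q.base.dim) ∞ baseMap
  equivariant : ∀ p g, toFun (P.bundle.act p g) = Q.bundle.act (toFun p) g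
  covers : ∀ p, Q.bundle.proj (toFun p) =
    (baseMap (P.bundle.proj p).1, (P.bundle.proj p).2)
  map_frame : ∀ m, toFun (P.frame m) = Q.frame (baseMap m)

/-- The category of `ΩG`-bundles. -/
instance : Category (LoopBundle G) where
  Hom := LoopBundle.Hom
  id P := ⟨id, id, dSmooth_id, contMDiff_id, fun _ _ => rfl, fun _ => rfl⟩
  comp f g := ⟨g.toFun ∘ f.toFun, g.baseMap ∘ f.baseMap, g.smooth.comp f.smooth,
    g.smooth_base.comp f.smooth_base,
    fun p γ => by simp [f.equivariant, g.equivariant],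
    fun p => by simp [f.covers, g.covers]⟩

/-- The category of framed `G`-bundles over manifolds of the form `M × S¹`. -/
instance : Category (FramedBundle G) where
  Hom := FramedBundle.Hom
  id P := ⟨id, id, dSmooth_id, contMDiff_id, fun _ _ => rfl, fun _ => rfl, fun _ => rfl⟩
  comp f g := ⟨g.toFun ∘ f.toFun, g.baseMap ∘ f.baseMap, g.smooth.comp f.smooth,
    g.smooth_base.comp f.smooth_base,
    fun p γ => by simp [f.equivariant, g.equivariant],
    fun p => by simp [f.covers, g.covers],
    fun m => by simp [f.map_frame, g.map_frame]⟩

end Objects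

/-! ### Connections and Higgs fields

A differential one-form on a diffeological space `X` is given by its pull-backs along all plots
`p : ℝⁿ → X`; the value of the pull-back at `x` on the vector `v` is written `A p x v`, that is,
`A p x v` is the form evaluated on the tangent vector `dp_x(v)` of `X` at `p x`. On a manifold
(also a Fréchet manifold) these are the usual one-forms. Values on maps that are not plots are
irrelevant. -/

/-- `A` is a smooth one-form on `X` with values in the normed space `W`. -/
structure IsOneForm {X W : Type*} [DiffeologicalSpace X] [NormedAddCommGroup W] [NormedSpace ℝ W]
    (A : ∀ {n : ℕ}, (Eu n → X) → Eu n → Eu n → W) : Prop where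
  linear : ∀ {n : ℕ} (p : Eu n → X), IsPlot p → ∀ x, IsLinearMap ℝ (A p x)
  smooth : ∀ {n : ℕ} (p : Eu n → X), IsPlot p →
    ContDiff ℝ ∞ fun z : Eu n × Eu n => A p z.1 z.2
  pullback : ∀ {m n : ℕ} (p : Eu n → X) (f : Eu m → Eu n), IsPlot p → ContDiff ℝ ∞ f →
    ∀ x v, A (p ∘ f) x v = A p (f x) (fderiv ℝ f x v)

section Connections

variable {G : Man.{u}} [Group G]

/-- `A` is a smooth one-form on `X` with values in the Lie algebra `Ω𝔤` of smooth loops in `𝔤` that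
vanish at `0`; `A p x v θ` is the value at `θ` of the loop `A p x v`. -/
structure IsLoopOneForm {X : Type*} [DiffeologicalSpace X]
    (A : ∀ {n : ℕ}, (Eu n → X) → Eu n → Eu n → S1 → LieAlg G) : Prop where
  based : ∀ {n : ℕ} (p : Eu n → X), IsPlot p → ∀ x v, A p x v 0 = 0
  linear : ∀ {n : ℕ} (p : Eu n → X), IsPlot p → ∀ x, IsLinearMap ℝ (A p x)
  smooth : ∀ {n : ℕ} (p : Eu n → X), IsPlot p →
    ContDiff ℝ ∞ fun z : Eu n × Eu n × ℝ => A p z.1 z.2.1 (z.2.2 : Real.Angle)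
  pullback : ∀ {m n : ℕ} (p : Eu n → X) (f : Eu m → Eu n), IsPlot p → ContDiff ℝ ∞ f →
    ∀ x v, A (p ∘ f) x v = A p (f x) (fderiv ℝ f x v)

/-- A connection on a principal `G`-bundle: a `𝔤`-valued one-form which is equivariant and whose
restriction to each orbit is the Maurer-Cartan form (so that it sends the fundamental vector
field generated by `ζ` to `ζ`). -/
structure IsConnection {B : Type u} (P : BundleData G B)
    (A : ∀ {n : ℕ}, (Eu n → P.Total) → Eu n → Eu n → LieAlg G) : Prop where
  form : IsOneForm A
  equivariant : ∀ {n : ℕ} (p : Eu n → P.Total), IsPlot p → ∀ (g : G) x v,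
    A (fun y => P.act (p y) g) x v = Ad g⁻¹ (A p x v)
  vertical : ∀ (p : P.Total) {n : ℕ} (κ : Eu n → G), IsPlot κ → ∀ x v,
    A (fun y => P.act p (κ y)) x v = maurerCartan κ x v

variable [LieGroup (𝓡 G.dim) ∞ G]

/-- A connection on a principal `ΩG`-bundle: an `Ω𝔤`-valued one-form which is equivariant and
restricts to the Maurer-Cartan form of `ΩG` on each orbit. -/
structure IsLoopConnection {B : Type u} (P : BundleData (LoopGroup G) B)
    (A : ∀ {n : ℕ}, (Eu n → P.Total) → Eu n → Eu n → S1 → LieAlg G) : Prop where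
  form : IsLoopOneForm A
  equivariant : ∀ {n : ℕ} (p : Eu n → P.Total), IsPlot p → ∀ (γ : LoopGroup G) x v θ,
    A (fun y => P.act (p y) γ) x v θ = Ad (γ θ)⁻¹ (A p x v θ)
  vertical : ∀ (p : P.Total) {n : ℕ} (κ : Eu n → LoopGroup G), IsPlot κ → ∀ x v θ,
    A (fun y => P.act p (κ y)) x v θ = maurerCartan (fun y => κ y θ) x v

/-- A Higgs field on an `ΩG`-bundle: a smooth map `Φ` to the smooth loops in `𝔤` with
`Φ(pγ) = ad(γ⁻¹)Φ(p) + γ⁻¹∂γ`. -/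
structure IsHiggs {B : Type u} (P : BundleData (LoopGroup G) B)
    (Φ : P.Total → S1 → LieAlg G) : Prop where
  smooth : ∀ {n : ℕ} (p : Eu n → P.Total), IsPlot p →
    ContDiff ℝ ∞ fun z : Eu n × ℝ => Φ (p z.1) (z.2 : Real.Angle)
  equivariant : ∀ (p : P.Total) (γ : LoopGroup G) (θ : S1),
    Φ (P.act p γ) θ = Ad (γ θ)⁻¹ (Φ p θ) + logDeriv γ θ

/-- A connection on a bundle over `M × S¹` framed by `s` is framed if `s^*A = 0`. -/
structure IsFramedConnection {M : Man.{u}} (P : BundleData G (M × S1)) (s : M → P.Total)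
    (A : ∀ {n : ℕ}, (Eu n → P.Total) → Eu n → Eu n → LieAlg G) : Prop where
  connection : IsConnection P A
  framed : ∀ {n : ℕ} (c : Eu n → M), IsPlot c → ∀ x v, A (s ∘ c) x v = 0

variable (G)

/-- An `ΩG`-bundle with connection and Higgs field. -/
structure LoopBundleC : Type (u + 1) extends LoopBundle G where
  conn : ∀ {n : ℕ}, (Eu n → bundle.Total) → Eu n → Eu n → S1 → LieAlg G
  isConn : IsLoopConnection bundle conn
  higgs : bundle.Total → S1 → LieAlg G
  isHiggs : IsHiggs bundle higgs

/-- A framed `G`-bundle over `M × S¹` with framed connection. -/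
structure FramedBundleC : Type (u + 1) extends FramedBundle G where
  conn : ∀ {n : ℕ}, (Eu n → bundle.Total) → Eu n → Eu n → LieAlg G
  isConn : IsFramedConnection bundle frame conn

variable {G}

/-- An `ΩG`-bundle map preserves the connections and the Higgs fields. -/
structure LoopBundleC.Preserves (P Q : LoopBundleC G)
    (f : P.toLoopBundle ⟶ Q.toLoopBundle) : Prop where
  conn : ∀ {n : ℕ} (p : Eu n → P.bundle.Total), IsPlot p → ∀ x v,
    Q.conn (f.toFun ∘ p) x v = P.conn p x v
  higgs : ∀ p, Q.higgs (f.toFun p) = P.higgs p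

/-- A map of framed `G`-bundles preserves the connections. -/
def FramedBundleC.Preserves (P Q : FramedBundleC G)
    (f : P.toFramedBundle ⟶ Q.toFramedBundle) : Prop :=
  ∀ {n : ℕ} (p : Eu n → P.bundle.Total), IsPlot p → ∀ x v,
    Q.conn (f.toFun ∘ p) x v = P.conn p x v

/-- The category of `ΩG`-bundles with connection and Higgs field. -/
instance : Category (LoopBundleC G) where
  Hom P Q := {f : P.toLoopBundle ⟶ Q.toLoopBundle // LoopBundleC.Preserves P Q f}
  id P := ⟨𝟙 P.toLoopBundle, fun _ _ _ _ => rfl, fun _ => rfl⟩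
  comp f g := ⟨f.1 ≫ g.1,
    fun p hp x v => (g.2.conn _ (f.1.smooth _ _ hp) x v).trans (f.2.conn p hp x v),
    fun p => (g.2.higgs _).trans (f.2.higgs p)⟩

/-- The category of framed `G`-bundles over manifolds `M × S¹` with framed connection. -/
instance : Category (FramedBundleC G) where
  Hom P Q := {f : P.toFramedBundle ⟶ Q.toFramedBundle // FramedBundleC.Preserves P Q f}
  id P := ⟨𝟙 P.toFramedBundle, fun _ _ _ _ => rfl⟩
  comp f g := ⟨f.1 ≫ g.1,
    fun p hp x v => (g.2 _ (f.1.smooth _ _ hp) x v).trans (f.2 p hp x v)⟩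

variable (G)

/-- Forgetting the connection and the Higgs field. -/
def LoopBundleC.forget : LoopBundleC G ⥤ LoopBundle G where
  obj P := P.toLoopBundle
  map f := f.1

/-- Forgetting the connection. -/
def FramedBundleC.forget : FramedBundleC G ⥤ FramedBundle G where
  obj P := P.toFramedBundle
  map f := f.1

end Connections

/-! ### The caloron transform `𝒞` -/

section Transform

variable {G : Man.{u}} [Group G] [LieGroup (𝓡 G.dim) ∞ G]

/-- The orbit relation of the action `(p, g, θ)γ = (pγ, γ(θ)⁻¹g, θ)` of `ΩG` on `P × G × S¹`. -/
def orbitRel (P : LoopBundle G) : Setoid (P.bundle.Total × G × S1) where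
  r a b := ∃ γ : LoopGroup G, b = (P.bundle.act a.1 γ, (γ a.2.2)⁻¹ * a.2.1, a.2.2)
  iseqv :=
    { refl := fun a => ⟨1, by simp [P.principal.act_one]⟩
      symm := by
        rintro ⟨p, g, θ⟩ _ ⟨γ, rfl⟩
        exact ⟨γ⁻¹, by simp [← P.principal.act_mul, P.principal.act_one]⟩
      trans := by
        rintro ⟨p, g, θ⟩ _ _ ⟨γ, rfl⟩ ⟨δ, rfl⟩
        exact ⟨γ * δ, by simp [← P.principal.act_mul, mul_assoc]⟩ }

/-- The class `[p, g, θ]` in `(P × G × S¹) / ΩG`. -/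
def mk (P : LoopBundle G) (p : P.bundle.Total) (g : G) (θ : S1) : Quotient (orbitRel P) :=
  Quotient.mk (orbitRel P) (p, g, θ)

/-- The bundle `(P × G × S¹) / ΩG → M × S¹`, `[p, g, θ] ↦ (π(p), θ)`, with the action
`[p, g, θ]h = [p, gh, θ]` of `G`. -/
def caloronData (P : LoopBundle G) : BundleData G (P.base × S1) where
  Total := Quotient (orbitRel P)
  diff := quotientDiffeology (orbitRel P)
  proj := Quotient.lift (fun a => (P.bundle.proj a.1, a.2.2)) (by
    rintro ⟨p, g, θ⟩ _ ⟨γ, rfl⟩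
    simp [P.principal.proj_act])
  act q h := Quotient.map' (s₁ := orbitRel P) (s₂ := orbitRel P)
    (fun a => (a.1, a.2.1 * h, a.2.2)) (by
      rintro ⟨p, g, θ⟩ _ ⟨γ, rfl⟩
      exact ⟨γ, by simp [mul_assoc]⟩) q

/-- The framing `s₀(m, 0) = [p, 1, 0]`, for any `p` in the fibre over `m`. -/
def caloronFrame (P : LoopBundle G) (m : P.base) : (caloronData P).Total :=
  mk P (P.principal.proj_surjective m).choose 1 0

theorem caloronFrame_proj (P : LoopBundle G) (p : P.bundle.Total) :
    caloronFrame P (P.bundle.proj p) = mk P p 1 0 := by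
  have h := (P.principal.proj_surjective (P.bundle.proj p)).choose_spec
  obtain ⟨γ, hγ⟩ := P.principal.exists_act_eq h
  refine Quotient.sound ⟨γ, ?_⟩
  simp [← hγ, LoopGroup.apply_zero]

/-- `𝒞(P)`, given that the construction yields a framed bundle. -/
def caloronObj
    (hC : ∀ P : LoopBundle G, (caloronData P).IsPrincipal ∧
      IsFraming (caloronData P) (caloronFrame P))
    (P : LoopBundle G) : FramedBundle G where
  base := P.base
  bundle := caloronData P
  principal := (hC P).1
  frame := caloronFrame P
  framing := (hC P).2

/-- `𝒞` on morphisms: `[p, g, θ] ↦ [f(p), g, θ]`. -/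
def caloronMap
    (hC : ∀ P : LoopBundle G, (caloronData P).IsPrincipal ∧
      IsFraming (caloronData P) (caloronFrame P))
    {P Q : LoopBundle G} (f : P ⟶ Q) : FramedBundle.Hom (caloronObj hC P) (caloronObj hC Q) where
  toFun := Quotient.map' (s₁ := orbitRel P) (s₂ := orbitRel Q)
    (fun a => (f.toFun a.1, a.2.1, a.2.2)) (by
      rintro ⟨p, g, θ⟩ _ ⟨γ, rfl⟩
      exact ⟨γ, by simp [f.equivariant]⟩)
  baseMap := f.baseMap
  smooth := fun n p hp x => by
    obtain ⟨q, hq, h⟩ := hp x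
    refine ⟨fun y => (f.toFun (q y).1, (q y).2), ⟨f.smooth _ _ hq.1, hq.2⟩, ?_⟩
    filter_upwards [h] with y hy
    simp only [Function.comp]
    rw [hy]
    rfl
  smooth_base := f.smooth_base
  equivariant := by
    rintro ⟨p, g, θ⟩ h
    rfl
  covers := by
    rintro ⟨p, g, θ⟩
    exact Prod.ext (f.covers p) rfl
  map_frame := fun m => by
    obtain ⟨p, rfl⟩ := P.principal.proj_surjective m
    refine (congrArg _ (caloronFrame_proj P p)).trans ?_
    refine Eq.trans ?_ (congrArg _ (f.covers p))
    exact (caloronFrame_proj Q (f.toFun p)).symm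

/-- The caloron transform `𝒞` from `ΩG`-bundles to framed `G`-bundles. -/
def caloron
    (hC : ∀ P : LoopBundle G, (caloronData P).IsPrincipal ∧
      IsFraming (caloronData P) (caloronFrame P)) : LoopBundle G ⥤ FramedBundle G where
  obj := caloronObj hC
  map f := caloronMap hC f
  map_id P := FramedBundle.Hom.ext (funext (by rintro ⟨p, g, θ⟩; rfl)) rfl
  map_comp f g := FramedBundle.Hom.ext (funext (by rintro ⟨p, g, θ⟩; rfl)) rfl

/-- The pull-back to `ℝⁿ`, along a plot `q = (p, g, θ)` of `P × G × S¹`, of the form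
`ad(g⁻¹)A(θ) + Θ + ad(g⁻¹)Φ dθ`. -/
def caloronForm (P : LoopBundleC G) {n : ℕ} (q : Eu n → P.bundle.Total × G × S1)
    (x v : Eu n) : LieAlg G :=
  Ad (q x).2.1⁻¹ (P.conn (fun y => (q y).1) x v (q x).2.2)
    + maurerCartan (fun y => (q y).2.1) x v
    + dAngle (fun y => (q y).2.2) x v • Ad (q x).2.1⁻¹ (P.higgs (q x).1 (q x).2.2)

open Classical in
/-- The form on `(P × G × S¹) / ΩG` induced by `ad(g⁻¹)A(θ) + Θ + ad(g⁻¹)Φ dθ`, computed on a local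
lift of a plot of the quotient to a plot of `P × G × S¹`. -/
def caloronConn (P : LoopBundleC G) {n : ℕ}
    (p : Eu n → (caloronData P.toLoopBundle).Total) (x v : Eu n) : LieAlg G :=
  if h : ∃ q : Eu n → P.bundle.Total × G × S1, IsPlot q ∧
      p =ᶠ[𝓝 x] fun y => Quotient.mk (orbitRel P.toLoopBundle) (q y) then
    caloronForm P h.choose x v
  else 0

/-- The caloron transform from `ΩG`-bundles with connection and Higgs field to framed `G`-bundles
with framed connection, given that the constructions have the required properties. -/
def caloronC
    (hC : ∀ P : LoopBundle G, (caloronData P).IsPrincipal ∧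
      IsFraming (caloronData P) (caloronFrame P))
    (hA : ∀ P : LoopBundleC G, IsFramedConnection (caloronData P.toLoopBundle)
      (caloronFrame P.toLoopBundle) (caloronConn P))
    (hmap : ∀ (P Q : LoopBundleC G) (f : P ⟶ Q),
      FramedBundleC.Preserves ⟨(caloron hC).obj P.toLoopBundle, caloronConn P, hA P⟩
        ⟨(caloron hC).obj Q.toLoopBundle, caloronConn Q, hA Q⟩ ((caloron hC).map f.1)) :
    LoopBundleC G ⥤ FramedBundleC G where
  obj P := ⟨(caloron hC).obj P.toLoopBundle, caloronConn P, hA P⟩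
  map {P Q} f := ⟨(caloron hC).map f.1, hmap P Q f⟩
  map_id P := Subtype.ext ((caloron hC).map_id P.toLoopBundle)
  map_comp f g := Subtype.ext ((caloron hC).map_comp f.1 g.1)

/-! ### The inverse caloron transform `𝒞⁻¹` -/

/-- The total space of the pull-back along `η(m)(θ) = (m, θ)` of the loop bundle: pairs of `m ∈ M`
and a smooth loop `f` in the framed bundle with `π(f(θ)) = (m, θ)` starting in the image of the
framing. -/
def LoopTotal (Q : FramedBundle G) : Type u :=
  {a : Q.base × SmoothMap S1 Q.bundle.Total //
    (∀ θ, Q.bundle.proj (a.2 θ) = (a.1, θ)) ∧ a.2 0 ∈ Set.range Q.frame}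

instance (Q : FramedBundle G) : DiffeologicalSpace (LoopTotal Q) :=
  inferInstanceAs (DiffeologicalSpace {a : Q.base × SmoothMap S1 Q.bundle.Total //
    (∀ θ, Q.bundle.proj (a.2 θ) = (a.1, θ)) ∧ a.2 0 ∈ Set.range Q.frame})

/-- The loop underlying a point of `𝒞⁻¹(Q)`. -/
def LoopTotal.loop {Q : FramedBundle G} (a : LoopTotal Q) (θ : S1) : Q.bundle.Total := a.1.2 θ

theorem LoopTotal.ext {Q : FramedBundle G} {a b : LoopTotal Q} (h : ∀ θ, a.loop θ = b.loop θ) :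
    a = b := by
  have h0 := congrArg Q.bundle.proj (h 0)
  have h1 := (a.2.1 0).symm.trans (h0.trans (b.2.1 0))
  exact Subtype.ext (Prod.ext (Prod.ext_iff.1 h1).1 (DFunLike.ext _ _ h))

/-- The `ΩG`-bundle `η^*Ω(Q) → M`, with the pointwise action of `ΩG`. -/
def invCaloronData (Q : FramedBundle G) : BundleData (LoopGroup G) Q.base where
  Total := LoopTotal Q
  proj a := a.1.1
  act a γ := ⟨(a.1.1, ⟨fun θ => Q.bundle.act (a.loop θ) (γ θ), fun n p hp =>
      Q.principal.smooth_act n (fun y => (a.loop (p y), γ (p y)))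
        ⟨a.1.2.smooth n p hp, γ.1.smooth n p hp⟩⟩),
    fun θ => (Q.principal.proj_act _ _).trans (a.2.1 θ), by
      show Q.bundle.act (a.loop 0) (γ 0) ∈ _
      rw [LoopGroup.apply_zero, Q.principal.act_one]
      exact a.2.2⟩

/-- `𝒞⁻¹(Q)`, given that the construction yields an `ΩG`-bundle. -/
def invCaloronObj (hF : ∀ Q : FramedBundle G, (invCaloronData Q).IsPrincipal)
    (Q : FramedBundle G) : LoopBundle G where
  base := Q.base
  bundle := invCaloronData Q
  principal := hF Q

/-- `𝒞⁻¹` on morphisms: composition of loops with the bundle map. -/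
def invCaloronMap (hF : ∀ Q : FramedBundle G, (invCaloronData Q).IsPrincipal)
    {Q R : FramedBundle G} (f : Q ⟶ R) :
    LoopBundle.Hom (invCaloronObj hF Q) (invCaloronObj hF R) where
  toFun a := ⟨(f.baseMap a.1.1, ⟨fun θ => f.toFun (a.1.2 θ), f.smooth.comp a.1.2.smooth⟩),
    fun θ => by
      show R.bundle.proj (f.toFun (a.1.2 θ)) = _
      rw [f.covers, a.2.1], by
      obtain ⟨m, hm⟩ := a.2.2
      exact ⟨f.baseMap m, by rw [← f.map_frame, hm]; rfl⟩⟩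
  baseMap := f.baseMap
  smooth := fun n p hp =>
    ⟨f.smooth_base.comp hp.1, fun m q hq => f.smooth m _ (hp.2 m q hq)⟩
  smooth_base := f.smooth_base
  equivariant a γ := LoopTotal.ext fun θ => f.equivariant _ _
  covers _ := rfl

/-- The inverse caloron transform `𝒞⁻¹` from framed `G`-bundles to `ΩG`-bundles. -/
def invCaloron (hF : ∀ Q : FramedBundle G, (invCaloronData Q).IsPrincipal) :
    FramedBundle G ⥤ LoopBundle G where
  obj := invCaloronObj hF
  map f := invCaloronMap hF f
  map_id _ := rfl
  map_comp _ _ := rfl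

/-- The connection on `𝒞⁻¹(Q)`, acting pointwise: `A(X)(θ) = Ã(X(θ))`. -/
def invCaloronConn (Q : FramedBundleC G) {n : ℕ}
    (p : Eu n → (invCaloronData Q.toFramedBundle).Total) (x v : Eu n) (θ : S1) : LieAlg G :=
  Q.conn (fun y => LoopTotal.loop (p y) θ) x v

/-- The Higgs field `Φ(f) = Ã(∂f)` on `𝒞⁻¹(Q)`: the connection form evaluated on the velocity at
`t = 0` of the curve `t ↦ f(θ + t)`. -/
def invCaloronHiggs (Q : FramedBundleC G)
    (a : (invCaloronData Q.toFramedBundle).Total) (θ : S1) : LieAlg G :=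
  Q.conn (n := 1) (fun t => LoopTotal.loop a (θ + (t 0 : Real.Angle))) 0
    (EuclideanSpace.single 0 1)

/-- The inverse caloron transform from framed `G`-bundles with framed connection to `ΩG`-bundles
with connection and Higgs field, given that the constructions have the required properties. -/
def invCaloronC (hF : ∀ Q : FramedBundle G, (invCaloronData Q).IsPrincipal)
    (hA : ∀ Q : FramedBundleC G,
      IsLoopConnection (invCaloronData Q.toFramedBundle) (invCaloronConn Q))
    (hΦ : ∀ Q : FramedBundleC G, IsHiggs (invCaloronData Q.toFramedBundle) (invCaloronHiggs Q))
    (hmap : ∀ (Q R : FramedBundleC G) (f : Q ⟶ R),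
      LoopBundleC.Preserves
        ⟨(invCaloron hF).obj Q.toFramedBundle, invCaloronConn Q, hA Q, invCaloronHiggs Q, hΦ Q⟩
        ⟨(invCaloron hF).obj R.toFramedBundle, invCaloronConn R, hA R, invCaloronHiggs R, hΦ R⟩
        ((invCaloron hF).map f.1)) :
    FramedBundleC G ⥤ LoopBundleC G where
  obj Q := ⟨(invCaloron hF).obj Q.toFramedBundle, invCaloronConn Q, hA Q, invCaloronHiggs Q, hΦ Q⟩
  map {Q R} f := ⟨(invCaloron hF).map f.1, hmap Q R f⟩
  map_id Q := Subtype.ext ((invCaloron hF).map_id Q.toFramedBundle)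
  map_comp f g := Subtype.ext ((invCaloron hF).map_comp f.1 g.1)

end Transform

end Caloron

end

/-!
Smoothness is tested on plots, that is, smooth families indexed by Euclidean spaces. All
constructions are local in the parameters, so it suffices to produce the germs of plots
(`PlotAt`), and near a point a germ is extended by composing it with a smooth map which is the
identity near the point and has values in a given neighbourhood.

*Bundles.* A local section `s` of an `ΩG`-bundle `P` gives the local section `(m, θ) ↦ [s m, 1, θ]`
of its transform, so this is a principal `G`-bundle, with the framing `m ↦ [s m, 1, 0]`
(`caloronData_isPrincipal`). The converse needs that `G` is connected: for a framed bundle `Q` over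
`M × S¹` one has to find, near each `m`, sections over the whole circle that start in the framing.
Local sections over short arcs are glued to a section over `U × [-π, π]` (`hasSection`). The values
at the two ends differ by a function on `U` with values in `G`; after shrinking `U`, a smooth
family of paths in `G` from `1` to the values of this function (`exists_smooth_paths`) is used to
make the section periodic (`exists_framed_section`). Such a section is a local section of the
bundle of loops, which is therefore principal (`invCaloronData_isPrincipal`). The maps
`p ↦ (θ ↦ [p, 1, θ])` and `[f, g, θ] ↦ f(θ)g` are bundle maps over the identity, natural by
inspection, and a bundle map of principal bundles over the identity is invertible
(`exists_smooth_inverse`). These are `α⁻¹` and `β`.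

*Connections.* The derivatives of `G`-valued maps are all expressed by the left logarithmic
derivative `mc`, computed in the chart at `1`; there the rules
`mc (fg) = ad(g⁻¹) mc f + mc g` and `mc (f⁻¹) = -ad(f) mc f` come from the linearization of the
multiplication at the identity. For a family of loops evaluated at a varying angle, `mc` is the sum
of the contribution of the family and of the logarithmic derivative of the loop times `dθ`
(`mc_loop_apply`). This last term is exactly what the inhomogeneous term in the transformation law
of the Higgs field cancels, so `ad(g⁻¹)A + Θ + ad(g⁻¹)Φ dθ` is invariant under every smooth family
of elements of `ΩG` (`caloronForm_act`). As any two lifts of a plot of the quotient differ locally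
by such a family, the form descends (`caloronConn_eq`), and the properties of a framed connection
are read off from lifts. Conversely the restrictions of a connection on `Q` to the loops and along
the loops are a connection and a Higgs field. The splitting
`A(f(θ)) = A(f)(θ) + Φ(f)(θ) dθ` of a form along a two-parameter family (`conn_loop_apply`) and the
Leibniz rule (`IsConnection.act`) show that `β` preserves the connections; for `α⁻¹` one puts
`g = 1` in the form. Since the inverse of a bundle map that preserves the data preserves them as
well, `α` and `β` are also natural isomorphisms of functors between the categories of bundles with
connection.
-/

namespace Caloron

/-! ### Germs of plots -/

section PlotAt

variable {X Y Z : Type*} [DiffeologicalSpace X] [DiffeologicalSpace Y] [DiffeologicalSpace Z]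
  {n m : ℕ}

/-- The germ of `p` at `x` is the germ of a plot. -/
def PlotAt (p : Eu n → X) (x : Eu n) : Prop := ∃ q : Eu n → X, IsPlot q ∧ p =ᶠ[𝓝 x] q

theorem PlotAt.of_isPlot {p : Eu n → X} (hp : IsPlot p) (x : Eu n) : PlotAt p x :=
  ⟨p, hp, .rfl⟩

theorem isPlot_of_plotAt {p : Eu n → X} (hp : ∀ x, PlotAt p x) : IsPlot p :=
  isPlot_of_locally hp

theorem PlotAt.congr {p q : Eu n → X} {x : Eu n} (hp : PlotAt p x) (h : q =ᶠ[𝓝 x] p) :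
    PlotAt q x :=
  hp.elim fun r hr => ⟨r, hr.1, h.trans hr.2⟩

/-- Near any point where `P` holds eventually, the identity extends to a smooth map with values in
the set where `P` holds. -/
theorem exists_retract_of_eventually {P : Eu n → Prop} {x : Eu n} (h : ∀ᶠ y in 𝓝 x, P y) :
    ∃ r : Eu n → Eu n, ContDiff ℝ ∞ r ∧ (∀ y, P (r y)) ∧ ∀ᶠ y in 𝓝 x, r y = y := by
  obtain ⟨s, hs, hso, hx⟩ := eventually_nhds_iff.1 h
  obtain ⟨r, hr, hr', hrx⟩ := exists_smooth_retract hso hx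
  exact ⟨r, hr', fun y => hs _ (hr y), hrx⟩

theorem PlotAt.dSmooth_comp {p : Eu n → X} {x : Eu n} (hp : PlotAt p x) {f : X → Y}
    (hf : DSmooth f) : PlotAt (fun y => f (p y)) x := by
  obtain ⟨q, hq, h⟩ := hp
  exact ⟨f ∘ q, hf _ _ hq, h.mono fun y hy => congrArg f hy⟩

theorem PlotAt.prodMk {p : Eu n → X} {q : Eu n → Y} {x : Eu n} (hp : PlotAt p x)
    (hq : PlotAt q x) : PlotAt (fun y => (p y, q y)) x := by
  obtain ⟨p', hp', h⟩ := hp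
  obtain ⟨q', hq', h'⟩ := hq
  refine ⟨fun y => (p' y, q' y), ⟨hp', hq'⟩, ?_⟩
  filter_upwards [h, h'] with y hy hy'
  rw [hy, hy']

theorem isPlot_prodMk {p : Eu n → X} {q : Eu n → Y} (hp : IsPlot p) (hq : IsPlot q) :
    IsPlot fun y => (p y, q y) := ⟨hp, hq⟩

theorem isPlot_subtype_iff {S : X → Prop} {p : Eu n → {x // S x}} :
    IsPlot p ↔ IsPlot fun x => (p x : X) := Iff.rfl

theorem dSmooth_fst : DSmooth (Prod.fst : X × Y → X) := fun _ _ h => h.1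

theorem dSmooth_snd : DSmooth (Prod.snd : X × Y → Y) := fun _ _ h => h.2

theorem DSmooth.prodMk {f : X → Y} {g : X → Z} (hf : DSmooth f) (hg : DSmooth g) :
    DSmooth fun x => (f x, g x) := fun _ _ h => ⟨hf _ _ h, hg _ _ h⟩

/-- A function, possibly with irrelevant values outside of `S`, is smooth near the points
of `S`. -/
def SmoothOn (f : X → Y) (S : Set X) : Prop :=
  ∀ (n : ℕ) (p : Eu n → X), IsPlot p → ∀ x, p x ∈ S → PlotAt (fun y => f (p y)) x

theorem SmoothOn.plotAt {f : X → Y} {S : Set X} (hf : SmoothOn f S) {p : Eu n → X} {x : Eu n}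
    (hp : PlotAt p x) (hx : p x ∈ S) : PlotAt (fun y => f (p y)) x := by
  obtain ⟨q, hq, h⟩ := hp
  exact (hf n q hq x (h.eq_of_nhds ▸ hx)).congr (h.mono fun y hy => congrArg f hy)

theorem SmoothOn.mono {f : X → Y} {S T : Set X} (hf : SmoothOn f S) (h : T ⊆ S) : SmoothOn f T :=
  fun n p hp x hx => hf n p hp x (h hx)

theorem DSmooth.smoothOn {f : X → Y} (hf : DSmooth f) (S : Set X) : SmoothOn f S :=
  fun _ _ hp x _ => (PlotAt.of_isPlot hp x).dSmooth_comp hf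

theorem SmoothOn.isPlot {f : X → Y} {S : Set X} (hf : SmoothOn f S) {p : Eu n → X}
    (hp : IsPlot p) (h : ∀ x, p x ∈ S) : IsPlot fun y => f (p y) :=
  isPlot_of_plotAt fun x => hf n p hp x (h x)

end PlotAt

/-! ### Plots of normed spaces, manifolds and the circle -/

section Concrete

variable {n m : ℕ}

/-- The identification of `ℝ` with `ℝ¹`. -/
noncomputable def euLine : ℝ →L[ℝ] Eu 1 :=
  (ContinuousLinearMap.id ℝ ℝ).smulRight (EuclideanSpace.single 0 1)

@[simp] theorem euLine_apply (t : ℝ) : euLine t 0 = t := by simp [euLine]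

theorem contDiff_eu_apply : ContDiff ℝ ∞ fun w : Eu 1 => w 0 :=
  (EuclideanSpace.proj (𝕜 := ℝ) (0 : Fin 1)).contDiff

theorem fderiv_eu_apply (x v : Eu 1) : fderiv ℝ (fun w : Eu 1 => w 0) x v = v 0 :=
  DFunLike.congr_fun (EuclideanSpace.proj (𝕜 := ℝ) (0 : Fin 1)).hasFDerivAt.fderiv v

theorem isPlot_man_iff {M : Man.{u}} {p : Eu n → M} :
    IsPlot p ↔ ContMDiff (𝓡 n) (𝓡 M.dim) ∞ p := Iff.rfl

theorem PlotAt.of_contMDiffAt {M : Man.{u}} {p : Eu n → M} {x : Eu n}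
    (hp : ∀ᶠ y in 𝓝 x, ContMDiffAt (𝓡 n) (𝓡 M.dim) ∞ p y) : PlotAt p x := by
  obtain ⟨r, hr, hr', hrx⟩ := exists_retract_of_eventually hp
  exact ⟨p ∘ r, isPlot_man_iff.2 fun y => (hr' y).comp y hr.contMDiff.contMDiffAt,
    hrx.mono fun y hy => by simp [hy]⟩

theorem IsPlot.continuous_man {M : Man.{u}} {p : Eu n → M} (hp : IsPlot p) : Continuous p :=
  (isPlot_man_iff.1 hp).continuous

theorem isPlot_circle_iff {p : Eu n → S1} :
    IsPlot p ↔ ∀ x, ∃ f : Eu n → ℝ, ContDiff ℝ ∞ f ∧ p =ᶠ[𝓝 x] fun y => ((f y : ℝ) : S1) :=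
  Iff.rfl

theorem PlotAt.exists_lift {p : Eu n → S1} {x : Eu n} (hp : PlotAt p x) :
    ∃ f : Eu n → ℝ, ContDiff ℝ ∞ f ∧ p =ᶠ[𝓝 x] fun y => ((f y : ℝ) : S1) := by
  obtain ⟨q, hq, h⟩ := hp
  obtain ⟨f, hf, hqf⟩ := isPlot_circle_iff.1 hq x
  exact ⟨f, hf, h.trans hqf⟩

theorem dSmooth_angleCoe : DSmooth fun t : ℝ => (t : S1) :=
  fun _ p hp => isPlot_circle_iff.2 fun _ => ⟨p, IsPlot.contDiff hp, .rfl⟩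

theorem IsPlot.continuous_circle {p : Eu n → S1} (hp : IsPlot p) : Continuous p := by
  refine continuous_iff_continuousAt.2 fun x => ?_
  obtain ⟨f, hf, h⟩ := isPlot_circle_iff.1 hp x
  exact (Real.Angle.continuous_coe.comp hf.continuous).continuousAt.congr h.symm

theorem isPlot_circle_add {p q : Eu n → S1} (hp : IsPlot p) (hq : IsPlot q) :
    IsPlot fun y => p y + q y := by
  refine isPlot_circle_iff.2 fun x => ?_
  obtain ⟨f, hf, h⟩ := isPlot_circle_iff.1 hp x
  obtain ⟨g, hg, h'⟩ := isPlot_circle_iff.1 hq x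
  refine ⟨fun y => f y + g y, hf.add hg, ?_⟩
  filter_upwards [h, h'] with y hy hy'
  rw [hy, hy', Real.Angle.coe_add]

end Concrete

/-! ### One-forms along plots -/

section Forms

variable {X W : Type*} [DiffeologicalSpace X] [NormedAddCommGroup W] [NormedSpace ℝ W]
  {A : ∀ {n : ℕ}, (Eu n → X) → Eu n → Eu n → W} {n m : ℕ}

theorem IsOneForm.congr_of_eventuallyEq (hA : IsOneForm A) {p q : Eu n → X} (hp : IsPlot p)
    (hq : IsPlot q) {x : Eu n} (h : p =ᶠ[𝓝 x] q) (v : Eu n) : A p x v = A q x v := by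
  obtain ⟨r, hr, hr', hrx⟩ := exists_retract_of_eventually h
  have hfd : fderiv ℝ r x = ContinuousLinearMap.id ℝ _ :=
    (Filter.EventuallyEq.fderiv_eq (f := id) hrx).trans fderiv_id
  have h1 := hA.pullback p r hp hr x v
  have h2 := hA.pullback q r hq hr x v
  rw [hfd, hrx.self_of_nhds] at h1 h2
  have : p ∘ r = q ∘ r := funext hr'
  rw [this] at h1
  exact h1.symm.trans h2

theorem IsOneForm.const (hA : IsOneForm A) (a : X) (x v : Eu n) : A (fun _ => a) x v = 0 := by
  have h := hA.pullback (fun _ : Eu n => a) (fun _ : Eu n => (0 : Eu n)) isPlot_const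
    contDiff_const x v
  rw [fderiv_const_apply] at h
  exact h.trans (hA.linear _ isPlot_const _).map_zero

/-- The linear isomorphism used to regard maps on a product of Euclidean spaces as plots. -/
noncomputable abbrev euProd (n m : ℕ) :
    (Eu n × Eu m) ≃L[ℝ] Eu (Module.finrank ℝ (Eu n × Eu m)) := toEuclidean

theorem isPlot_comp_euProd_symm {P : Eu n × Eu m → X} (hP : DSmooth P) :
    IsPlot (P ∘ (euProd n m).symm) :=
  hP _ _ ⟨(contDiff_fst.comp (euProd n m).symm.contDiff).isPlot,
    (contDiff_snd.comp (euProd n m).symm.contDiff).isPlot⟩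

theorem IsOneForm.pullback_prod (hA : IsOneForm A) {P : Eu n × Eu m → X} (hP : DSmooth P) {k : ℕ}
    (f : Eu k → Eu n × Eu m) (hf : ContDiff ℝ ∞ f) (x v : Eu k) :
    A (fun y => P (f y)) x v =
      A (P ∘ (euProd n m).symm) (euProd n m (f x)) (euProd n m (fderiv ℝ f x v)) := by
  have h := hA.pullback (P ∘ (euProd n m).symm) (euProd n m ∘ f) (isPlot_comp_euProd_symm hP)
    ((euProd n m).contDiff.comp hf) x v
  rw [ContinuousLinearEquiv.comp_fderiv] at h
  convert! h using 2
  ext y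
  simp

theorem fderiv_prodMk_const (x v : Eu n) (c : Eu m) : fderiv ℝ (fun y => (y, c)) x v = (v, 0) :=
  DFunLike.congr_fun ((hasFDerivAt_id x).prodMk (hasFDerivAt_const c x)).fderiv v

theorem fderiv_const_prodMk (x : Eu n) (c w : Eu m) : fderiv ℝ (fun z => (x, z)) c w = (0, w) :=
  DFunLike.congr_fun ((hasFDerivAt_const x c).prodMk (hasFDerivAt_id c)).fderiv w

/-- A form on a family with two parameters splits into the contributions of the parameters. -/
theorem IsOneForm.prod_split (hA : IsOneForm A) {P : Eu n × Eu m → X} (hP : DSmooth P)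
    {f : Eu n → Eu m} (hf : ContDiff ℝ ∞ f) (x v : Eu n) :
    A (fun y => P (y, f y)) x v =
      A (fun y => P (y, f x)) x v + A (fun z => P (x, z)) (f x) (fderiv ℝ f x v) := by
  have hd : DifferentiableAt ℝ f x := (hf.differentiable (by simp)).differentiableAt
  rw [hA.pullback_prod hP (fun y => (y, f y)) (contDiff_id.prodMk hf),
    hA.pullback_prod hP (fun y => (y, f x)) (contDiff_id.prodMk contDiff_const),
    hA.pullback_prod hP (fun z => (x, z)) (contDiff_const.prodMk contDiff_id)]
  have e1 : fderiv ℝ (fun y => (y, f y)) x v = (v, fderiv ℝ f x v) :=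
    DFunLike.congr_fun ((hasFDerivAt_id x).prodMk hd.hasFDerivAt).fderiv v
  rw [e1, fderiv_prodMk_const, fderiv_const_prodMk,
    ← (hA.linear _ (isPlot_comp_euProd_symm hP) _).map_add, ← map_add]
  simp

theorem IsOneForm.contDiff_left (hA : IsOneForm A) {P : Eu n × Eu m → X} (hP : DSmooth P) :
    ContDiff ℝ ∞ fun z : Eu n × Eu n × Eu m => A (fun y => P (y, z.2.2)) z.1 z.2.1 := by
  have h := hA.smooth _ (isPlot_comp_euProd_symm hP)
  have : (fun z : Eu n × Eu n × Eu m => A (fun y => P (y, z.2.2)) z.1 z.2.1) =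
      (fun z : Eu n × Eu n × Eu m => A (P ∘ (euProd n m).symm) (euProd n m (z.1, z.2.2))
        (euProd n m (z.2.1, 0))) := by
    ext1 z
    rw [hA.pullback_prod hP (fun y => (y, z.2.2)) (contDiff_id.prodMk contDiff_const),
      fderiv_prodMk_const]
  rw [this]
  exact h.comp (((euProd n m).contDiff.comp
      (contDiff_fst.prodMk (contDiff_snd.comp contDiff_snd))).prodMk
    ((euProd n m).contDiff.comp ((contDiff_fst.comp contDiff_snd).prodMk contDiff_const)))

theorem IsOneForm.contDiff_right (hA : IsOneForm A) {P : Eu n × Eu m → X} (hP : DSmooth P) :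
    ContDiff ℝ ∞ fun z : Eu n × Eu m × Eu m => A (fun w => P (z.1, w)) z.2.1 z.2.2 := by
  have h := hA.smooth _ (isPlot_comp_euProd_symm hP)
  have : (fun z : Eu n × Eu m × Eu m => A (fun w => P (z.1, w)) z.2.1 z.2.2) =
      (fun z : Eu n × Eu m × Eu m => A (P ∘ (euProd n m).symm) (euProd n m (z.1, z.2.1))
        (euProd n m (0, z.2.2))) := by
    ext1 z
    rw [hA.pullback_prod hP (fun w => (z.1, w)) (contDiff_const.prodMk contDiff_id),
      fderiv_const_prodMk]
  rw [this]
  exact h.comp (((euProd n m).contDiff.comp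
      (contDiff_fst.prodMk (contDiff_fst.comp contDiff_snd))).prodMk
    ((euProd n m).contDiff.comp (contDiff_const.prodMk (contDiff_snd.comp contDiff_snd))))

end Forms

/-! ### Principal bundles -/

/-- The group operations of `K` are smooth. -/
class SmoothGroup (K : Type*) [Group K] [DiffeologicalSpace K] : Prop where
  isPlot_mul : ∀ {n : ℕ} {p q : Eu n → K}, IsPlot p → IsPlot q → IsPlot fun y => p y * q y
  isPlot_inv : ∀ {n : ℕ} {p : Eu n → K}, IsPlot p → IsPlot fun y => (p y)⁻¹

/-- Plots of `B` are continuous for the topology of `B`. -/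
class ContinuousPlots (B : Type*) [TopologicalSpace B] [DiffeologicalSpace B] : Prop where
  continuous_plot : ∀ {n : ℕ} {p : Eu n → B}, IsPlot p → Continuous p

instance (M : Man.{u}) : ContinuousPlots M := ⟨IsPlot.continuous_man⟩

instance : ContinuousPlots S1 := ⟨IsPlot.continuous_circle⟩

instance : ContinuousPlots ℝ := ⟨fun hp => (IsPlot.contDiff hp).continuous⟩

instance {B C : Type*} [TopologicalSpace B] [DiffeologicalSpace B] [TopologicalSpace C]
    [DiffeologicalSpace C] [ContinuousPlots B] [ContinuousPlots C] : ContinuousPlots (B × C) :=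
  ⟨fun hp => (ContinuousPlots.continuous_plot hp.1).prodMk (ContinuousPlots.continuous_plot hp.2)⟩

section

variable {G : Man.{u}} [Group G] [LieGroup (𝓡 G.dim) ∞ G]

instance : SmoothGroup G where
  isPlot_mul hp hq := ContMDiff.mul (I := 𝓡 G.dim) hp hq
  isPlot_inv hp := ContMDiff.inv (I := 𝓡 G.dim) hp

omit [LieGroup (𝓡 G.dim) ∞ G] in
theorem isPlot_loopGroup_iff {n : ℕ} {p : Eu n → LoopGroup G} :
    IsPlot p ↔ DSmooth fun z : Eu n × S1 => p z.1 z.2 := Iff.rfl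

omit [LieGroup (𝓡 G.dim) ∞ G] in
theorem IsPlot.loopGroup_eval {n : ℕ} {p : Eu n → LoopGroup G} {θ : Eu n → S1} (hp : IsPlot p)
    (hθ : IsPlot θ) : IsPlot fun y => p y (θ y) :=
  isPlot_loopGroup_iff.1 hp n (fun y => (y, θ y)) ⟨isPlot_id, hθ⟩

instance : SmoothGroup (LoopGroup G) where
  isPlot_mul hp hq := isPlot_loopGroup_iff.2 fun m r hr =>
    SmoothGroup.isPlot_mul (isPlot_loopGroup_iff.1 hp m r hr) (isPlot_loopGroup_iff.1 hq m r hr)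
  isPlot_inv hp := isPlot_loopGroup_iff.2 fun m r hr =>
    SmoothGroup.isPlot_inv (isPlot_loopGroup_iff.1 hp m r hr)

end

section Plots

variable {K : Type*} [Group K] [DiffeologicalSpace K] [SmoothGroup K] {n : ℕ}

theorem dSmooth_mul : DSmooth fun z : K × K => z.1 * z.2 :=
  fun _ _ h => SmoothGroup.isPlot_mul h.1 h.2

theorem PlotAt.mul {p q : Eu n → K} {x : Eu n} (hp : PlotAt p x) (hq : PlotAt q x) :
    PlotAt (fun y => p y * q y) x := (hp.prodMk hq).dSmooth_comp dSmooth_mul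

theorem PlotAt.eventually_mem {B : Type*} [TopologicalSpace B] [DiffeologicalSpace B]
    [ContinuousPlots B] {p : Eu n → B} {x : Eu n} (hp : PlotAt p x) {U : Set B} (hU : IsOpen U)
    (hx : p x ∈ U) : ∀ᶠ y in 𝓝 x, p y ∈ U := by
  obtain ⟨q, hq, h⟩ := hp
  have hqx : q x ∈ U := h.eq_of_nhds ▸ hx
  filter_upwards [h, (ContinuousPlots.continuous_plot hq).continuousAt.eventually
    (hU.mem_nhds hqx)] with y hy hy'
  rwa [hy]

theorem PlotAt.continuousAt {B : Type*} [TopologicalSpace B] [DiffeologicalSpace B]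
    [ContinuousPlots B] {p : Eu n → B} {x : Eu n} (hp : PlotAt p x) : ContinuousAt p x := by
  obtain ⟨q, hq, h⟩ := hp
  exact (ContinuousPlots.continuous_plot hq).continuousAt.congr h.symm

/-- Smoothness is local for the topology of the source. -/
theorem SmoothOn.of_locally_eq {B Y : Type*} [TopologicalSpace B] [DiffeologicalSpace B]
    [ContinuousPlots B] [DiffeologicalSpace Y] {f : B → Y} {S : Set B}
    (h : ∀ b ∈ S, ∃ g : B → Y, SmoothOn g {b} ∧ f =ᶠ[𝓝 b] g) : SmoothOn f S := by
  intro n p hp x hx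
  obtain ⟨g, hg, hfg⟩ := h _ hx
  exact (hg n p hp x rfl).congr
    ((ContinuousPlots.continuous_plot hp).continuousAt.eventually hfg)

end Plots

namespace BundleData

variable {K B : Type u} [Group K]

open Classical in
/-- The `k` such that `q = p k`, for points `p`, `q` of the same fibre of a principal bundle (and
`1` if there is none). -/
noncomputable def div (P : BundleData K B) (p q : P.Total) : K :=
  if h : ∃ k, P.act p k = q then h.choose else 1

theorem act_div_of_exists {P : BundleData K B} {p q : P.Total} (h : ∃ k, P.act p k = q) :
    P.act p (P.div p q) = q := by
  rw [div, dif_pos h]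
  exact h.choose_spec

variable [DiffeologicalSpace K] [TopologicalSpace B] [DiffeologicalSpace B]

/-- A bundle with a free action and smooth local sections is principal, if the element of the
group by which a point differs from the section depends smoothly on the point. -/
theorem isPrincipal_of_sections [ContinuousPlots B] {P : BundleData K B}
    (act_one : ∀ p, P.act p 1 = p) (act_mul : ∀ p k l, P.act p (k * l) = P.act (P.act p k) l)
    (proj_act : ∀ p k, P.proj (P.act p k) = P.proj p) (smooth_proj : DSmooth P.proj)
    (smooth_act : DSmooth fun z : P.Total × K => P.act z.1 z.2)
    (free : ∀ p k l, P.act p k = P.act p l → k = l)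
    (h : ∀ b, ∃ U : Set B, IsOpen U ∧ b ∈ U ∧ ∃ s : B → P.Total, SmoothOn s U ∧
      (∀ b ∈ U, P.proj (s b) = b) ∧ ∃ d : P.Total → K, SmoothOn d (P.proj ⁻¹' U) ∧
        ∀ p, P.proj p ∈ U → P.act (s (P.proj p)) (d p) = p) : P.IsPrincipal where
  act_one := act_one
  act_mul := act_mul
  proj_act := proj_act
  smooth_proj := smooth_proj
  smooth_act := smooth_act
  locally_trivial b := by
    obtain ⟨U, hU, hb, s, hs, hsU, d, hd, hsd⟩ := h b
    have hp : ∀ z : {b : B // b ∈ U} × K, P.proj (P.act (s z.1) z.2) = z.1 := fun z => by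
      rw [proj_act, hsU _ z.1.2]
    refine ⟨U, hU, hb, ⟨fun p => (⟨P.proj p.1, p.2⟩, d p.1),
      fun z => ⟨P.act (s z.1) z.2, (hp z).symm ▸ z.1.2⟩, fun p => Subtype.ext (hsd p.1 p.2),
      fun z => ?_⟩, ?_, ?_, fun p => rfl, fun p k hk => ?_⟩
    · refine Prod.ext (Subtype.ext (hp z)) (free (s z.1) _ _ ?_)
      have := hsd (P.act (s z.1) z.2) ((hp z).symm ▸ z.1.2)
      rwa [hp z] at this
    · exact fun n p hp => ⟨smooth_proj _ _ hp, hd.isPlot (isPlot_subtype_iff.1 hp) fun y => (p y).2⟩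
    · exact fun n p hp => smooth_act n (fun y => (s (p y).1, (p y).2))
        ⟨hs.isPlot (isPlot_subtype_iff.1 hp.1) fun y => (p y).1.2, hp.2⟩
    · refine free (s (P.proj p.1)) _ _ ?_
      have h1 := hsd _ hk
      rw [proj_act] at h1
      refine h1.trans ?_
      change _ = P.act (s (P.proj p.1)) (d p.1 * k)
      rw [act_mul, hsd _ p.2]

namespace IsPrincipal

variable {P R : BundleData K B}

theorem free (hP : P.IsPrincipal) {p : P.Total} {k l : K} (h : P.act p k = P.act p l) :
    k = l := by
  obtain ⟨U, -, hb, t, -, -, -, ht⟩ := hP.locally_trivial (P.proj p)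
  have h1 := ht ⟨p, hb⟩ k (by rwa [hP.proj_act])
  have h2 := ht ⟨p, hb⟩ l (by rwa [hP.proj_act])
  refine mul_left_cancel (a := (t ⟨p, hb⟩).2) ?_
  rw [← h1, ← h2]
  congr 3

theorem act_div (hP : P.IsPrincipal) {p q : P.Total} (h : P.proj p = P.proj q) :
    P.act p (P.div p q) = q :=
  act_div_of_exists ((hP.exists_act_eq h).imp fun _ hk => hk.symm)

theorem div_eq (hP : P.IsPrincipal) {p q : P.Total} {k : K} (h : P.act p k = q) :
    P.div p q = k :=
  hP.free ((hP.act_div (by rw [← h, hP.proj_act])).trans h.symm)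

theorem eq_div (hP : P.IsPrincipal) {p q : P.Total} {k : K} (h : P.act p k = q) :
    k = P.div p q := (hP.div_eq h).symm

theorem plotAt_act (hP : P.IsPrincipal) {n : ℕ} {p : Eu n → P.Total} {k : Eu n → K}
    {x : Eu n} (hp : PlotAt p x) (hk : PlotAt k x) : PlotAt (fun y => P.act (p y) (k y)) x :=
  (hp.prodMk hk).dSmooth_comp hP.smooth_act

theorem isPlot_act (hP : P.IsPrincipal) {n : ℕ} {p : Eu n → P.Total} {k : Eu n → K}
    (hp : IsPlot p) (hk : IsPlot k) : IsPlot (fun y => P.act (p y) (k y)) :=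
  hP.smooth_act n (fun y => (p y, k y)) ⟨hp, hk⟩

variable [ContinuousPlots B]

/-- The difference of two families of points of the same fibres depends smoothly on the
parameters. -/
theorem isPlot_div [SmoothGroup K] (hP : P.IsPrincipal) {n : ℕ} {p q : Eu n → P.Total}
    (hp : IsPlot p) (hq : IsPlot q) (h : ∀ y, P.proj (p y) = P.proj (q y)) :
    IsPlot fun y => P.div (p y) (q y) := by
  refine isPlot_of_plotAt fun x => ?_
  obtain ⟨U, hU, hb, t, ht, -, hproj, hmul⟩ := hP.locally_trivial (P.proj (p x))
  obtain ⟨r, hr, hrU, hrx⟩ := exists_retract_of_eventually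
    ((PlotAt.of_isPlot (hP.smooth_proj _ _ hp) x).eventually_mem hU hb)
  have hrU' : ∀ y, P.proj (q (r y)) ∈ U := fun y => h (r y) ▸ hrU y
  have h1 : IsPlot fun y => (t ⟨p (r y), hrU y⟩).2 :=
    (ht n (fun y => ⟨p (r y), hrU y⟩) (isPlot_reparam hp hr)).2
  have h2 : IsPlot fun y => (t ⟨q (r y), hrU' y⟩).2 :=
    (ht n (fun y => ⟨q (r y), hrU' y⟩) (isPlot_reparam hq hr)).2
  refine ⟨_, SmoothGroup.isPlot_mul (SmoothGroup.isPlot_inv h1) h2, ?_⟩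
  filter_upwards [hrx] with y hy
  have h3 := hmul ⟨p (r y), hrU y⟩ (P.div (p (r y)) (q (r y))) (by rw [hP.proj_act]; exact hrU y)
  simp only [hP.act_div (h (r y))] at h3
  rw [h3, inv_mul_cancel_left, hy]

theorem plotAt_div [SmoothGroup K] (hP : P.IsPrincipal) {n : ℕ} {p q : Eu n → P.Total} {x : Eu n}
    (hp : PlotAt p x) (hq : PlotAt q x) (h : ∀ᶠ y in 𝓝 x, P.proj (p y) = P.proj (q y)) :
    PlotAt (fun y => P.div (p y) (q y)) x := by
  obtain ⟨p', hp', h1⟩ := hp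
  obtain ⟨q', hq', h2⟩ := hq
  have h3 : ∀ᶠ y in 𝓝 x, P.proj (p' y) = P.proj (q' y) := by
    filter_upwards [h, h1, h2] with y hy h1 h2
    rw [← h1, ← h2, hy]
  obtain ⟨r, hr, hr', hrx⟩ := exists_retract_of_eventually h3
  refine ⟨_, hP.isPlot_div (isPlot_reparam hp' hr) (isPlot_reparam hq' hr) hr', ?_⟩
  filter_upwards [h1, h2, hrx] with y h1 h2 hy
  simp [h1, h2, hy]

theorem exists_section (hP : P.IsPrincipal) (b : B) :
    ∃ U : Set B, IsOpen U ∧ b ∈ U ∧ ∃ s : B → P.Total, SmoothOn s U ∧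
      ∀ b ∈ U, P.proj (s b) = b := by
  classical
  obtain ⟨U, hU, hb, t, -, ht, hproj, -⟩ := hP.locally_trivial b
  refine ⟨U, hU, hb, fun c => if h : c ∈ U then (t.symm (⟨c, h⟩, 1)).1 else
    (t.symm (⟨b, hb⟩, 1)).1, fun n p hp x hx => ?_, fun c hc => ?_⟩
  · obtain ⟨r, hr, hrU, hrx⟩ := exists_retract_of_eventually
      ((PlotAt.of_isPlot hp x).eventually_mem hU hx)
    refine ⟨fun y => (t.symm (⟨p (r y), hrU y⟩, 1)).1,
      ht n (fun y => (⟨p (r y), hrU y⟩, 1)) ⟨isPlot_reparam hp hr, isPlot_const⟩, ?_⟩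
    filter_upwards [hrx] with y hy
    have : p y ∈ U := by
      have := hrU y
      rwa [hy] at this
    simp only [this, hy, dif_pos]
  · beta_reduce
    rw [dif_pos hc, ← hproj, Equiv.apply_symm_apply]

/-- A bundle map of principal bundles over the identity is a diffeomorphism. -/
theorem exists_smooth_inverse [SmoothGroup K] (hP : P.IsPrincipal) (hR : R.IsPrincipal)
    {f : P.Total → R.Total} (hf : DSmooth f) (hact : ∀ p k, f (P.act p k) = R.act (f p) k)
    (hproj : ∀ p, R.proj (f p) = P.proj p) :
    ∃ g : R.Total → P.Total, DSmooth g ∧ Function.LeftInverse g f ∧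
      Function.RightInverse g f ∧ (∀ r k, g (R.act r k) = P.act (g r) k) ∧
      ∀ r, P.proj (g r) = R.proj r := by
  have hinj : Function.Injective f := fun p q h => by
    obtain ⟨k, rfl⟩ := hP.exists_act_eq (show P.proj p = P.proj q by rw [← hproj, h, hproj])
    rw [hact] at h
    have hk : (1 : K) = k := hR.free (p := f p) (by rw [hR.act_one, ← h])
    rw [← hk, hP.act_one]
  have hsurj : Function.Surjective f := fun r => by
    obtain ⟨p, hp⟩ := hP.proj_surjective (R.proj r)
    obtain ⟨k, rfl⟩ := hR.exists_act_eq (show R.proj (f p) = R.proj r by rw [hproj, hp])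
    exact ⟨P.act p k, hact p k⟩
  let e := Equiv.ofBijective f ⟨hinj, hsurj⟩
  refine ⟨e.symm, fun n p hp => isPlot_of_plotAt fun x => ?_, e.left_inv, e.right_inv,
    fun r k => ?_, fun r => ?_⟩
  rotate_left
  · refine e.injective ((e.apply_symm_apply _).trans ?_)
    exact ((hact _ _).trans (congrArg (R.act · k) (e.apply_symm_apply r))).symm
  · rw [← hproj]
    exact congrArg R.proj (e.apply_symm_apply r)
  obtain ⟨U, hU, hb, s, hs, hsU⟩ := hP.exists_section (R.proj (p x))
  have hpx := PlotAt.of_isPlot hp x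
  have hrp : PlotAt (fun y => R.proj (p y)) x := hpx.dSmooth_comp hR.smooth_proj
  have h1 : PlotAt (fun y => s (R.proj (p y))) x := hs.plotAt hrp hb
  have hmem := hrp.eventually_mem hU hb
  refine (hP.plotAt_act h1 (hR.plotAt_div (h1.dSmooth_comp hf) hpx ?_)).congr ?_
  · filter_upwards [hmem] with y hy
    rw [hproj, hsU _ hy]
  · filter_upwards [hmem] with y hy
    refine e.injective ((e.apply_symm_apply _).trans ?_)
    refine Eq.trans ?_ (hact _ _).symm
    exact (hR.act_div (by rw [hproj, hsU _ hy])).symm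

end IsPrincipal

end BundleData

/-! ### Smooth paths and interpolation in a connected Lie group -/

/-- Near any point of an interval the identity of `ℝ` extends to a smooth map into the interval. -/
theorem exists_smooth_retract_real (b : ℝ) {ε : ℝ} (hε : 0 < ε) :
    ∃ χ : ℝ → ℝ, ContDiff ℝ ∞ χ ∧ (∀ t, χ t ∈ Set.Ioo (b - ε) (b + ε)) ∧
      ∀ᶠ t in 𝓝 b, χ t = t := by
  obtain ⟨f, hf, hf', hfx⟩ := exists_smooth_retract (n := 1)
    (s := {y | y 0 ∈ Set.Ioo (b - ε) (b + ε)})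
    (isOpen_Ioo.preimage contDiff_eu_apply.continuous) (x := euLine b) (by simp [hε])
  refine ⟨fun t => f (euLine t) 0, ?_, fun t => hf (euLine t), ?_⟩
  · exact contDiff_eu_apply.comp (hf'.comp euLine.contDiff)
  · filter_upwards [euLine.continuous.continuousAt.eventually hfx] with t ht
    rw [ht, euLine_apply]

section Group

variable {G : Man.{u}} [Group G] [LieGroup (𝓡 G.dim) ∞ G]

/-- Straight lines in a chart contract a neighbourhood of `1` smoothly. -/
theorem exists_contraction (G : Man.{u}) [Group G] :
    ∃ V : Set G, IsOpen V ∧ 1 ∈ V ∧ ∃ K : G × ℝ → G, SmoothOn K (V ×ˢ Set.Icc 0 1) ∧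
      ∀ v ∈ V, K (v, 0) = 1 ∧ K (v, 1) = v := by
  let e := extChartAt (𝓡 G.dim) (1 : G)
  obtain ⟨r, hr, hb⟩ := Metric.isOpen_iff.1 (isOpen_extChartAt_target (I := 𝓡 G.dim) (1 : G))
    (e 1) (mem_extChartAt_target (I := 𝓡 G.dim) (1 : G))
  let V : Set G := e.source ∩ e ⁻¹' Metric.ball (e 1) r
  let L : G × ℝ → LieAlg G := fun z => e 1 + z.2 • (e z.1 - e 1)
  have hL : ∀ z ∈ V ×ˢ Set.Icc (0 : ℝ) 1, L z ∈ e.target := by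
    rintro ⟨v, l⟩ ⟨⟨-, hv⟩, hl0, hl1⟩
    refine hb ?_
    simp only [Set.mem_preimage, Metric.mem_ball, dist_eq_norm, L] at hv ⊢
    rw [add_sub_cancel_left, norm_smul, Real.norm_of_nonneg hl0]
    calc l * ‖e v - e 1‖ ≤ 1 * ‖e v - e 1‖ := by gcongr
      _ < r := by linarith
  refine ⟨V, (continuousOn_extChartAt (I := 𝓡 G.dim) (1 : G)).isOpen_inter_preimage
    (isOpen_extChartAt_source (I := 𝓡 G.dim) (1 : G)) Metric.isOpen_ball,
    ⟨mem_extChartAt_source (I := 𝓡 G.dim) (1 : G), Metric.mem_ball_self hr⟩,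
    fun z => e.symm (L z), fun n p hp x hx => ?_, fun v hv => ⟨?_, ?_⟩⟩
  · have hsrc : ∀ᶠ y in 𝓝 x, (p y).1 ∈ (chartAt (Eu G.dim) (1 : G)).source := by
      refine (IsPlot.continuous_man hp.1).continuousAt.eventually_mem ?_
      refine (chartAt (Eu G.dim) (1 : G)).open_source.mem_nhds ?_
      have := hx.1.1
      rwa [extChartAt_source] at this
    have hLp : ∀ᶠ y in 𝓝 x, ContMDiffAt (𝓡 n) 𝓘(ℝ, Eu G.dim) ∞ (fun y => L (p y)) y := by
      filter_upwards [hsrc] with y hy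
      have h1 : ContMDiffAt (𝓡 n) 𝓘(ℝ, Eu G.dim) ∞ (fun y => e (p y).1) y :=
        (contMDiffAt_extChartAt' hy).comp y (isPlot_man_iff.1 hp.1 y)
      have h2 : ContMDiffAt (𝓡 n) 𝓘(ℝ, ℝ) ∞ (fun y => (p y).2) y :=
        (IsPlot.contDiff hp.2).contMDiff y
      exact contMDiffAt_const.add (h2.smul (h1.sub contMDiffAt_const))
    have hmem : ∀ᶠ y in 𝓝 x, L (p y) ∈ e.target :=
      hLp.self_of_nhds.continuousAt.eventually_mem
        ((isOpen_extChartAt_target (I := 𝓡 G.dim) (1 : G)).mem_nhds (hL _ hx))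
    refine PlotAt.of_contMDiffAt ?_
    filter_upwards [hLp, hmem] with y h1 h2
    exact ((contMDiffOn_extChartAt_symm (I := 𝓡 G.dim) (n := ∞) (1 : G)).contMDiffAt
      ((isOpen_extChartAt_target (I := 𝓡 G.dim) (1 : G)).mem_nhds h2)).comp y h1
  · simp only [L, zero_smul, add_zero]
    exact e.left_inv (mem_extChartAt_source (I := 𝓡 G.dim) (1 : G))
  · simp only [L, one_smul, add_sub_cancel]
    exact e.left_inv hv.1

/-- Any element of a connected Lie group is joined to `1` by a smooth path which is constant near
both ends. -/
theorem exists_smooth_path [ConnectedSpace G] (g : G) :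
    ∃ c : ℝ → G, DSmooth c ∧ (∀ t ≤ 1, c t = 1) ∧ ∀ t, 2 ≤ t → c t = g := by
  obtain ⟨V, hV, h1, K, hK, hK'⟩ := exists_contraction G
  have := topologicalGroup_of_lieGroup (𝓡 G.dim) ∞ (G := G)
  let H : Subgroup G :=
    { carrier := {g | ∃ c : ℝ → G, DSmooth c ∧ (∀ t ≤ 1, c t = 1) ∧ ∀ t, 2 ≤ t → c t = g}
      mul_mem' := by
        rintro g h ⟨c, hc, hc1, hc2⟩ ⟨d, hd, hd1, hd2⟩
        exact ⟨fun t => c t * d t, fun n p hp => SmoothGroup.isPlot_mul (hc n p hp) (hd n p hp),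
          fun t ht => by beta_reduce; rw [hc1 t ht, hd1 t ht, mul_one],
          fun t ht => by beta_reduce; rw [hc2 t ht, hd2 t ht]⟩
      one_mem' := ⟨fun _ => 1, dSmooth_const, fun _ _ => rfl, fun _ _ => rfl⟩
      inv_mem' := by
        rintro g ⟨c, hc, hc1, hc2⟩
        exact ⟨fun t => (c t)⁻¹, fun n p hp => SmoothGroup.isPlot_inv (hc n p hp),
          fun t ht => by beta_reduce; rw [hc1 t ht, inv_one],
          fun t ht => by beta_reduce; rw [hc2 t ht]⟩ }
  -- `H` contains a neighbourhood of `1`, so it is an open subgroup of a connected group.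
  have hVH : V ⊆ H := fun v hv => by
    refine ⟨fun t => K (v, Real.smoothTransition (t - 1)), fun n p hp => ?_, fun t ht => ?_,
      fun t ht => ?_⟩
    · refine hK.isPlot (p := fun y => (v, Real.smoothTransition (p y - 1)))
        ⟨isPlot_const, ?_⟩ fun x => ⟨hv, Real.smoothTransition.nonneg _,
          Real.smoothTransition.le_one _⟩
      exact (Real.smoothTransition.contDiff.comp
        ((IsPlot.contDiff hp).sub contDiff_const)).isPlot
    · beta_reduce; rw [Real.smoothTransition.zero_of_nonpos (by linarith), (hK' v hv).1]
    · beta_reduce; rw [Real.smoothTransition.one_of_one_le (by linarith), (hK' v hv).2]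
  have hH : IsOpen (H : Set G) :=
    H.isOpen_of_mem_nhds (Filter.mem_of_superset (hV.mem_nhds h1) hVH)
  have htop : (H : Set G) = Set.univ :=
    IsClopen.eq_univ ⟨H.isClosed_of_isOpen hH, hH⟩ ⟨1, H.one_mem⟩
  exact (htop ▸ Set.mem_univ g : g ∈ (H : Set G))

/-- Smooth paths from `1` to the elements `v` of a neighbourhood of `g`, depending smoothly
on `v`. -/
theorem exists_smooth_paths [ConnectedSpace G] (g : G) :
    ∃ V : Set G, IsOpen V ∧ g ∈ V ∧ ∃ H : G × ℝ → G, SmoothOn H (V ×ˢ Set.univ) ∧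
      ∀ v ∈ V, (∀ t ≤ 1, H (v, t) = 1) ∧ ∀ t, 2 ≤ t → H (v, t) = v := by
  obtain ⟨V, hV, h1, K, hK, hK'⟩ := exists_contraction G
  obtain ⟨c, hc, hc1, hc2⟩ := exists_smooth_path g
  have := topologicalGroup_of_lieGroup (𝓡 G.dim) ∞ (G := G)
  refine ⟨(fun v => g⁻¹ * v) ⁻¹' V, hV.preimage (continuous_const_mul g⁻¹), by simpa using h1,
    fun z => c z.2 * K (g⁻¹ * z.1, Real.smoothTransition (z.2 - 1)), fun n p hp x hx => ?_,
    fun v hv => ⟨fun t ht => ?_, fun t ht => ?_⟩⟩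
  · refine ((PlotAt.of_isPlot hp.2 x).dSmooth_comp hc).mul ?_
    refine hK n (fun y => (g⁻¹ * (p y).1, Real.smoothTransition ((p y).2 - 1)))
      ⟨SmoothGroup.isPlot_mul isPlot_const hp.1, ?_⟩ x
      ⟨hx.1, Real.smoothTransition.nonneg _, Real.smoothTransition.le_one _⟩
    exact (Real.smoothTransition.contDiff.comp
        ((IsPlot.contDiff hp.2).sub contDiff_const)).isPlot
  · simp only
    rw [Real.smoothTransition.zero_of_nonpos (by linarith), (hK' _ hv).1, hc1 t ht, one_mul]
  · simp only
    rw [Real.smoothTransition.one_of_one_le (by linarith), (hK' _ hv).2, hc2 t ht,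
      mul_inv_cancel_left]

end Group

/-! ### Sections over the circle -/

section SmoothOn

variable {X Y Z : Type*} [DiffeologicalSpace X] [DiffeologicalSpace Y] [DiffeologicalSpace Z]

theorem SmoothOn.comp {g : Y → Z} {f : X → Y} {T : Set Y} {S : Set X} (hg : SmoothOn g T)
    (hf : SmoothOn f S) (h : Set.MapsTo f S T) : SmoothOn (fun x => g (f x)) S :=
  fun n p hp x hx => hg.plotAt (hf n p hp x hx) (h hx)

theorem SmoothOn.prodMk {f : X → Y} {g : X → Z} {S : Set X} (hf : SmoothOn f S)
    (hg : SmoothOn g S) : SmoothOn (fun x => (f x, g x)) S :=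
  fun n p hp x hx => (hf n p hp x hx).prodMk (hg n p hp x hx)

variable {K B : Type u} [Group K] [DiffeologicalSpace K] [TopologicalSpace B]
  [DiffeologicalSpace B] {P : BundleData K B}

theorem SmoothOn.act (hP : P.IsPrincipal) {σ : X → P.Total} {k : X → K} {S : Set X}
    (hσ : SmoothOn σ S) (hk : SmoothOn k S) : SmoothOn (fun x => P.act (σ x) (k x)) S :=
  fun n p hp x hx => hP.plotAt_act (hσ n p hp x hx) (hk n p hp x hx)

theorem SmoothOn.div [ContinuousPlots B] [SmoothGroup K] [TopologicalSpace X] [ContinuousPlots X]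
    (hP : P.IsPrincipal) {σ τ : X → P.Total} {S : Set X} (hS : IsOpen S) (hσ : SmoothOn σ S)
    (hτ : SmoothOn τ S) (h : ∀ x ∈ S, P.proj (σ x) = P.proj (τ x)) :
    SmoothOn (fun x => P.div (σ x) (τ x)) S := by
  intro n p hp x hx
  refine hP.plotAt_div (hσ n p hp x hx) (hτ n p hp x hx) ?_
  filter_upwards [(PlotAt.of_isPlot hp x).eventually_mem hS hx] with y hy using h _ hy

end SmoothOn

/-- Near a point of `M` the chart is inverted by a plot. -/
theorem exists_isPlot_extChartAt_symm {M : Man.{u}} (m : M) :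
    ∃ p : Eu M.dim → M, IsPlot p ∧ ∀ᶠ z in 𝓝 m, p (extChartAt (𝓡 M.dim) m z) = z := by
  obtain ⟨r, hr, hr', hrx⟩ := exists_retract_of_eventually
    ((isOpen_extChartAt_target (I := 𝓡 M.dim) m).mem_nhds
      (mem_extChartAt_target (I := 𝓡 M.dim) m))
  refine ⟨fun y => (extChartAt (𝓡 M.dim) m).symm (r y), isPlot_man_iff.2 fun y => ?_, ?_⟩
  · have h1 : ContMDiffAt 𝓘(ℝ, Eu M.dim) (𝓡 M.dim) ∞ (extChartAt (𝓡 M.dim) m).symm (r y) :=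
      (contMDiffOn_extChartAt_symm (I := 𝓡 M.dim) (n := ∞) m).contMDiffAt
        ((isOpen_extChartAt_target (I := 𝓡 M.dim) m).mem_nhds (hr' _))
    exact h1.comp y hr.contMDiff.contMDiffAt
  · filter_upwards [extChartAt_source_mem_nhds (I := 𝓡 M.dim) m,
      (continuousAt_extChartAt (I := 𝓡 M.dim) m).eventually hrx] with z hz hz'
    rw [hz', (extChartAt (𝓡 M.dim) m).left_inv hz]

/-- The topology of `M × ℝ` is the one given by plots, so smooth maps are continuous. -/
theorem SmoothOn.continuousAt {M : Man.{u}} {Y : Type*} [TopologicalSpace Y] [DiffeologicalSpace Y]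
    [ContinuousPlots Y] {f : M × ℝ → Y} {z : M × ℝ} (hf : SmoothOn f {z}) : ContinuousAt f z := by
  obtain ⟨m, t⟩ := z
  obtain ⟨p, hp, hpm⟩ := exists_isPlot_extChartAt_symm m
  obtain ⟨N, ⟨T⟩⟩ : ∃ N, Nonempty ((Eu M.dim × ℝ) ≃L[ℝ] Eu N) := ⟨_, ⟨toEuclidean⟩⟩
  let c : M × ℝ → Eu N := fun z => T (extChartAt (𝓡 M.dim) m z.1, z.2)
  let q : Eu N → M × ℝ := fun y => (p (T.symm y).1, (T.symm y).2)
  have hq : IsPlot q := isPlot_prodMk (isPlot_reparam hp (contDiff_fst.comp T.symm.contDiff))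
    (contDiff_snd.comp T.symm.contDiff).isPlot
  have hc : ContinuousAt c (m, t) :=
    T.continuous.continuousAt.comp ((ContinuousAt.comp (x := ((m, t) : M × ℝ)) (f := Prod.fst)
      (continuousAt_extChartAt (I := 𝓡 M.dim) m) continuousAt_fst).prodMk continuousAt_snd)
  have hqc : ∀ᶠ z in 𝓝 (m, t), q (c z) = z := by
    have hfst : ContinuousAt (Prod.fst : M × ℝ → M) (m, t) := continuousAt_fst
    filter_upwards [hfst.eventually hpm] with z hz
    simp only [q, c, T.symm_apply_apply, hz]
  have h1 : ContinuousAt (fun y => f (q y)) (c (m, t)) :=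
    (hf N q hq (c (m, t)) hqc.self_of_nhds).continuousAt
  exact (h1.comp hc).congr (hqc.mono fun z hz => congrArg f hz)

section Circle

variable {G M : Man.{u}} [Group G]

/-- There is a smooth section of the pull-back to `U × (a - ε, b + ε)` of a bundle over `M × S¹`,
for some neighbourhood `U` of `m` and some `ε > 0`. -/
def HasSection (P : BundleData G (M × S1)) (m : M) (a b : ℝ) : Prop :=
  ∃ U : Set M, IsOpen U ∧ m ∈ U ∧ ∃ ε > 0, ∃ σ : M × ℝ → P.Total,
    SmoothOn σ (U ×ˢ Set.Ioo (a - ε) (b + ε)) ∧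
      ∀ z ∈ U ×ˢ Set.Ioo (a - ε) (b + ε), P.proj (σ z) = (z.1, (z.2 : S1))

variable {P : BundleData G (M × S1)}

theorem exists_hasSection_nhds (hP : P.IsPrincipal) (m : M) (t : ℝ) :
    ∃ δ > 0, ∀ a b, a ∈ Set.Ioo (t - δ) (t + δ) → b ∈ Set.Ioo (t - δ) (t + δ) →
      HasSection P m a b := by
  obtain ⟨V, hV, hb, s, hs, hsV⟩ := hP.exists_section (m, (t : S1))
  have hc : Continuous fun z : M × ℝ => (z.1, (z.2 : S1)) :=
    continuous_fst.prodMk (Real.Angle.continuous_coe.comp continuous_snd)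
  obtain ⟨U, hU, T, hT, hUT⟩ :=
    mem_nhds_prod_iff.1 ((hV.preimage hc).mem_nhds (show (m, t) ∈ _ from hb))
  obtain ⟨U', hU', hUo, hmU⟩ := mem_nhds_iff.1 hU
  obtain ⟨δ, hδ, hδT⟩ := Metric.mem_nhds_iff.1 hT
  refine ⟨δ / 2, half_pos hδ, fun a b ha hb' => ⟨U', hUo, hmU, δ / 2, half_pos hδ,
    fun z => s (z.1, (z.2 : S1)), ?_, ?_⟩⟩
  all_goals
    have hmem : ∀ z ∈ U' ×ˢ Set.Ioo (a - δ / 2) (b + δ / 2), (z.1, (z.2 : S1)) ∈ V := by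
      rintro ⟨n, r⟩ ⟨hn, hr1, hr2⟩
      refine hUT (show (n, r) ∈ _ from ⟨hU' hn, hδT ?_⟩)
      rw [Real.ball_eq_Ioo]
      exact ⟨by linarith [ha.1], by linarith [hb'.2]⟩
  · exact hs.comp (DSmooth.smoothOn
      (DSmooth.prodMk dSmooth_fst (dSmooth_angleCoe.comp dSmooth_snd)) _) hmem
  · exact fun z hz => hsV _ (hmem z hz)

variable [LieGroup (𝓡 G.dim) ∞ G]

/-- Sections over adjacent intervals are glued by continuing the first one by the second one,
corrected by the transition function, whose argument is kept in the overlap by a smooth map which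
is the identity near the common end point. -/
theorem HasSection.trans (hP : P.IsPrincipal) {m : M} {a b c : ℝ}
    (h₁ : HasSection P m a b) (h₂ : HasSection P m b c) (hab : a ≤ b) (hbc : b ≤ c) :
    HasSection P m a c := by
  obtain ⟨U₁, hU₁, hm₁, ε₁, hε₁, σ₁, hσ₁, hp₁⟩ := h₁
  obtain ⟨U₂, hU₂, hm₂, ε₂, hε₂, σ₂, hσ₂, hp₂⟩ := h₂
  obtain ⟨ε, hε, hεε₁, hεε₂⟩ : ∃ ε > 0, ε ≤ ε₁ ∧ ε ≤ ε₂ :=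
    ⟨min ε₁ ε₂, lt_min hε₁ hε₂, min_le_left _ _, min_le_right _ _⟩
  obtain ⟨χ, hχ, hχb, hχe⟩ := exists_smooth_retract_real b hε
  let S : Set (M × ℝ) := (U₁ ∩ U₂) ×ˢ Set.Ioo (b - ε) (b + ε)
  have hS : IsOpen S := (hU₁.inter hU₂).prod isOpen_Ioo
  have hS₁ : S ⊆ U₁ ×ˢ Set.Ioo (a - ε₁) (b + ε₁) := fun z hz =>
    ⟨hz.1.1, by linarith [hz.2.1], by linarith [hz.2.2]⟩
  have hS₂ : S ⊆ U₂ ×ˢ Set.Ioo (b - ε₂) (c + ε₂) := fun z hz =>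
    ⟨hz.1.2, by linarith [hz.2.1], by linarith [hz.2.2]⟩
  have hS₁₂ : ∀ z ∈ S, P.proj (σ₂ z) = P.proj (σ₁ z) := fun z hz => by
    rw [hp₁ z (hS₁ hz), hp₂ z (hS₂ hz)]
  have hh : SmoothOn (fun z => P.div (σ₂ z) (σ₁ z)) S :=
    SmoothOn.div hP hS (hσ₂.mono hS₂) (hσ₁.mono hS₁) hS₁₂
  have hχs : DSmooth fun z : M × ℝ => (z.1, χ z.2) :=
    DSmooth.prodMk dSmooth_fst (hχ.dSmooth.comp dSmooth_snd)
  let τ : M × ℝ → P.Total := fun z =>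
    P.act (σ₂ z) (P.div (σ₂ (z.1, χ z.2)) (σ₁ (z.1, χ z.2)))
  let T : Set (M × ℝ) := (U₁ ∩ U₂) ×ˢ Set.Ioo (b - ε) (c + ε)
  have hT : T ⊆ U₂ ×ˢ Set.Ioo (b - ε₂) (c + ε₂) := fun z hz =>
    ⟨hz.1.2, by linarith [hz.2.1], by linarith [hz.2.2]⟩
  have hτ : SmoothOn τ T := SmoothOn.act hP (hσ₂.mono hT)
    (hh.comp (DSmooth.smoothOn hχs T) fun z hz => ⟨hz.1, hχb _⟩)
  refine ⟨U₁ ∩ U₂, hU₁.inter hU₂, ⟨hm₁, hm₂⟩, ε, hε, fun z => if z.2 ≤ b then σ₁ z else τ z,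
    SmoothOn.of_locally_eq ?_, ?_⟩
  · rintro ⟨n, t⟩ ⟨hn, ht1, ht2⟩
    rcases lt_trichotomy t b with h | rfl | h
    · refine ⟨σ₁, hσ₁.mono ?_, ?_⟩
      · rintro _ rfl
        exact ⟨hn.1, by linarith, by linarith⟩
      · filter_upwards [continuousAt_snd.eventually (gt_mem_nhds h)] with z hz
        rw [if_pos hz.le]
    · refine ⟨σ₁, hσ₁.mono ?_, ?_⟩
      · rintro _ rfl
        exact ⟨hn.1, by linarith, by linarith⟩
      · filter_upwards [hS.mem_nhds (show (n, t) ∈ S from ⟨hn, by linarith, by linarith⟩),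
          continuousAt_snd.eventually hχe] with z hz hz'
        split_ifs
        · rfl
        · simp only [τ, hz']
          exact hP.act_div (hS₁₂ z hz)
    · refine ⟨τ, hτ.mono ?_, ?_⟩
      · rintro _ rfl
        exact ⟨hn, by linarith, ht2⟩
      · filter_upwards [continuousAt_snd.eventually (lt_mem_nhds h)] with z hz
        rw [if_neg (not_le.2 hz)]
  · rintro ⟨n, t⟩ ⟨hn, ht1, ht2⟩
    simp only at ht1 ht2 ⊢
    split_ifs with h
    · exact hp₁ (n, t) ⟨hn.1, by linarith, by linarith⟩
    · simp only [τ, hP.proj_act]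
      exact hp₂ (n, t) ⟨hn.2, by linarith, by linarith⟩

theorem hasSection (hP : P.IsPrincipal) (m : M) {a b : ℝ} (hab : a ≤ b) : HasSection P m a b := by
  choose δ hδ h using exists_hasSection_nhds hP m
  obtain ⟨t, ht0, htm, ⟨N, hN⟩, ht⟩ := exists_monotone_Icc_subset_open_cover_Icc hab
    (c := fun s : ℝ => Subtype.val ⁻¹' Set.Ioo (s - δ s) (s + δ s))
    (fun s => isOpen_Ioo.preimage continuous_subtype_val)
    (fun x _ => Set.mem_iUnion.2 ⟨x.1, by simp [hδ]⟩)
  have key : ∀ n, HasSection P m a (t n) := by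
    intro n
    induction n with
    | zero =>
      rw [ht0]
      exact h a a a (by simp [hδ]) (by simp [hδ])
    | succ n ih =>
      obtain ⟨s, hs⟩ := ht n
      have hle : t n ≤ t (n + 1) := htm (Nat.le_succ n)
      exact ih.trans hP (h s _ _ (hs ⟨le_rfl, hle⟩) (hs ⟨hle, le_rfl⟩)) (t n).2.1 hle
  have := key N
  rwa [hN N le_rfl] at this

end Circle

section FramedSection

variable {G M : Man.{u}} [Group G] [LieGroup (𝓡 G.dim) ∞ G] [ConnectedSpace G]
  {P : BundleData G (M × S1)} {s : M → P.Total}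

/-- A framed bundle has a local section along `U × S¹` that extends the framing: a section along
`U × [-π, π]` is made periodic with the help of smooth paths in `G` from `1` to the values of the
monodromy. -/
theorem exists_framed_section (hP : P.IsPrincipal) (hs : IsFraming P s) (m : M) :
    ∃ U : Set M, IsOpen U ∧ m ∈ U ∧ ∃ σ : M × S1 → P.Total, SmoothOn σ (U ×ˢ Set.univ) ∧
      ∀ n ∈ U, (∀ θ, P.proj (σ (n, θ)) = (n, θ)) ∧ σ (n, 0) = s n := by
  have hπ := Real.pi_gt_three
  obtain ⟨U₀, hU₀, hm₀, ε₀, hε₀, σ₀, hσ₀, hp₀⟩ :=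
    hasSection hP m (a := -Real.pi) (b := Real.pi) (by linarith)
  -- `σ₁` agrees with the framing at `0`
  let k : M × ℝ → G := fun z => P.div (σ₀ (z.1, 0)) (s z.1)
  let σ₁ : M × ℝ → P.Total := fun z => P.act (σ₀ z) (k z)
  let I : Set ℝ := Set.Ioo (-Real.pi - ε₀) (Real.pi + ε₀)
  have hI0 : (0 : ℝ) ∈ I := ⟨by linarith, by linarith⟩
  have hk : SmoothOn k (U₀ ×ˢ Set.univ) := by
    refine SmoothOn.div hP (hU₀.prod isOpen_univ) ?_ ?_ ?_
    · exact hσ₀.comp (DSmooth.smoothOn (DSmooth.prodMk dSmooth_fst dSmooth_const) _)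
        fun z hz => ⟨hz.1, hI0⟩
    · exact DSmooth.smoothOn (hs.smooth.comp dSmooth_fst) _
    · intro z hz
      rw [hp₀ (z.1, 0) ⟨hz.1, hI0⟩, hs.section_]
      simp
  have hσ₁ : SmoothOn σ₁ (U₀ ×ˢ I) :=
    SmoothOn.act hP hσ₀ (hk.mono (Set.prod_mono le_rfl (Set.subset_univ _)))
  have hp₁ : ∀ z ∈ U₀ ×ˢ I, P.proj (σ₁ z) = (z.1, (z.2 : S1)) := fun z hz => by
    rw [hP.proj_act, hp₀ z hz]
  have hs₁ : ∀ n ∈ U₀, σ₁ (n, 0) = s n := fun n hn => hP.act_div (by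
    rw [hp₀ (n, 0) ⟨hn, hI0⟩, hs.section_]
    simp)
  -- `g (n, t)` is the monodromy from `t + 2π` to `t`
  let g : M × ℝ → G := fun z => P.div (σ₁ (z.1, z.2 + 2 * Real.pi)) (σ₁ z)
  have hgp : ∀ z ∈ U₀ ×ˢ Set.Ioo (-Real.pi - min ε₀ 1) (-Real.pi + min ε₀ 1),
      P.proj (σ₁ (z.1, z.2 + 2 * Real.pi)) = P.proj (σ₁ z) ∧ (z.1, z.2 + 2 * Real.pi) ∈ U₀ ×ˢ I ∧
        z ∈ U₀ ×ˢ I := by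
    rintro ⟨n, t⟩ ⟨hn, ht1, ht2⟩
    have h1 := min_le_left ε₀ 1
    have h2 := min_le_right ε₀ 1
    simp only at ht1 ht2 hn
    have h3 : (n, t + 2 * Real.pi) ∈ U₀ ×ˢ I := ⟨hn, by simp only; linarith, by simp only; linarith⟩
    have h4 : (n, t) ∈ U₀ ×ˢ I := ⟨hn, by simp only; linarith, by simp only; linarith⟩
    refine ⟨?_, h3, h4⟩
    rw [hp₁ _ h3, hp₁ _ h4]
    simp
  have hg : SmoothOn g (U₀ ×ˢ Set.Ioo (-Real.pi - min ε₀ 1) (-Real.pi + min ε₀ 1)) := by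
    refine SmoothOn.div hP (hU₀.prod isOpen_Ioo) ?_ (hσ₁.mono fun z hz => (hgp z hz).2.2)
      fun z hz => (hgp z hz).1
    exact hσ₁.comp (DSmooth.smoothOn (DSmooth.prodMk dSmooth_fst
      (DSmooth.comp (contDiff_id.add contDiff_const).dSmooth dSmooth_snd)) _)
      fun z hz => (hgp z hz).2.1
  have hε₁ : 0 < min ε₀ 1 := lt_min hε₀ one_pos
  have hmem : (m, -Real.pi) ∈ U₀ ×ˢ Set.Ioo (-Real.pi - min ε₀ 1) (-Real.pi + min ε₀ 1) :=
    ⟨hm₀, by simp [hε₀], by simp [hε₀]⟩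
  -- shrink the neighbourhood such that smooth paths to the values of `g` exist
  obtain ⟨V, hV, hgV, H, hH, hH'⟩ := exists_smooth_paths (g (m, -Real.pi))
  have hgc : ContinuousAt g (m, -Real.pi) :=
    SmoothOn.continuousAt (hg.mono (Set.singleton_subset_iff.2 hmem))
  obtain ⟨U₁, hU₁, T, hT, hUT⟩ := mem_nhds_prod_iff.1 (hgc.eventually_mem (hV.mem_nhds hgV))
  obtain ⟨U₂, hU₂, hU₂o, hmU₂⟩ := mem_nhds_iff.1 hU₁
  obtain ⟨δ, hδ, hδT⟩ := Metric.mem_nhds_iff.1 hT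
  rw [Real.ball_eq_Ioo] at hδT
  obtain ⟨ε, hε, hε0, hε1, hεδ⟩ : ∃ ε > 0, ε ≤ ε₀ ∧ ε ≤ 1 ∧ ε ≤ δ :=
    ⟨min (min ε₀ 1) δ, lt_min hε₁ hδ, (min_le_left _ _).trans (min_le_left _ _),
      (min_le_left _ _).trans (min_le_right _ _), min_le_right _ _⟩
  have hεm : ε ≤ min ε₀ 1 := le_min hε0 hε1
  obtain ⟨χ, hχ, hχI, hχe⟩ := exists_smooth_retract_real (-Real.pi) hε
  let U : Set M := U₀ ∩ U₂
  have hU : IsOpen U := hU₀.inter hU₂o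
  have hχV : ∀ n ∈ U, ∀ t, g (n, χ t) ∈ V := fun n hn t =>
    hUT (show (n, χ t) ∈ _ from ⟨hU₂ hn.2, hδT ⟨by linarith [(hχI t).1], by linarith [(hχI t).2]⟩⟩)
  -- The correction `η` is `1` for `t ≤ 1` and the monodromy `g (n, t - 2π)` for `t` near `π`; the
  -- map `χ`, the identity near `-π`, keeps the argument of `g` in the domain of `g`.
  let ψ : M × ℝ → M × ℝ := fun z => (z.1, χ (z.2 - 2 * Real.pi))
  have hψ : DSmooth ψ := DSmooth.prodMk dSmooth_fst (DSmooth.comp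
    (g := fun t : ℝ => χ (t - 2 * Real.pi))
    (ContDiff.dSmooth (hχ.comp (contDiff_id.sub contDiff_const))) dSmooth_snd)
  let η : M × ℝ → G := fun z => H (g (ψ z), z.2)
  have hη : SmoothOn η (U ×ˢ Set.univ) := by
    refine hH.comp (SmoothOn.prodMk (hg.comp (DSmooth.smoothOn hψ _) ?_)
      (DSmooth.smoothOn dSmooth_snd _)) fun z hz => ⟨hχV _ hz.1 _, Set.mem_univ _⟩
    exact fun z hz => ⟨hz.1.1, by linarith [(hχI (z.2 - 2 * Real.pi)).1],
      by linarith [(hχI (z.2 - 2 * Real.pi)).2]⟩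
  let σ₂ : M × ℝ → P.Total := fun z => P.act (σ₁ z) (η z)
  have hσ₂ : SmoothOn σ₂ (U ×ˢ I) := SmoothOn.act hP
    (hσ₁.mono (Set.prod_mono Set.inter_subset_left le_rfl))
    (hη.mono (Set.prod_mono le_rfl (Set.subset_univ _)))
  have hσ₂le : ∀ n ∈ U, ∀ t ≤ 1, σ₂ (n, t) = σ₁ (n, t) := fun n hn t ht => by
    simp only [σ₂, η]
    rw [(hH' _ (hχV n hn _)).1 t ht, hP.act_one]
  -- so the corrected section is periodic near `±π`
  have hper : ∀ᶠ t in 𝓝 Real.pi, ∀ n ∈ U, σ₂ (n, t) = σ₂ (n, t - 2 * Real.pi) := by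
    have h1 : ∀ᶠ t in 𝓝 Real.pi, χ (t - 2 * Real.pi) = t - 2 * Real.pi := by
      have : Filter.Tendsto (fun t : ℝ => t - 2 * Real.pi) (𝓝 Real.pi) (𝓝 (-Real.pi)) := by
        rw [show -Real.pi = Real.pi - 2 * Real.pi by ring]
        exact Filter.tendsto_id.sub_const _
      exact this.eventually hχe
    filter_upwards [h1, lt_mem_nhds (show (2 : ℝ) < Real.pi by linarith),
      gt_mem_nhds (show Real.pi < 2 * Real.pi by linarith)] with t ht ht2 ht3 n hn
    have hI := hχI (t - 2 * Real.pi)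
    rw [ht] at hI
    rw [hσ₂le n hn (t - 2 * Real.pi) (by linarith)]
    simp only [σ₂, η, ψ]
    rw [(hH' _ (hχV n hn _)).2 t ht2.le, ht]
    have h2 := (hgp (n, t - 2 * Real.pi) ⟨hn.1, by linarith [hI.1], by linarith [hI.2]⟩).1
    have h3 := hP.act_div h2
    simp only [sub_add_cancel] at h3
    simp only [g, sub_add_cancel]
    exact h3
  have htoR : ∀ θ : S1, θ.toReal ∈ I := fun θ =>
    ⟨by linarith [θ.neg_pi_lt_toReal], by linarith [θ.toReal_le_pi]⟩
  refine ⟨U, hU, ⟨hm₀, hmU₂⟩, fun z => σ₂ (z.1, z.2.toReal), ?_, fun n hn => ⟨fun θ => ?_, ?_⟩⟩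
  · intro N p hp x hx
    obtain ⟨f', hf', hpf'⟩ := (PlotAt.of_isPlot hp.2 x).exists_lift
    obtain ⟨j, hj⟩ := Real.Angle.angle_eq_iff_two_pi_dvd_sub.1
      (hpf'.eq_of_nhds.symm.trans (Real.Angle.coe_toReal (p x).2).symm)
    let f : Eu N → ℝ := fun y => f' y - 2 * Real.pi * j
    have hf : ContDiff ℝ ∞ f := hf'.sub contDiff_const
    have hpf : ∀ᶠ y in 𝓝 x, (p y).2 = ((f y : ℝ) : S1) := by
      filter_upwards [hpf'] with y hy
      rw [hy, Real.Angle.angle_eq_iff_two_pi_dvd_sub]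
      exact ⟨j, by simp only [f]; ring⟩
    have hfx : f x = (p x).2.toReal := by simp only [f]; linarith
    have hmemU : ∀ᶠ y in 𝓝 x, (p y).1 ∈ U :=
      (PlotAt.of_isPlot hp.1 x).eventually_mem hU hx.1
    have hplot : PlotAt (fun y => σ₂ ((p y).1, f y)) x :=
      hσ₂ N (fun y => ((p y).1, f y)) (isPlot_prodMk hp.1 hf.isPlot) x ⟨hx.1, hfx ▸ htoR _⟩
    refine hplot.congr ?_
    have hgt : ∀ᶠ y in 𝓝 x, -Real.pi < f y := hf.continuous.continuousAt.eventually
      (lt_mem_nhds (hfx ▸ (p x).2.neg_pi_lt_toReal))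
    rcases (hfx ▸ (p x).2.toReal_le_pi : f x ≤ Real.pi).lt_or_eq with hlt | heq
    · filter_upwards [hpf, hgt, hf.continuous.continuousAt.eventually (gt_mem_nhds hlt)]
        with y hy hy1 hy2
      rw [hy, Real.Angle.toReal_coe_eq_self_iff.2 ⟨hy1, hy2.le⟩]
    -- at `θ = π` the representative in `(-π, π]` jumps, and periodicity is used
    · have hper' : ∀ᶠ y in 𝓝 x, ∀ n ∈ U, σ₂ (n, f y) = σ₂ (n, f y - 2 * Real.pi) :=
        hf.continuous.continuousAt.eventually (by rwa [heq])
      have hlt : ∀ᶠ y in 𝓝 x, f y < 3 * Real.pi := hf.continuous.continuousAt.eventually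
        (gt_mem_nhds (by linarith))
      filter_upwards [hpf, hgt, hper', hmemU, hlt] with y hy hy1 hy2 hyU hy3
      rw [hy]
      by_cases hle : f y ≤ Real.pi
      · rw [Real.Angle.toReal_coe_eq_self_iff.2 ⟨hy1, hle⟩]
      · have h1 : ((f y : ℝ) : S1) = ((f y - 2 * Real.pi : ℝ) : S1) := by simp
        rw [h1, Real.Angle.toReal_coe_eq_self_iff.2 ⟨by linarith, by linarith⟩, hy2 _ hyU]
  · rw [show P.proj (σ₂ (n, θ.toReal)) = P.proj (σ₁ (n, θ.toReal)) from hP.proj_act _ _,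
      hp₁ _ ⟨hn.1, htoR θ⟩, Real.Angle.coe_toReal]
  · simp only [Real.Angle.toReal_zero]
    rw [hσ₂le n hn 0 zero_le_one, hs₁ n hn.1]

end FramedSection

section Transforms

variable {G : Man.{u}} [Group G] [LieGroup (𝓡 G.dim) ∞ G]

omit [LieGroup (𝓡 G.dim) ∞ G] in
theorem isPlot_loopTotal_iff {Q : FramedBundle G} {n : ℕ} {p : Eu n → LoopTotal Q} :
    IsPlot p ↔ (IsPlot fun y => (p y).1.1) ∧ DSmooth fun z : Eu n × S1 => (p z.1).loop z.2 :=
  Iff.rfl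

omit [LieGroup (𝓡 G.dim) ∞ G] in
theorem IsPlot.loop {Q : FramedBundle G} {n : ℕ} {p : Eu n → LoopTotal Q} (hp : IsPlot p)
    {θ : Eu n → S1} (hθ : IsPlot θ) : IsPlot fun y => (p y).loop (θ y) :=
  (isPlot_loopTotal_iff.1 hp).2 n (fun y => (y, θ y)) ⟨isPlot_id, hθ⟩

omit [LieGroup (𝓡 G.dim) ∞ G] in
theorem LoopTotal.proj_loop {Q : FramedBundle G} (a : LoopTotal Q) (θ : S1) :
    Q.bundle.proj (a.loop θ) = (a.1.1, θ) := a.2.1 θ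

omit [LieGroup (𝓡 G.dim) ∞ G] in
theorem LoopTotal.loop_zero {Q : FramedBundle G} (a : LoopTotal Q) :
    a.loop 0 = Q.frame a.1.1 := by
  obtain ⟨m, hm⟩ := a.2.2
  have h2 : Q.frame m = a.loop 0 := hm
  have h1 : (m, (0 : S1)) = (a.1.1, 0) := by
    rw [← Q.framing.section_, h2]
    exact a.proj_loop 0
  have h3 : m = a.1.1 := congrArg Prod.fst h1
  rw [← h2, h3]

/-- The transform of a framed bundle is a principal `ΩG`-bundle. -/
theorem invCaloronData_isPrincipal [ConnectedSpace G] (Q : FramedBundle G) :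
    (invCaloronData Q).IsPrincipal := by
  classical
  have hQ := Q.principal
  refine BundleData.isPrincipal_of_sections (P := invCaloronData Q)
    (fun a => LoopTotal.ext fun θ => hQ.act_one _)
    (fun a γ δ => LoopTotal.ext fun θ => hQ.act_mul _ _ _) (fun _ _ => rfl)
    (fun n p hp => hp.1) ?_ ?_ fun m => ?_
  · exact fun n p hp => ⟨hp.1.1, fun k q hq => hQ.isPlot_act (hp.1.2 k q hq) (hp.2 k q hq)⟩
  · exact fun a γ δ h => LoopGroup.ext fun θ =>
      hQ.free (congrArg (fun b : LoopTotal Q => b.loop θ) h)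
  obtain ⟨U, hU, hm, σ, hσ, hσU⟩ := exists_framed_section hQ Q.framing m
  have hσθ : ∀ n ∈ U, DSmooth fun θ => σ (n, θ) := fun n hn k q hq =>
    hσ.isPlot (p := fun y => (n, q y)) ⟨isPlot_const, hq⟩ fun y => ⟨hn, Set.mem_univ _⟩
  let s' : ∀ n ∈ U, LoopTotal Q := fun n hn => ⟨(n, ⟨fun θ => σ (n, θ), hσθ n hn⟩),
    (hσU n hn).1, n, (hσU n hn).2.symm⟩
  let s : Q.base → LoopTotal Q := fun n => if h : n ∈ U then s' n h else s' m hm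
  have hs : ∀ n (h : n ∈ U) θ, (s n).loop θ = σ (n, θ) := fun n h θ => by
    simp only [s, dif_pos h]
    rfl
  have hsp : ∀ n ∈ U, (s n).1.1 = n := fun n h => by
    simp only [s, dif_pos h]
    rfl
  have hdp : ∀ (a : LoopTotal Q) (_ : a.1.1 ∈ U) θ,
      Q.bundle.proj (σ (a.1.1, θ)) = Q.bundle.proj (a.loop θ) := fun a ha θ => by
    rw [(hσU _ ha).1, a.proj_loop]
  let d' : ∀ a : LoopTotal Q, a.1.1 ∈ U → LoopGroup G := fun a ha =>
    ⟨⟨fun θ => Q.bundle.div (σ (a.1.1, θ)) (a.loop θ), fun k q hq =>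
      hQ.isPlot_div (hσθ _ ha k q hq) (a.1.2.smooth k q hq) fun y => hdp a ha _⟩,
      hQ.div_eq (by rw [(hσU _ ha).2, hQ.act_one, a.loop_zero])⟩
  let d : LoopTotal Q → LoopGroup G := fun a => if h : a.1.1 ∈ U then d' a h else 1
  have hd : ∀ a (h : a.1.1 ∈ U) θ, d a θ = Q.bundle.div (σ (a.1.1, θ)) (a.loop θ) :=
    fun a h θ => by
      simp only [d, dif_pos h]
      rfl
  refine ⟨U, hU, hm, s, fun n p hp x hx => ?_, hsp, d, fun n p hp x hx => ?_, fun a ha => ?_⟩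
  · obtain ⟨r, hr, hrU, hrx⟩ := exists_retract_of_eventually
      ((PlotAt.of_isPlot hp x).eventually_mem hU hx)
    refine ⟨fun y => s (p (r y)), isPlot_loopTotal_iff.2 ⟨?_, fun k q hq => ?_⟩,
      hrx.mono fun y hy => congrArg (fun z => s (p z)) hy.symm⟩
    · simp only [hsp _ (hrU _)]
      exact isPlot_reparam hp hr
    · simp only [Function.comp_def, hs _ (hrU _)]
      exact hσ.isPlot (p := fun y => (p (r (q y).1), (q y).2))
        ⟨isPlot_reparam hp (hr.comp hq.1.contDiff), hq.2⟩ fun y => ⟨hrU _, Set.mem_univ _⟩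
  · have hp1 : IsPlot fun y => (p y).1.1 := hp.1
    obtain ⟨r, hr, hrU, hrx⟩ := exists_retract_of_eventually
      ((PlotAt.of_isPlot hp1 x).eventually_mem hU hx)
    refine ⟨fun y => d (p (r y)), isPlot_loopGroup_iff.2 fun k q hq => ?_,
      hrx.mono fun y hy => congrArg (fun z => d (p z)) hy.symm⟩
    simp only [Function.comp_def, hd _ (hrU _)]
    have hrq : IsPlot fun y => p (r (q y).1) := isPlot_reparam hp (hr.comp hq.1.contDiff)
    refine hQ.isPlot_div ?_ (IsPlot.loop hrq hq.2) fun y => hdp _ (hrU _) _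
    exact hσ.isPlot (p := fun y => ((p (r (q y).1)).1.1, (q y).2))
        ⟨hrq.1, hq.2⟩ fun y => ⟨hrU _, Set.mem_univ _⟩
  · refine LoopTotal.ext fun θ => ?_
    change Q.bundle.act ((s a.1.1).loop θ) (d a θ) = _
    refine (congrArg₂ Q.bundle.act (hs _ ha θ) (hd a ha θ)).trans (hQ.act_div (hdp a ha θ))

end Transforms

section Quotient

variable {X Y : Type*} [DiffeologicalSpace X] [DiffeologicalSpace Y] {s : Setoid X} {n : ℕ}

theorem isPlot_quotient_iff {p : Eu n → Quotient s} :
    IsPlot p ↔ ∀ x, ∃ q : Eu n → X, IsPlot q ∧ p =ᶠ[𝓝 x] fun y => Quotient.mk s (q y) := Iff.rfl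

theorem dSmooth_quotientMk : DSmooth (Quotient.mk s) :=
  fun _ p hp => isPlot_quotient_iff.2 fun _ => ⟨p, hp, .rfl⟩

theorem dSmooth_quotient {f : Quotient s → Y} (hf : DSmooth fun a => f (Quotient.mk s a)) :
    DSmooth f := fun n p hp => isPlot_of_plotAt fun x => by
  obtain ⟨q, hq, h⟩ := isPlot_quotient_iff.1 hp x
  exact ⟨_, hf n q hq, h.mono fun y hy => congrArg f hy⟩

end Quotient

/-! ### The transforms of bundles without connection -/

section Caloron

variable {G : Man.{u}} [Group G] [LieGroup (𝓡 G.dim) ∞ G] (P : LoopBundle G)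

theorem mk_eq_mk_iff {p q : P.bundle.Total} {g h : G} {θ θ' : S1} :
    mk P p g θ = mk P q h θ' ↔
      ∃ γ : LoopGroup G, q = P.bundle.act p γ ∧ h = (γ θ)⁻¹ * g ∧ θ' = θ := by
  refine Quotient.eq''.trans ⟨?_, ?_⟩
  · rintro ⟨γ, h⟩
    exact ⟨γ, congrArg Prod.fst h, congrArg (fun z => z.2.1) h, congrArg (fun z => z.2.2) h⟩
  · rintro ⟨γ, rfl, rfl, rfl⟩
    exact ⟨γ, rfl⟩

theorem mk_act (p : P.bundle.Total) (γ : LoopGroup G) (g : G) (θ : S1) :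
    mk P (P.bundle.act p γ) g θ = mk P p (γ θ * g) θ :=
  ((mk_eq_mk_iff P).2 ⟨γ, rfl, by simp, rfl⟩).symm

theorem caloronData_act_mk (p : P.bundle.Total) (g h : G) (θ : S1) :
    (caloronData P).act (mk P p g θ) h = mk P p (g * h) θ := rfl

theorem isPlot_caloronData_iff {n : ℕ} {p : Eu n → (caloronData P).Total} :
    IsPlot p ↔ ∀ x, ∃ q : Eu n → P.bundle.Total × G × S1, IsPlot q ∧
      p =ᶠ[𝓝 x] fun y => mk P (q y).1 (q y).2.1 (q y).2.2 := Iff.rfl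

theorem plotAt_mk {n : ℕ} {p : Eu n → P.bundle.Total} {g : Eu n → G} {θ : Eu n → S1} {x : Eu n}
    (hp : PlotAt p x) (hg : PlotAt g x) (hθ : PlotAt θ x) :
    PlotAt (X := (caloronData P).Total) (fun y => mk P (p y) (g y) (θ y)) x :=
  (hp.prodMk (hg.prodMk hθ)).dSmooth_comp (dSmooth_quotientMk (s := orbitRel P))

theorem isPlot_mk {n : ℕ} {p : Eu n → P.bundle.Total} {g : Eu n → G} {θ : Eu n → S1}
    (hp : IsPlot p) (hg : IsPlot g) (hθ : IsPlot θ) :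
    IsPlot (X := (caloronData P).Total) (fun y => mk P (p y) (g y) (θ y)) :=
  dSmooth_quotientMk (s := orbitRel P) n (fun y => (p y, g y, θ y)) ⟨hp, hg, hθ⟩

theorem exists_rep (z : (caloronData P).Total) : ∃ p g θ, z = mk P p g θ := by
  obtain ⟨⟨p, g, θ⟩, rfl⟩ := Quotient.exists_rep z
  exact ⟨p, g, θ, rfl⟩

theorem caloronData_free {z : (caloronData P).Total} {k l : G}
    (h : (caloronData P).act z k = (caloronData P).act z l) : k = l := by
  obtain ⟨p, g, θ, rfl⟩ := exists_rep P z
  obtain ⟨γ, h1, h2, -⟩ := (mk_eq_mk_iff P).1 h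
  have hγ : (1 : LoopGroup G) = γ := P.principal.free (p := p) (by rw [P.principal.act_one, ← h1])
  rw [← hγ, LoopGroup.one_apply, inv_one, one_mul] at h2
  exact (mul_left_cancel h2).symm

/-- The transform of an `ΩG`-bundle is a principal `G`-bundle: a local section `s` of the former
gives the local section `(m, θ) ↦ [s m, 1, θ]` of the latter. -/
theorem caloronData_isPrincipal : (caloronData P).IsPrincipal := by
  have hP := P.principal
  refine BundleData.isPrincipal_of_sections (P := caloronData P) (fun z => ?_) (fun z k l => ?_)
    (fun z k => ?_) ?_ ?_ (fun z k l => caloronData_free P) ?_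
  · obtain ⟨p, g, θ, rfl⟩ := exists_rep P z
    rw [caloronData_act_mk, mul_one]
  · obtain ⟨p, g, θ, rfl⟩ := exists_rep P z
    rw [caloronData_act_mk, caloronData_act_mk, caloronData_act_mk, mul_assoc]
  · obtain ⟨p, g, θ, rfl⟩ := exists_rep P z
    rfl
  · exact dSmooth_quotient (s := orbitRel P) fun n p hp =>
      ⟨hP.smooth_proj n _ hp.1, hp.2.2⟩
  · refine fun n p hp => isPlot_of_plotAt fun x => ?_
    obtain ⟨q, hq, h⟩ := (isPlot_caloronData_iff P).1 hp.1 x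
    refine ⟨_, isPlot_mk P hq.1 (SmoothGroup.isPlot_mul hq.2.1 hp.2) hq.2.2, ?_⟩
    filter_upwards [h] with y hy
    exact congrArg (fun z => (caloronData P).act z (p y).2) hy
  · rintro ⟨m, θ₀⟩
    obtain ⟨U, hU, hm, s, hs, hsU⟩ := hP.exists_section m
    let σ : P.base × S1 → (caloronData P).Total := fun z => mk P (s z.1) 1 z.2
    let d := fun z => (caloronData P).div (σ ((caloronData P).proj z)) z
    have hd : ∀ p g θ, P.bundle.proj p ∈ U →
        (caloronData P).act (σ (P.bundle.proj p, θ))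
          (P.bundle.div (s (P.bundle.proj p)) p θ * g) = mk P p g θ := by
      intro p g θ hp
      have h1 := hP.act_div (hsU _ hp)
      conv_rhs => rw [← h1]
      rw [mk_act, caloronData_act_mk, one_mul]
    have hd' : ∀ p g θ, P.bundle.proj p ∈ U →
        d (mk P p g θ) = P.bundle.div (s (P.bundle.proj p)) p θ * g := fun p g θ hp =>
      caloronData_free P ((BundleData.act_div_of_exists ⟨_, hd p g θ hp⟩).trans
        (hd p g θ hp).symm)
    refine ⟨U ×ˢ Set.univ, hU.prod isOpen_univ, ⟨hm, Set.mem_univ _⟩, σ, ?_, fun z hz => ?_, d,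
      ?_, fun z hz => ?_⟩
    · exact fun n p hp x hx => plotAt_mk P (hs n _ hp.1 x hx.1) (.of_isPlot isPlot_const x)
        (.of_isPlot hp.2 x)
    · exact Prod.ext (hsU _ hz.1) rfl
    · intro n p hp x hx
      obtain ⟨q, hq, h⟩ := (isPlot_caloronData_iff P).1 hp x
      have hproj : IsPlot fun y => P.bundle.proj (q y).1 := hP.smooth_proj n _ hq.1
      have hxU : P.bundle.proj (q x).1 ∈ U := by
        have := hx.1
        rwa [h.eq_of_nhds] at this
      have hyU := (PlotAt.of_isPlot hproj x).eventually_mem hU hxU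
      have hγ : PlotAt (fun y => P.bundle.div (s (P.bundle.proj (q y).1)) (q y).1) x :=
        hP.plotAt_div (hs n _ hproj x hxU) (.of_isPlot hq.1 x)
          (hyU.mono fun y hy => hsU _ hy)
      obtain ⟨γ, hγp, hγe⟩ := hγ
      refine ⟨_, SmoothGroup.isPlot_mul (IsPlot.loopGroup_eval hγp hq.2.2) hq.2.1, ?_⟩
      filter_upwards [h, hyU, hγe] with y hy hyU hγy
      rw [hy, hd' _ _ _ hyU, hγy]
    · obtain ⟨p, g, θ, rfl⟩ := exists_rep P z
      rw [hd' p g θ hz.1]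
      exact hd p g θ hz.1

theorem caloronFrame_isFraming : IsFraming (caloronData P) (caloronFrame P) where
  smooth n p hp := isPlot_of_plotAt fun x => by
    obtain ⟨U, hU, hm, s, hs, hsU⟩ := P.principal.exists_section (p x)
    refine (plotAt_mk P (hs n p hp x hm) (.of_isPlot (isPlot_const (x := 1)) x)
      (.of_isPlot (isPlot_const (x := 0)) x)).congr ?_
    filter_upwards [(PlotAt.of_isPlot hp x).eventually_mem hU hm] with y hy
    have := caloronFrame_proj P (s (p y))
    rwa [hsU _ hy] at this
  section_ m := by
    obtain ⟨p, rfl⟩ := P.principal.proj_surjective m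
    rw [caloronFrame_proj]
    rfl

end Caloron

section Equivalence

variable {G : Man.{u}} [Group G] [LieGroup (𝓡 G.dim) ∞ G]

variable (hC : ∀ P : LoopBundle G, (caloronData P).IsPrincipal ∧
    IsFraming (caloronData P) (caloronFrame P))
  (hF : ∀ Q : FramedBundle G, (invCaloronData Q).IsPrincipal)

/-- The bundle map `p ↦ (θ ↦ [p, 1, θ])`. -/
def toInvCaloronCaloron (P : LoopBundle G) : P ⟶ (caloron hC ⋙ invCaloron hF).obj P where
  toFun p := ⟨(P.bundle.proj p, ⟨fun θ => mk P p 1 θ, fun n q hq =>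
      isPlot_mk P isPlot_const isPlot_const hq⟩), fun _ => rfl,
    P.bundle.proj p, caloronFrame_proj P p⟩
  baseMap := id
  smooth n p hp := isPlot_loopTotal_iff.2 ⟨P.principal.smooth_proj n p hp, fun m q hq =>
    isPlot_mk P (isPlot_reparam hp hq.1.contDiff) isPlot_const hq.2⟩
  smooth_base := contMDiff_id
  equivariant p γ := LoopTotal.ext fun θ => by
    refine (mk_act P p γ 1 θ).trans ?_
    change _ = (caloronData P).act (mk P p 1 θ) (γ θ)
    rw [caloronData_act_mk, mul_one, one_mul]
  covers _ := rfl

/-- The bundle map `[f, g, θ] ↦ f(θ)g`. -/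
def ofCaloronInvCaloron (Q : FramedBundle G) : (invCaloron hF ⋙ caloron hC).obj Q ⟶ Q where
  toFun := Quotient.lift
    (fun a : LoopTotal Q × G × S1 => Q.bundle.act (a.1.loop a.2.2) a.2.1) (by
      rintro ⟨a, g, θ⟩ _ ⟨γ, rfl⟩
      change _ = Q.bundle.act (Q.bundle.act (a.loop θ) (γ θ)) ((γ θ)⁻¹ * g)
      rw [← Q.principal.act_mul, mul_inv_cancel_left])
  baseMap := id
  smooth := dSmooth_quotient (s := orbitRel ((invCaloron hF).obj Q)) fun _ _ hp =>
    Q.principal.isPlot_act (IsPlot.loop hp.1 hp.2.2) hp.2.1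
  smooth_base := contMDiff_id
  equivariant := by
    rintro ⟨a, g, θ⟩ h
    exact Q.principal.act_mul _ _ _
  covers := by
    rintro ⟨a, g, θ⟩
    exact (Q.principal.proj_act _ _).trans (LoopTotal.proj_loop a θ)
  map_frame m := by
    obtain ⟨a, rfl⟩ := (hF Q).proj_surjective m
    refine (congrArg _ (caloronFrame_proj ((invCaloron hF).obj Q) a)).trans ?_
    exact (Q.principal.act_one _).trans (LoopTotal.loop_zero a)

instance isIso_toInvCaloronCaloron (P : LoopBundle G) :
    IsIso (toInvCaloronCaloron hC hF P) := by
  obtain ⟨g, hg, hl, hr, hact, hproj⟩ := P.principal.exists_smooth_inverse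
    (hF (caloronObj hC P)) (toInvCaloronCaloron hC hF P).smooth
    (toInvCaloronCaloron hC hF P).equivariant fun _ => rfl
  exact ⟨⟨g, id, hg, contMDiff_id, hact, hproj⟩, LoopBundle.Hom.ext (funext hl) rfl,
    LoopBundle.Hom.ext (funext hr) rfl⟩

instance isIso_ofCaloronInvCaloron (Q : FramedBundle G) :
    IsIso (ofCaloronInvCaloron hC hF Q) := by
  obtain ⟨g, hg, hl, hr, hact, hproj⟩ := (hC (invCaloronObj hF Q)).1.exists_smooth_inverse
    Q.principal (ofCaloronInvCaloron hC hF Q).smooth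
    (ofCaloronInvCaloron hC hF Q).equivariant (ofCaloronInvCaloron hC hF Q).covers
  refine ⟨⟨g, id, hg, contMDiff_id, hact, hproj, fun m => ?_⟩,
    FramedBundle.Hom.ext (funext hl) rfl, FramedBundle.Hom.ext (funext hr) rfl⟩
  exact (congrArg g ((ofCaloronInvCaloron hC hF Q).map_frame m)).symm.trans (hl _)

/-- The natural isomorphism `α`. -/
noncomputable def caloronUnitIso : caloron hC ⋙ invCaloron hF ≅ 𝟭 (LoopBundle G) :=
  (NatIso.ofComponents (F := 𝟭 (LoopBundle G)) (fun P =>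
    @asIso _ _ _ _ (toInvCaloronCaloron hC hF P) (isIso_toInvCaloronCaloron hC hF P))
    fun _ => LoopBundle.Hom.ext (funext fun _ => LoopTotal.ext fun _ => rfl) rfl).symm

/-- The natural isomorphism `β`. -/
noncomputable def caloronCounitIso : invCaloron hF ⋙ caloron hC ≅ 𝟭 (FramedBundle G) :=
  NatIso.ofComponents (G := 𝟭 (FramedBundle G)) (fun Q =>
    @asIso _ _ _ _ (ofCaloronInvCaloron hC hF Q) (isIso_ofCaloronInvCaloron hC hF Q))
    fun f => FramedBundle.Hom.ext (funext (by
      rintro ⟨a, g, θ⟩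
      exact (f.equivariant _ _).symm)) rfl

end Equivalence

/-! ### Logarithmic derivatives and the adjoint action -/

section LieCalculus

variable {G : Man.{u}} [Group G] {E F : Type*} [NormedAddCommGroup E] [NormedSpace ℝ E]
  [NormedAddCommGroup F] [NormedSpace ℝ F]

/-- The derivative at `x`, read in the chart of `G` at `1`, of a map `f` to `G` (which is
meaningful if `f x = 1`). -/
noncomputable def chartDeriv (f : E → G) (x : E) : E →L[ℝ] LieAlg G :=
  fderiv ℝ (fun y => extChartAt (𝓡 G.dim) (1 : G) (f y)) x

/-- The left logarithmic derivative of a map `f` from a normed space to `G`. -/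
noncomputable def mc (f : E → G) (x : E) : E →L[ℝ] LieAlg G :=
  chartDeriv (fun y => (f x)⁻¹ * f y) x

/-- `f` is smooth at `x`, as a map from a normed space to `G`. -/
abbrev SmAt (f : E → G) (x : E) : Prop := ContMDiffAt 𝓘(ℝ, E) (𝓡 G.dim) ∞ f x

omit [Group G] in
theorem SmAt.comp {f : E → G} {k : F → E} {x : F} (hf : SmAt f (k x))
    (hk : ContDiffAt ℝ ∞ k x) : SmAt (fun y => f (k y)) x :=
  ContMDiffAt.comp (f := k) x hf hk.contMDiffAt

theorem SmAt.contDiffAt_chart {f : E → G} {x : E} (hf : SmAt f x) (hx : f x = 1) :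
    ContDiffAt ℝ ∞ (fun y => extChartAt (𝓡 G.dim) (1 : G) (f y)) x := by
  have h1 : ContMDiffAt (𝓡 G.dim) 𝓘(ℝ, Eu G.dim) ∞ (extChartAt (𝓡 G.dim) (1 : G)) (f x) := by
    rw [hx]
    exact contMDiffAt_extChartAt
  exact (ContMDiffAt.comp (f := f) x h1 hf).contDiffAt

theorem mfderiv_eq_chartDeriv {f : E → G} {x : E} (hf : SmAt f x) (hx : f x = 1) (v : E) :
    (mfderiv 𝓘(ℝ, E) (𝓡 G.dim) f x v : LieAlg G) = chartDeriv f x v := by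
  have h : fderivWithin ℝ (writtenInExtChartAt 𝓘(ℝ, E) (𝓡 G.dim) x f) (Set.range 𝓘(ℝ, E))
      (extChartAt 𝓘(ℝ, E) x x) = chartDeriv f x := by
    rw [modelWithCornersSelf_coe, Set.range_id, fderivWithin_univ, writtenInExtChartAt, hx]
    rfl
  exact (congrArg (fun L : E →L[ℝ] LieAlg G => L v)
    (MDifferentiableAt.mfderiv (hf.mdifferentiableAt (by simp)))).trans (DFunLike.congr_fun h v)

theorem chartDeriv_congr {f g : E → G} {x : E} (h : f =ᶠ[𝓝 x] g) :
    chartDeriv f x = chartDeriv g x :=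
  Filter.EventuallyEq.fderiv_eq (h.fun_comp (extChartAt (𝓡 G.dim) (1 : G)))

theorem chartDeriv_const (g : G) (x : E) : chartDeriv (fun _ => g) x = 0 := by
  simp [chartDeriv]

theorem chartDeriv_comp {f : E → G} {k : F → E} {x : F} (hf : SmAt f (k x)) (h1 : f (k x) = 1)
    (hk : DifferentiableAt ℝ k x) (v : F) :
    chartDeriv (fun y => f (k y)) x v = chartDeriv f (k x) (fderiv ℝ k x v) := by
  have := fderiv_comp x (g := fun y => extChartAt (𝓡 G.dim) (1 : G) (f y)) (f := k)
    ((hf.contDiffAt_chart h1).differentiableAt (by simp)) hk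
  exact DFunLike.congr_fun this v

/-- The inverse of the chart at `1`, centred at the origin. -/
noncomputable def chartInv (G : Man.{u}) [Group G] (z : LieAlg G) : G :=
  (extChartAt (𝓡 G.dim) (1 : G)).symm (extChartAt (𝓡 G.dim) (1 : G) 1 + z)

theorem chartInv_zero : chartInv G 0 = 1 := by
  rw [chartInv, add_zero]
  exact (extChartAt (𝓡 G.dim) (1 : G)).left_inv (mem_extChartAt_source (1 : G))

theorem smAt_chartInv : SmAt (chartInv G) 0 := by
  have h1 : ContMDiffAt 𝓘(ℝ, Eu G.dim) (𝓡 G.dim) ∞ (extChartAt (𝓡 G.dim) (1 : G)).symm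
      (extChartAt (𝓡 G.dim) (1 : G) 1 + 0) := by
    rw [add_zero]
    exact (contMDiffOn_extChartAt_symm (I := 𝓡 G.dim) (n := ∞) (1 : G)).contMDiffAt
      (extChartAt_target_mem_nhds (I := 𝓡 G.dim) (1 : G))
  exact ContMDiffAt.comp (f := fun z : LieAlg G => extChartAt (𝓡 G.dim) (1 : G) 1 + z) 0 h1
    (contDiff_const.add contDiff_id).contMDiff.contMDiffAt

theorem chart_chartInv : ∀ᶠ z in 𝓝 (0 : LieAlg G),
    extChartAt (𝓡 G.dim) (1 : G) (chartInv G z) = extChartAt (𝓡 G.dim) (1 : G) 1 + z := by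
  have hc : ContinuousAt (fun z : LieAlg G => extChartAt (𝓡 G.dim) (1 : G) 1 + z) 0 := by fun_prop
  have : (extChartAt (𝓡 G.dim) (1 : G)).target ∈ 𝓝 (extChartAt (𝓡 G.dim) (1 : G) 1 + 0) := by
    rw [add_zero]
    exact extChartAt_target_mem_nhds (I := 𝓡 G.dim) (1 : G)
  filter_upwards [hc.eventually_mem this] with z hz
  exact (extChartAt (𝓡 G.dim) (1 : G)).right_inv hz

/-- Near `x`, a map with `f x = 1` is recovered from its expression in the chart. -/
theorem chartInv_chart {f : E → G} {x : E} (hf : SmAt f x) (hx : f x = 1) :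
    ∀ᶠ y in 𝓝 x, chartInv G (extChartAt (𝓡 G.dim) (1 : G) (f y) -
      extChartAt (𝓡 G.dim) (1 : G) 1) = f y := by
  have : (extChartAt (𝓡 G.dim) (1 : G)).source ∈ 𝓝 (f x) :=
    hx ▸ extChartAt_source_mem_nhds (I := 𝓡 G.dim) (1 : G)
  filter_upwards [hf.continuousAt.eventually_mem this] with y hy
  rw [chartInv, add_sub_cancel]
  exact (extChartAt (𝓡 G.dim) (1 : G)).left_inv hy

theorem chartDeriv_chartInv (v : LieAlg G) : chartDeriv (chartInv G) 0 v = v := by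
  have h : chartDeriv (chartInv G) 0 = ContinuousLinearMap.id ℝ (LieAlg G) :=
    (Filter.EventuallyEq.fderiv_eq chart_chartInv).trans ((fderiv_const_add _).trans fderiv_id)
  rw [h]
  rfl

variable [LieGroup (𝓡 G.dim) ∞ G]

theorem SmAt.mul {f g : E → G} {x : E} (hf : SmAt f x) (hg : SmAt g x) :
    SmAt (fun y => f y * g y) x := ContMDiffAt.mul (I := 𝓡 G.dim) hf hg

theorem SmAt.inv {f : E → G} {x : E} (hf : SmAt f x) : SmAt (fun y => (f y)⁻¹) x :=
  ContMDiffAt.inv (I := 𝓡 G.dim) hf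

omit [LieGroup (𝓡 G.dim) ∞ G] [Group G] in
theorem smAt_const (g : G) (x : E) : SmAt (fun _ => g) x := contMDiffAt_const

theorem SmAt.left_inv_mul {f : E → G} {x : E} (hf : SmAt f x) :
    SmAt (fun y => (f x)⁻¹ * f y) x := (smAt_const _ _).mul hf

theorem maurerCartan_eq_mc {n : ℕ} {κ : Eu n → G} (hκ : IsPlot κ) (x v : Eu n) :
    maurerCartan κ x v = mc κ x v :=
  mfderiv_eq_chartDeriv (SmAt.left_inv_mul (isPlot_man_iff.1 hκ x)) (inv_mul_cancel _) v

/-- The product rule at the identity. -/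
theorem chartDeriv_mul {f g : E → G} {x : E} (hf : SmAt f x) (hg : SmAt g x) (hfx : f x = 1)
    (hgx : g x = 1) :
    chartDeriv (fun y => f y * g y) x = chartDeriv f x + chartDeriv g x := by
  let c := extChartAt (𝓡 G.dim) (1 : G) 1
  let f' : E → LieAlg G := fun y => extChartAt (𝓡 G.dim) (1 : G) (f y) - c
  let g' : E → LieAlg G := fun y => extChartAt (𝓡 G.dim) (1 : G) (g y) - c
  have hf' : DifferentiableAt ℝ f' x :=
    ((hf.contDiffAt_chart hfx).sub contDiffAt_const).differentiableAt (by simp)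
  have hg' : DifferentiableAt ℝ g' x :=
    ((hg.contDiffAt_chart hgx).sub contDiffAt_const).differentiableAt (by simp)
  have hf0 : f' x = 0 := by simp [f', hfx, c]
  have hg0 : g' x = 0 := by simp [g', hgx, c]
  let m : LieAlg G × LieAlg G → G := fun z => chartInv G z.1 * chartInv G z.2
  have hm : SmAt m 0 := SmAt.mul
    (SmAt.comp (k := Prod.fst) (x := (0 : LieAlg G × LieAlg G)) smAt_chartInv contDiffAt_fst)
    (SmAt.comp (k := Prod.snd) (x := (0 : LieAlg G × LieAlg G)) smAt_chartInv contDiffAt_snd)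
  have hm0 : m 0 = 1 := by simp [m, chartInv_zero]
  have hl : ∀ v, chartDeriv m 0 (v, 0) = v := fun v => by
    have h := chartDeriv_comp (k := fun v : LieAlg G => (v, (0 : LieAlg G))) (x := 0) (f := m)
      hm hm0 (by fun_prop) v
    have h2 : fderiv ℝ (fun v : LieAlg G => (v, (0 : LieAlg G))) 0 v = (v, 0) :=
      fderiv_prodMk_const _ _ _
    rw [h2] at h
    refine h.symm.trans ?_
    simp only [m, chartInv_zero, mul_one]
    exact chartDeriv_chartInv v
  have hr : ∀ v, chartDeriv m 0 (0, v) = v := fun v => by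
    have h := chartDeriv_comp (k := fun v : LieAlg G => ((0 : LieAlg G), v)) (x := 0) (f := m)
      hm hm0 (by fun_prop) v
    have h2 : fderiv ℝ (fun v : LieAlg G => ((0 : LieAlg G), v)) 0 v = (0, v) :=
      fderiv_const_prodMk _ _ _
    rw [h2] at h
    refine h.symm.trans ?_
    simp only [m, chartInv_zero, one_mul]
    exact chartDeriv_chartInv v
  have hk0 : ((f' x, g' x) : LieAlg G × LieAlg G) = 0 := by rw [hf0, hg0]; rfl
  have hfg : (fun y => f y * g y) =ᶠ[𝓝 x] fun y => m (f' y, g' y) := by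
    filter_upwards [chartInv_chart hf hfx, chartInv_chart hg hgx] with y hy hy'
    simp only [m, f', g', c, hy, hy']
  ext1 v
  rw [chartDeriv_congr hfg, chartDeriv_comp (f := m) (k := fun y => (f' y, g' y))
    (by rw [hk0]; exact hm) (by rw [hk0]; exact hm0) (hf'.prodMk hg'), hk0,
    (hf'.hasFDerivAt.prodMk hg'.hasFDerivAt).fderiv]
  have : ((fderiv ℝ f' x).prod (fderiv ℝ g' x)) v =
      (fderiv ℝ f' x v, (0 : LieAlg G)) + ((0 : LieAlg G), fderiv ℝ g' x v) := by
    simp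
  rw [this, map_add, hl, hr]
  simp only [f', g', fderiv_sub_const]
  rfl

theorem Ad_eq_chartDeriv (g : G) (ξ : LieAlg G) :
    Ad g ξ = chartDeriv (fun z => g * chartInv G z * g⁻¹) 0 ξ := by
  have h1 : ContMDiffAt (𝓡 G.dim) (𝓡 G.dim) ∞ (fun h : G => g * h * g⁻¹) (chartInv G 0) :=
    ((contMDiff_const.mul contMDiff_id).mul contMDiff_const).contMDiffAt
  have h2 := mfderiv_comp (I := 𝓘(ℝ, LieAlg G)) (I' := 𝓡 G.dim) (I'' := 𝓡 G.dim) (0 : LieAlg G)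
    (f := chartInv G) (g := fun h : G => g * h * g⁻¹) (h1.mdifferentiableAt (by simp))
    (smAt_chartInv.mdifferentiableAt (by simp))
  have h3 := mfderiv_eq_chartDeriv (f := fun z => g * chartInv G z * g⁻¹) (x := (0 : LieAlg G))
    (((smAt_const g _).mul smAt_chartInv).mul (smAt_const _ _)) (by simp [chartInv_zero]) ξ
  rw [← h3]
  have h4 := DFunLike.congr_fun h2 ξ
  refine Eq.trans ?_ h4.symm
  have h5 := mfderiv_eq_chartDeriv smAt_chartInv (chartInv_zero (G := G)) ξ
  rw [chartDeriv_chartInv] at h5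
  change _ = mfderiv (𝓡 G.dim) (𝓡 G.dim) (fun h : G => g * h * g⁻¹) (chartInv G 0)
    (mfderiv 𝓘(ℝ, LieAlg G) (𝓡 G.dim) (chartInv G) 0 ξ)
  rw [show mfderiv 𝓘(ℝ, LieAlg G) (𝓡 G.dim) (chartInv G) 0 ξ = ξ from h5, chartInv_zero]
  rfl

/-- `Ad g` is the derivative of conjugation by `g` along arbitrary maps, not only along the chart. -/
theorem chartDeriv_conj (g : G) {f : E → G} {x : E} (hf : SmAt f x) (hx : f x = 1) (v : E) :
    chartDeriv (fun y => g * f y * g⁻¹) x v = Ad g (chartDeriv f x v) := by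
  let c := extChartAt (𝓡 G.dim) (1 : G) 1
  let f' : E → LieAlg G := fun y => extChartAt (𝓡 G.dim) (1 : G) (f y) - c
  have hf' : DifferentiableAt ℝ f' x :=
    ((hf.contDiffAt_chart hx).sub contDiffAt_const).differentiableAt (by simp)
  have hf0 : f' x = 0 := by simp [f', hx, c]
  have h1 : (fun y => g * f y * g⁻¹) =ᶠ[𝓝 x] fun y => g * chartInv G (f' y) * g⁻¹ := by
    filter_upwards [chartInv_chart hf hx] with y hy
    simp only [f', c, hy]
  rw [Ad_eq_chartDeriv, chartDeriv_congr h1,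
    chartDeriv_comp (f := fun z => g * chartInv G z * g⁻¹) (k := f') ?_ ?_ hf', hf0]
  · simp only [f', fderiv_sub_const]
    rfl
  · rw [hf0]
    exact ((smAt_const g _).mul smAt_chartInv).mul (smAt_const _ _)
  · simp [hf0, chartInv_zero]

theorem Ad_add (g : G) (ξ ζ : LieAlg G) : Ad g (ξ + ζ) = Ad g ξ + Ad g ζ := by
  simp only [Ad_eq_chartDeriv, map_add]

theorem Ad_smul (g : G) (c : ℝ) (ξ : LieAlg G) : Ad g (c • ξ) = c • Ad g ξ := by
  simp only [Ad_eq_chartDeriv, map_smul]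

theorem Ad_neg (g : G) (ξ : LieAlg G) : Ad g (-ξ) = -Ad g ξ := by
  simp only [Ad_eq_chartDeriv, map_neg]

theorem Ad_zero (g : G) : Ad g (0 : LieAlg G) = 0 := by
  simp only [Ad_eq_chartDeriv, map_zero]

theorem Ad_mul (g h : G) (ξ : LieAlg G) : Ad (g * h) ξ = Ad g (Ad h ξ) := by
  rw [Ad_eq_chartDeriv h, ← chartDeriv_conj g
    (((smAt_const h _).mul smAt_chartInv).mul (smAt_const _ _)) (by simp [chartInv_zero]),
    Ad_eq_chartDeriv]
  simp only [mul_inv_rev, mul_assoc]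

theorem Ad_one (ξ : LieAlg G) : Ad (1 : G) ξ = ξ := by
  rw [Ad_eq_chartDeriv]
  simp only [one_mul, inv_one, mul_one, chartDeriv_chartInv]

omit [LieGroup (𝓡 G.dim) ∞ G] in
theorem mc_congr {f g : E → G} {x : E} (h : f =ᶠ[𝓝 x] g) : mc f x = mc g x :=
  chartDeriv_congr (h.mono fun y hy => by
    change (f x)⁻¹ * f y = (g x)⁻¹ * g y
    rw [hy, h.eq_of_nhds])

omit [LieGroup (𝓡 G.dim) ∞ G] in
theorem mc_const (g : G) (x : E) : mc (fun _ => g) x = 0 := chartDeriv_const _ _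

omit [LieGroup (𝓡 G.dim) ∞ G] in
/-- Left invariance of the logarithmic derivative. -/
theorem mc_const_mul (g : G) (f : E → G) (x : E) : mc (fun y => g * f y) x = mc f x := by
  simp [mc, mul_assoc]

theorem mc_mul {f g : E → G} {x : E} (hf : SmAt f x) (hg : SmAt g x) (v : E) :
    mc (fun y => f y * g y) x v = Ad (g x)⁻¹ (mc f x v) + mc g x v := by
  have h : (fun y => (f x * g x)⁻¹ * (f y * g y)) =
      fun y => ((g x)⁻¹ * ((f x)⁻¹ * f y) * (g x)⁻¹⁻¹) * ((g x)⁻¹ * g y) := by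
    ext1 y
    group
  rw [mc, h, chartDeriv_mul (((smAt_const _ _).mul hf.left_inv_mul).mul (smAt_const _ _))
    hg.left_inv_mul (by simp) (by simp), add_apply,
    chartDeriv_conj _ hf.left_inv_mul (by simp)]
  rfl

theorem mc_inv {f : E → G} {x : E} (hf : SmAt f x) (v : E) :
    mc (fun y => (f y)⁻¹) x v = -Ad (f x) (mc f x v) := by
  have h := mc_mul hf hf.inv v
  simp only [mul_inv_cancel, mc_const, inv_inv] at h
  exact (neg_eq_of_add_eq_zero_right h.symm).symm

theorem mc_comp {f : E → G} {k : F → E} {x : F} (hf : SmAt f (k x))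
    (hk : DifferentiableAt ℝ k x) (v : F) :
    mc (fun y => f (k y)) x v = mc f (k x) (fderiv ℝ k x v) :=
  chartDeriv_comp (f := fun z => (f (k x))⁻¹ * f z) hf.left_inv_mul (inv_mul_cancel _) hk v

/-- The logarithmic derivative of a family with two parameters splits into the contributions of
the parameters. -/
theorem mc_prod_split {f : E × F → G} {k : E → F} {x : E} (hf : SmAt f (x, k x))
    (hk : DifferentiableAt ℝ k x) (v : E) :
    mc (fun y => f (y, k y)) x v =
      mc (fun y => f (y, k x)) x v + mc (fun z => f (x, z)) (k x) (fderiv ℝ k x v) := by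
  have h1 : HasFDerivAt (fun y => (y, k y)) ((ContinuousLinearMap.id ℝ E).prod (fderiv ℝ k x)) x :=
    (hasFDerivAt_id x).prodMk hk.hasFDerivAt
  have h2 : HasFDerivAt (fun y => (y, k x)) ((ContinuousLinearMap.id ℝ E).prod 0) x :=
    (hasFDerivAt_id x).prodMk (hasFDerivAt_const (k x) x)
  have h3 : HasFDerivAt (fun z => (x, z))
      ((0 : F →L[ℝ] E).prod (ContinuousLinearMap.id ℝ F)) (k x) :=
    (hasFDerivAt_const x (k x)).prodMk (hasFDerivAt_id (k x))
  rw [mc_comp (k := fun y => (y, k y)) hf h1.differentiableAt,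
    mc_comp (k := fun y => (y, k x)) hf h2.differentiableAt,
    mc_comp (k := fun z => (x, z)) hf h3.differentiableAt, h1.fderiv, h2.fderiv, h3.fderiv,
    ← map_add]
  simp

theorem contDiff_Ad {κ : E → G} (hκ : ∀ x, SmAt κ x) {ξ : E → LieAlg G} (hξ : ContDiff ℝ ∞ ξ) :
    ContDiff ℝ ∞ fun y => Ad (κ y) (ξ y) := by
  simp only [Ad_eq_chartDeriv, chartDeriv]
  refine ContDiff.clm_apply (contDiff_iff_contDiffAt.2 fun x => ?_) hξ
  refine ContDiffAt.fderiv (n := ∞) (g := fun _ => 0) (f := fun y z =>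
    extChartAt (𝓡 G.dim) (1 : G) (κ y * chartInv G z * (κ y)⁻¹)) ?_ contDiffAt_const (by simp)
  have h1 : SmAt (fun z : E × LieAlg G => κ z.1) (x, 0) :=
    SmAt.comp (k := Prod.fst) (x := (x, (0 : LieAlg G))) (hκ x) contDiffAt_fst
  have h2 : SmAt (fun z : E × LieAlg G => chartInv G z.2) (x, 0) :=
    SmAt.comp (k := Prod.snd) (x := (x, (0 : LieAlg G))) smAt_chartInv contDiffAt_snd
  exact ((h1.mul h2).mul h1.inv).contDiffAt_chart (by simp [chartInv_zero])

theorem contDiff_mc {κ : E → G} (hκ : ∀ x, SmAt κ x) :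
    ContDiff ℝ ∞ fun z : E × E => mc κ z.1 z.2 := by
  simp only [mc, chartDeriv]
  refine ContDiff.clm_apply (f := fun z : E × E => fderiv ℝ (fun y =>
    extChartAt (𝓡 G.dim) (1 : G) ((κ z.1)⁻¹ * κ y)) z.1) ?_ contDiff_snd
  refine ContDiff.comp (g := fun x => fderiv ℝ (fun y =>
    extChartAt (𝓡 G.dim) (1 : G) ((κ x)⁻¹ * κ y)) x) ?_ contDiff_fst
  refine contDiff_iff_contDiffAt.2 fun x => ?_
  refine ContDiffAt.fderiv (n := ∞) (g := fun x => x) (f := fun x y =>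
    extChartAt (𝓡 G.dim) (1 : G) ((κ x)⁻¹ * κ y)) ?_ contDiffAt_id (by simp)
  have h1 : SmAt (fun z : E × E => κ z.1) (x, x) :=
    SmAt.comp (k := Prod.fst) (x := (x, x)) (hκ x) contDiffAt_fst
  have h2 : SmAt (fun z : E × E => κ z.2) (x, x) :=
    SmAt.comp (k := Prod.snd) (x := (x, x)) (hκ x) contDiffAt_snd
  exact (h1.inv.mul h2).contDiffAt_chart (by simp)

end LieCalculus

/-! ### The circle direction -/

section Angle

variable {n : ℕ}

theorem dAngle_eq_fderiv {θ : Eu n → S1} {f : Eu n → ℝ} {x : Eu n} (hf : ContinuousAt f x)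
    (h : θ =ᶠ[𝓝 x] fun y => ((f y : ℝ) : S1)) (v : Eu n) : dAngle θ x v = fderiv ℝ f x v := by
  have h1 : ∀ᶠ y in 𝓝 x, f y - f x ∈ Set.Ioo (-Real.pi) Real.pi := by
    have : ContinuousAt (fun y => f y - f x) x := hf.sub continuousAt_const
    refine this.eventually_mem (Ioo_mem_nhds ?_ ?_) <;> simp [Real.pi_pos]
  have h2 : (fun y => (θ y - θ x).toReal) =ᶠ[𝓝 x] fun y => f y - f x := by
    filter_upwards [h, h1] with y hy hy1
    rw [hy, h.eq_of_nhds, ← Real.Angle.coe_sub, Real.Angle.toReal_coe_eq_self_iff]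
    exact ⟨hy1.1, hy1.2.le⟩
  rw [dAngle, h2.fderiv_eq, fderiv_sub_const]

theorem dAngle_const (θ : S1) (x v : Eu n) : dAngle (fun _ => θ) x v = 0 := by
  simp [dAngle]

theorem dAngle_congr {θ θ' : Eu n → S1} {x : Eu n} (h : θ =ᶠ[𝓝 x] θ') (v : Eu n) :
    dAngle θ x v = dAngle θ' x v := by
  have : (fun y => (θ y - θ x).toReal) =ᶠ[𝓝 x] fun y => (θ' y - θ' x).toReal := by
    filter_upwards [h] with y hy
    rw [hy, h.eq_of_nhds]
  rw [dAngle, this.fderiv_eq, dAngle]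

theorem dAngle_comp {m : ℕ} {θ : Eu n → S1} (hθ : IsPlot θ) {k : Eu m → Eu n}
    (hk : ContDiff ℝ ∞ k) (x v : Eu m) :
    dAngle (fun y => θ (k y)) x v = dAngle θ (k x) (fderiv ℝ k x v) := by
  obtain ⟨f, hf, h⟩ := isPlot_circle_iff.1 hθ (k x)
  rw [dAngle_eq_fderiv hf.continuous.continuousAt h, dAngle_eq_fderiv (f := fun y => f (k y))
    (hf.comp hk).continuous.continuousAt (hk.continuous.continuousAt.eventually h)]
  have := fderiv_comp x (g := f) (f := k) (hf.differentiable (by simp)).differentiableAt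
    (hk.differentiable (by simp)).differentiableAt
  exact DFunLike.congr_fun this v

end Angle

section LoopDerivatives

variable {G : Man.{u}} [Group G] [LieGroup (𝓡 G.dim) ∞ G] {n : ℕ}

omit [Group G] [LieGroup (𝓡 G.dim) ∞ G] in
theorem smAt_of_isPlot {E : Type*} [NormedAddCommGroup E] [NormedSpace ℝ E]
    [FiniteDimensional ℝ E] {f : E → G}
    (hf : ∀ (N : ℕ) (p : Eu N → E), ContDiff ℝ ∞ p → IsPlot fun y => f (p y)) (x : E) :
    SmAt f x := by
  have h1 := isPlot_man_iff.1 (hf _ (toEuclidean (E := E)).symm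
    (toEuclidean (E := E)).symm.contDiff) (toEuclidean x)
  have h2 := SmAt.comp (x := x) h1 (toEuclidean (E := E)).contDiff.contDiffAt
  simpa using h2

omit [LieGroup (𝓡 G.dim) ∞ G] in
theorem smAt_loop (γ : LoopGroup G) (t : ℝ) : SmAt (fun s : ℝ => γ (s : S1)) t :=
  smAt_of_isPlot (f := fun s : ℝ => γ (s : S1)) (fun N p hp => γ.1.smooth N (fun y => (p y : S1))
    (dSmooth_angleCoe N p hp.isPlot)) t

theorem logDeriv_coe (γ : LoopGroup G) (t : ℝ) :
    logDeriv γ (t : S1) = mc (fun s : ℝ => γ (s : S1)) t 1 := by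
  have hs : SmAt (fun s : ℝ => γ ((t : S1) + (s : S1))) 0 := by
    have : SmAt (fun s : ℝ => γ ((t + s : ℝ) : S1)) 0 :=
      SmAt.comp (k := fun s => t + s) (smAt_loop γ _) (by fun_prop)
    simpa using this
  have h1 : logDeriv γ (t : S1) = mc (fun s : ℝ => γ ((t : S1) + (s : S1))) 0 1 := by
    have h2 : SmAt (fun s : ℝ => (γ (t : S1))⁻¹ * γ ((t : S1) + (s : S1))) 0 :=
      (smAt_const _ _).mul hs
    refine (mfderiv_eq_chartDeriv h2 (by simp) (1 : ℝ)).trans ?_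
    simp only [mc, Real.Angle.coe_zero, add_zero]
    rfl
  rw [h1]
  have h3 := mc_comp (f := fun s : ℝ => γ (s : S1)) (k := fun s : ℝ => t + s) (x := 0)
    (smAt_loop γ _) (by fun_prop) (1 : ℝ)
  simpa [fderiv_const_add] using h3

/-- The logarithmic derivative of a family of loops evaluated at a varying angle. -/
theorem mc_loop_apply {γ : Eu n → LoopGroup G} (hγ : IsPlot γ) {θ : Eu n → S1} (hθ : IsPlot θ)
    (x v : Eu n) : mc (fun y => γ y (θ y)) x v =
      mc (fun y => γ y (θ x)) x v + dAngle θ x v • logDeriv (γ x) (θ x) := by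
  obtain ⟨f, hf, h⟩ := isPlot_circle_iff.1 hθ x
  have hΓ : ∀ z, SmAt (fun z : Eu n × ℝ => γ z.1 (z.2 : S1)) z := smAt_of_isPlot fun N p hp =>
    IsPlot.loopGroup_eval (isPlot_reparam hγ (contDiff_fst.comp hp))
      (dSmooth_angleCoe N _ (contDiff_snd.comp hp).isPlot)
  have hfx := h.eq_of_nhds
  have h1 : (fun y => γ y (θ y)) =ᶠ[𝓝 x] fun y => γ y (f y : S1) :=
    h.mono fun y hy => congrArg (γ y) hy
  rw [mc_congr h1, mc_prod_split (f := fun z : Eu n × ℝ => γ z.1 (z.2 : S1)) (hΓ _)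
    (hf.differentiable (by simp)).differentiableAt, dAngle_eq_fderiv hf.continuous.continuousAt h,
    hfx, logDeriv_coe]
  congr 1
  conv_lhs => rw [← mul_one (fderiv ℝ f x v), ← smul_eq_mul, map_smul]

end LoopDerivatives

/-! ### Connections along products of plots -/

section Leibniz

variable {G : Man.{u}} [Group G] {B : Type u} {n : ℕ}

omit [Group G] in
theorem IsLoopOneForm.isOneForm_apply {X : Type*} [DiffeologicalSpace X]
    {A : ∀ {n : ℕ}, (Eu n → X) → Eu n → Eu n → S1 → LieAlg G} (hA : IsLoopOneForm A) (θ : S1) :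
    IsOneForm fun {_} p x v => A p x v θ where
  linear p hp x := ⟨fun v w => congrFun ((hA.linear p hp x).map_add v w) θ,
    fun c v => congrFun ((hA.linear p hp x).map_smul c v) θ⟩
  smooth {n} p hp := by
    have h := (hA.smooth p hp).comp (g := fun z : Eu n × Eu n × ℝ =>
        A p z.1 z.2.1 (z.2.2 : Real.Angle))
      (f := fun z : Eu n × Eu n => (z.1, z.2, θ.toReal))
      (contDiff_fst.prodMk (contDiff_snd.prodMk contDiff_const))
    simpa [Function.comp_def] using h
  pullback p f hp hf x v := congrFun (hA.pullback p f hp hf x v) θ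

/-- The Leibniz rule for a connection. -/
theorem IsConnection.act {P : BundleData G B}
    {A : ∀ {n : ℕ}, (Eu n → P.Total) → Eu n → Eu n → LieAlg G} (hA : IsConnection P A)
    (hP : DSmooth fun z : P.Total × G => P.act z.1 z.2) {p : Eu n → P.Total} (hp : IsPlot p)
    {κ : Eu n → G} (hκ : IsPlot κ) (x v : Eu n) :
    A (fun y => P.act (p y) (κ y)) x v = Ad (κ x)⁻¹ (A p x v) + maurerCartan κ x v := by
  have hs : DSmooth fun z : Eu n × Eu n => P.act (p z.1) (κ z.2) := fun m q hq =>
    hP m (fun y => (p (q y).1, κ (q y).2)) ⟨isPlot_reparam hp hq.1.contDiff,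
      isPlot_reparam hκ hq.2.contDiff⟩
  have h := hA.form.prod_split hs (f := fun y => y) contDiff_id x v
  rw [fderiv_fun_id, ContinuousLinearMap.id_apply] at h
  refine h.trans ?_
  simp only
  rw [hA.equivariant p hp, hA.vertical (p x) κ hκ]

theorem IsLoopConnection.act [LieGroup (𝓡 G.dim) ∞ G] {P : BundleData (LoopGroup G) B}
    {A : ∀ {n : ℕ}, (Eu n → P.Total) → Eu n → Eu n → S1 → LieAlg G} (hA : IsLoopConnection P A)
    (hP : DSmooth fun z : P.Total × LoopGroup G => P.act z.1 z.2) {p : Eu n → P.Total}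
    (hp : IsPlot p) {κ : Eu n → LoopGroup G} (hκ : IsPlot κ) (x v : Eu n) (θ : S1) :
    A (fun y => P.act (p y) (κ y)) x v θ =
      Ad (κ x θ)⁻¹ (A p x v θ) + maurerCartan (fun y => κ y θ) x v := by
  have hs : DSmooth fun z : Eu n × Eu n => P.act (p z.1) (κ z.2) := fun m q hq =>
    hP m (fun y => (p (q y).1, κ (q y).2)) ⟨isPlot_reparam hp hq.1.contDiff,
      isPlot_reparam hκ hq.2.contDiff⟩
  have h := (hA.form.isOneForm_apply θ).prod_split hs (f := fun y => y) contDiff_id x v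
  rw [fderiv_fun_id, ContinuousLinearMap.id_apply] at h
  refine h.trans ?_
  simp only
  rw [hA.equivariant p hp, hA.vertical (p x) κ hκ]

end Leibniz

/-! ### The connection on the transform of an `ΩG`-bundle -/

section CaloronForm

variable {G : Man.{u}} [Group G] [LieGroup (𝓡 G.dim) ∞ G] (P : LoopBundleC G) {n m : ℕ}

theorem caloronForm_eq {q : Eu n → P.bundle.Total × G × S1} (hq : IsPlot q) (x v : Eu n) :
    caloronForm P q x v = Ad (q x).2.1⁻¹ (P.conn (fun y => (q y).1) x v (q x).2.2)
      + mc (fun y => (q y).2.1) x v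
      + dAngle (fun y => (q y).2.2) x v • Ad (q x).2.1⁻¹ (P.higgs (q x).1 (q x).2.2) := by
  rw [caloronForm, maurerCartan_eq_mc hq.2.1]

theorem caloronForm_congr {q q' : Eu n → P.bundle.Total × G × S1} (hq : IsPlot q)
    (hq' : IsPlot q') {x : Eu n} (h : q =ᶠ[𝓝 x] q') (v : Eu n) :
    caloronForm P q x v = caloronForm P q' x v := by
  rw [caloronForm_eq P hq, caloronForm_eq P hq', h.eq_of_nhds,
    mc_congr (f := fun y => (q y).2.1) (h.fun_comp fun z => z.2.1),
    dAngle_congr (θ := fun y => (q y).2.2) (h.fun_comp fun z => z.2.2),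
    (P.isConn.form.isOneForm_apply _).congr_of_eventuallyEq hq.1 hq'.1 (h.fun_comp fun z => z.1)]
  rfl

/-- The form on `P × G × S¹` is basic for the action of `ΩG`: the derivative of `γ(θ)` in the
direction of `θ`, which enters through the Maurer–Cartan term, cancels the inhomogeneous term in
the transformation law of the Higgs field. -/
theorem caloronForm_act {q : Eu n → P.bundle.Total × G × S1} (hq : IsPlot q)
    {γ : Eu n → LoopGroup G} (hγ : IsPlot γ) (x v : Eu n) :
    caloronForm P (fun y => (P.bundle.act (q y).1 (γ y), (γ y (q y).2.2)⁻¹ * (q y).2.1,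
      (q y).2.2)) x v = caloronForm P q x v := by
  have hγθ : IsPlot fun y => γ y (q y).2.2 := IsPlot.loopGroup_eval hγ hq.2.2
  have hγθ' : IsPlot fun y => γ y (q x).2.2 := IsPlot.loopGroup_eval hγ isPlot_const
  have hi := SmoothGroup.isPlot_inv hγθ
  rw [caloronForm_eq P hq, caloronForm_eq P (n := n)
    (isPlot_prodMk (P.principal.isPlot_act hq.1 hγ)
      (isPlot_prodMk (SmoothGroup.isPlot_mul hi hq.2.1) hq.2.2))]
  simp only
  rw [P.isConn.act P.principal.smooth_act hq.1 hγ, maurerCartan_eq_mc hγθ',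
    mc_mul (isPlot_man_iff.1 hi x) (isPlot_man_iff.1 hq.2.1 x),
    mc_inv (isPlot_man_iff.1 hγθ x), mc_loop_apply hγ hq.2.2, P.isHiggs.equivariant]
  simp only [mul_inv_rev, inv_inv, Ad_mul, Ad_add, Ad_neg, Ad_smul, smul_add]
  have h : ∀ ξ, Ad (γ x (q x).2.2) (Ad (γ x (q x).2.2)⁻¹ ξ) = ξ := fun ξ => by
    rw [← Ad_mul, mul_inv_cancel, Ad_one]
  simp only [h]
  abel

theorem caloronForm_comp {q : Eu n → P.bundle.Total × G × S1} (hq : IsPlot q)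
    {k : Eu m → Eu n} (hk : ContDiff ℝ ∞ k) (x v : Eu m) :
    caloronForm P (fun y => q (k y)) x v = caloronForm P q (k x) (fderiv ℝ k x v) := by
  rw [caloronForm_eq P hq, caloronForm_eq P (q := fun y => q (k y)) (isPlot_reparam hq hk)]
  rw [mc_comp (f := fun y => (q y).2.1) (isPlot_man_iff.1 hq.2.1 _)
    (hk.differentiable (by simp)).differentiableAt, dAngle_comp hq.2.2 hk]
  congr 3
  exact congrFun (P.isConn.form.pullback _ k hq.1 hk x v) _

theorem caloronForm_linear {q : Eu n → P.bundle.Total × G × S1} (hq : IsPlot q) (x : Eu n) :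
    IsLinearMap ℝ (caloronForm P q x) := by
  have h := (P.isConn.form.isOneForm_apply (q x).2.2).linear _ hq.1 x
  have hd : IsLinearMap ℝ (dAngle (fun y => (q y).2.2) x) := ⟨fun v w => map_add _ _ _,
    fun c v => map_smul _ _ _⟩
  constructor
  · intro v w
    simp only [caloronForm_eq P hq]
    rw [h.map_add, hd.map_add, map_add, Ad_add, add_smul]
    abel
  · intro c v
    simp only [caloronForm_eq P hq]
    rw [h.map_smul, hd.map_smul, map_smul, Ad_smul, smul_add, smul_add, smul_assoc]

theorem caloronForm_contDiffAt {q : Eu n → P.bundle.Total × G × S1} (hq : IsPlot q)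
    (z : Eu n × Eu n) :
    ContDiffAt ℝ ∞ (fun z : Eu n × Eu n => caloronForm P q z.1 z.2) z := by
  obtain ⟨f, hf, h⟩ := isPlot_circle_iff.1 hq.2.2 z.1
  have hg : ∀ w : Eu n × Eu n, SmAt (fun w : Eu n × Eu n => (q w.1).2.1⁻¹) w := fun w =>
    (SmAt.comp (k := Prod.fst) (x := w) (isPlot_man_iff.1 hq.2.1 w.1) contDiffAt_fst).inv
  have h1 : ContDiff ℝ ∞ fun w : Eu n × Eu n => Ad (q w.1).2.1⁻¹
      (P.conn (fun y => (q y).1) w.1 w.2 (f w.1 : S1)) :=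
    contDiff_Ad hg ((P.isConn.form.smooth _ hq.1).comp
      (contDiff_fst.prodMk (contDiff_snd.prodMk (hf.comp contDiff_fst))))
  have h2 : ContDiff ℝ ∞ fun w : Eu n × Eu n => Ad (q w.1).2.1⁻¹ (P.higgs (q w.1).1 (f w.1 : S1)) :=
    contDiff_Ad hg ((P.isHiggs.smooth _ hq.1).comp (contDiff_fst.prodMk (hf.comp contDiff_fst)))
  have h3 : ContDiff ℝ ∞ fun w : Eu n × Eu n => mc (fun y => (q y).2.1) w.1 w.2 :=
    contDiff_mc (isPlot_man_iff.1 hq.2.1)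
  have h4 : ContDiff ℝ ∞ fun w : Eu n × Eu n => fderiv ℝ f w.1 w.2 :=
    ContDiff.clm_apply ((hf.fderiv_right (by simp)).comp contDiff_fst) contDiff_snd
  have h5 : ContDiff ℝ ∞ fun w : Eu n × Eu n => Ad (q w.1).2.1⁻¹
      (P.conn (fun y => (q y).1) w.1 w.2 (f w.1 : S1)) + mc (fun y => (q y).2.1) w.1 w.2 +
        fderiv ℝ f w.1 w.2 • Ad (q w.1).2.1⁻¹ (P.higgs (q w.1).1 (f w.1 : S1)) :=
    (h1.add h3).add (h4.smul h2)
  refine h5.contDiffAt.congr_of_eventuallyEq ?_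
  filter_upwards [continuousAt_fst.eventually h.eventually_nhds] with w hw
  have hw' : (q w.1).2.2 = (f w.1 : S1) := hw.self_of_nhds
  rw [caloronForm_eq P hq, dAngle_eq_fderiv hf.continuous.continuousAt hw, hw']

/-- The form on `P × G × S¹` descends to the quotient. -/
theorem caloronForm_eq_of_mk_eq {q q' : Eu n → P.bundle.Total × G × S1} (hq : IsPlot q)
    (hq' : IsPlot q') {x : Eu n}
    (h : ∀ᶠ y in 𝓝 x, mk P.toLoopBundle (q y).1 (q y).2.1 (q y).2.2 =
      mk P.toLoopBundle (q' y).1 (q' y).2.1 (q' y).2.2) (v : Eu n) :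
    caloronForm P q x v = caloronForm P q' x v := by
  obtain ⟨r, hr, hr', hrx⟩ := exists_retract_of_eventually h
  have h1 : ∀ {q : Eu n → P.bundle.Total × G × S1}, q =ᶠ[𝓝 x] fun y => q (r y) :=
    hrx.mono fun y hy => by simp only [hy]
  have hqr : IsPlot fun y => q (r y) := isPlot_reparam hq hr
  have hqr' : IsPlot fun y => q' (r y) := isPlot_reparam hq' hr
  rw [caloronForm_congr P hq hqr h1, caloronForm_congr P hq' hqr' h1]
  -- two lifts differ by a family of loops, which is smooth since `P` is principal
  choose γ hγ hγ' hγθ using fun y => (mk_eq_mk_iff _).1 (hr' y)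
  have hγp : IsPlot γ := by
    have : γ = fun y => P.bundle.div (q (r y)).1 (q' (r y)).1 :=
      funext fun y => P.principal.eq_div (hγ y).symm
    rw [this]
    exact P.principal.isPlot_div hqr.1 hqr'.1 fun y => by rw [hγ y, P.principal.proj_act]
  refine (caloronForm_act P hqr hγp x v).symm.trans ?_
  exact congrArg (fun s => caloronForm P s x v)
    (funext fun y => Prod.ext (hγ y).symm (Prod.ext (hγ' y).symm (hγθ y).symm))

/-- The connection on the quotient may be computed from any local lift of the plot. -/
theorem caloronConn_eq {p : Eu n → (caloronData P.toLoopBundle).Total}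
    {q : Eu n → P.bundle.Total × G × S1} (hq : IsPlot q) {x : Eu n}
    (h : p =ᶠ[𝓝 x] fun y => mk P.toLoopBundle (q y).1 (q y).2.1 (q y).2.2) (v : Eu n) :
    caloronConn P p x v = caloronForm P q x v := by
  have hex : ∃ q : Eu n → P.bundle.Total × G × S1, IsPlot q ∧
      p =ᶠ[𝓝 x] fun y => Quotient.mk (orbitRel P.toLoopBundle) (q y) := ⟨q, hq, h⟩
  rw [caloronConn, dif_pos hex]
  exact caloronForm_eq_of_mk_eq P hex.choose_spec.1 hq (hex.choose_spec.2.symm.trans h) v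

/-- The transform of a connection and a Higgs field is a framed connection. -/
theorem caloronConn_isFramedConnection :
    IsFramedConnection (caloronData P.toLoopBundle) (caloronFrame P.toLoopBundle)
      (caloronConn P) where
  connection :=
    { form :=
      { linear := fun p hp x => by
          obtain ⟨q, hq, h⟩ := (isPlot_caloronData_iff _).1 hp x
          have h1 : caloronConn P p x = caloronForm P q x := funext (caloronConn_eq P hq h)
          rw [h1]
          exact caloronForm_linear P hq x
        smooth := fun p hp => contDiff_iff_contDiffAt.2 fun z => by
          obtain ⟨q, hq, h⟩ := (isPlot_caloronData_iff _).1 hp z.1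
          refine (caloronForm_contDiffAt P hq z).congr_of_eventuallyEq ?_
          filter_upwards [continuousAt_fst.eventually h.eventually_nhds] with w hw
          exact caloronConn_eq P hq hw _
        pullback := fun p f hp hf x v => by
          obtain ⟨q, hq, h⟩ := (isPlot_caloronData_iff _).1 hp (f x)
          rw [caloronConn_eq P hq h, caloronConn_eq P (p := p ∘ f) (q := fun y => q (f y))
            (isPlot_reparam hq hf) (hf.continuous.continuousAt.eventually h),
            caloronForm_comp P hq hf] }
      equivariant := fun p hp g x v => by
        obtain ⟨q, hq, h⟩ := (isPlot_caloronData_iff _).1 hp x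
        have hq' : IsPlot fun y => ((q y).1, (q y).2.1 * g, (q y).2.2) :=
          isPlot_prodMk hq.1 (isPlot_prodMk (SmoothGroup.isPlot_mul hq.2.1 isPlot_const) hq.2.2)
        rw [caloronConn_eq P hq h, caloronConn_eq P hq'
          (h.mono fun y hy => congrArg (fun z => (caloronData P.toLoopBundle).act z g) hy),
          caloronForm_eq P hq, caloronForm_eq P hq']
        simp only
        rw [mc_mul (isPlot_man_iff.1 hq.2.1 x) (smAt_const g x), mc_const]
        simp only [mul_inv_rev, Ad_mul, Ad_add, Ad_smul]
        simp
      vertical := fun z {n} κ hκ x v => by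
        obtain ⟨p, g, θ, rfl⟩ := exists_rep _ z
        have hq : IsPlot fun y => (p, g * κ y, θ) :=
          isPlot_prodMk isPlot_const
            (isPlot_prodMk (SmoothGroup.isPlot_mul isPlot_const hκ) isPlot_const)
        refine (caloronConn_eq P hq .rfl v).trans ?_
        rw [caloronForm_eq P hq]
        simp only
        rw [dAngle_const, zero_smul, add_zero, mc_const_mul,
          (P.isConn.form.isOneForm_apply θ).const, Ad_zero, zero_add, maurerCartan_eq_mc hκ] }
  framed c hc x v := by
    obtain ⟨U, hU, hm, s, hs, hsU⟩ := P.principal.exists_section (c x)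
    obtain ⟨q, hq, hqs⟩ := hs _ c hc x hm
    have hq' : IsPlot fun y => (q y, (1 : G), (0 : S1)) :=
      isPlot_prodMk hq (isPlot_prodMk isPlot_const isPlot_const)
    rw [caloronConn_eq P hq', caloronForm_eq P hq']
    · simp only
      rw [mc_const, dAngle_const, P.isConn.form.based q hq, Ad_zero]
      simp
    · filter_upwards [hqs, (PlotAt.of_isPlot hc x).eventually_mem hU hm] with y hy hyU
      have := caloronFrame_proj P.toLoopBundle (s (c y))
      rw [hsU _ hyU] at this
      rw [Function.comp, this, hy]

end CaloronForm

/-! ### The connection and the Higgs field on the transform of a framed bundle -/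

section InverseTransform

variable {G : Man.{u}} [Group G] [LieGroup (𝓡 G.dim) ∞ G] (Q : FramedBundleC G) {n : ℕ}

omit [LieGroup (𝓡 G.dim) ∞ G] [Group G] in
theorem isPlot_angle {f : Eu n → ℝ} (hf : ContDiff ℝ ∞ f) : IsPlot fun y => ((f y : ℝ) : S1) :=
  dSmooth_angleCoe n f hf.isPlot

omit [LieGroup (𝓡 G.dim) ∞ G] in
theorem dSmooth_loop {p : Eu n → LoopTotal Q.toFramedBundle} (hp : IsPlot p) :
    DSmooth fun z : Eu n × Eu 1 => (p z.1).loop ((z.2 0 : ℝ) : S1) := fun _ q hq =>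
  IsPlot.loop (p := fun y => p (q y).1) (isPlot_reparam hp hq.1.contDiff)
    (isPlot_angle (contDiff_eu_apply.comp hq.2.contDiff))

omit [LieGroup (𝓡 G.dim) ∞ G] in
/-- The Higgs field is the connection applied to the derivative of the loop in its parameter. -/
theorem invCaloronHiggs_coe (a : LoopTotal Q.toFramedBundle) (t : ℝ) :
    invCaloronHiggs Q a (t : S1) =
      Q.conn (n := 1) (fun w => a.loop ((w 0 : ℝ) : S1)) (euLine t)
        (EuclideanSpace.single 0 1) := by
  have hp : IsPlot fun w : Eu 1 => a.loop ((w 0 : ℝ) : S1) :=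
    IsPlot.loop (p := fun _ => a) isPlot_const (isPlot_angle contDiff_eu_apply)
  have h := Q.isConn.connection.form.pullback _ (fun w : Eu 1 => euLine t + w) hp
    (contDiff_const.add contDiff_id) 0 (EuclideanSpace.single 0 1)
  rw [fderiv_const_add, fderiv_fun_id, ContinuousLinearMap.id_apply, add_zero] at h
  refine Eq.trans ?_ h
  refine congrArg (fun r : Eu 1 → Q.bundle.Total => Q.conn r 0 (EuclideanSpace.single 0 1))
    (funext fun w => congrArg a.loop ?_)
  simp

omit [LieGroup (𝓡 G.dim) ∞ G] in
/-- A connection evaluated along a family of loops at a varying angle. -/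
theorem conn_loop_apply {p : Eu n → LoopTotal Q.toFramedBundle} (hp : IsPlot p)
    {θ : Eu n → S1} (hθ : IsPlot θ) (x v : Eu n) :
    Q.conn (fun y => (p y).loop (θ y)) x v =
      invCaloronConn Q p x v (θ x) + dAngle θ x v • invCaloronHiggs Q (p x) (θ x) := by
  obtain ⟨f, hf, h⟩ := isPlot_circle_iff.1 hθ x
  have hform := Q.isConn.connection.form
  have hfx : θ x = (f x : S1) := h.eq_of_nhds
  have h1 := hform.congr_of_eventuallyEq (IsPlot.loop hp hθ) (IsPlot.loop hp (isPlot_angle hf))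
    (h.mono fun y hy => congrArg (p y).loop hy) v
  have h2 := hform.prod_split (dSmooth_loop Q hp) (f := fun y => euLine (f y))
    (euLine.contDiff.comp hf) x v
  have h3 : fderiv ℝ (fun y => euLine (f y)) x v = fderiv ℝ f x v • EuclideanSpace.single 0 1 := by
    have := fderiv_comp x (g := euLine) (f := f) euLine.differentiableAt
      (hf.differentiable (by simp)).differentiableAt
    rw [ContinuousLinearMap.fderiv] at this
    exact DFunLike.congr_fun this v
  have h4 : IsPlot fun w : Eu 1 => (p x).loop ((w 0 : ℝ) : S1) :=
    IsPlot.loop (p := fun _ => p x) isPlot_const (isPlot_angle contDiff_eu_apply)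
  simp only [euLine_apply] at h2
  rw [h1, h2, h3, (hform.linear _ h4 _).map_smul, dAngle_eq_fderiv hf.continuous.continuousAt h,
    hfx, invCaloronHiggs_coe]
  rfl

omit [LieGroup (𝓡 G.dim) ∞ G] in
theorem invCaloronConn_isLoopConnection :
    IsLoopConnection (invCaloronData Q.toFramedBundle) (invCaloronConn Q) where
  form :=
    { based := fun p hp x v => by
        have h : (fun y => LoopTotal.loop (p y) 0) = Q.frame ∘ fun y => (p y).1.1 :=
          funext fun y => LoopTotal.loop_zero (p y)
        rw [invCaloronConn, h]
        exact Q.isConn.framed _ hp.1 x v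
      linear := fun p hp x =>
        have h : ∀ θ, IsLinearMap ℝ (fun v => invCaloronConn Q p x v θ) := fun θ =>
          Q.isConn.connection.form.linear _ (IsPlot.loop hp isPlot_const) x
        ⟨fun v w => funext fun θ => (h θ).map_add v w, fun c v => funext fun θ =>
          (h θ).map_smul c v⟩
      smooth := fun p hp => by
        have h := Q.isConn.connection.form.contDiff_left (dSmooth_loop Q hp)
        have h1 := h.comp (contDiff_fst.prodMk ((contDiff_fst.comp contDiff_snd).prodMk
          (euLine.contDiff.comp (contDiff_snd.comp contDiff_snd))))
        simp only [Function.comp_def, euLine_apply] at h1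
        exact h1
      pullback := fun p f hp hf x v => funext fun θ =>
        Q.isConn.connection.form.pullback _ f (IsPlot.loop hp isPlot_const) hf x v }
  equivariant p hp γ x v θ :=
    Q.isConn.connection.equivariant _ (IsPlot.loop hp isPlot_const) (γ θ) x v
  vertical a n κ hκ x v θ :=
    Q.isConn.connection.vertical (a.loop θ) _ (IsPlot.loopGroup_eval hκ isPlot_const) x v

theorem invCaloronHiggs_isHiggs :
    IsHiggs (invCaloronData Q.toFramedBundle) (invCaloronHiggs Q) where
  smooth p hp := by
    have h := Q.isConn.connection.form.contDiff_right (dSmooth_loop Q hp)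
    have h1 := h.comp (contDiff_fst.prodMk ((euLine.contDiff.comp contDiff_snd).prodMk
      (contDiff_const (c := EuclideanSpace.single (0 : Fin 1) (1 : ℝ)))))
    convert h1 using 1
    exact funext fun z => invCaloronHiggs_coe Q _ _
  equivariant a γ θ := by
    obtain ⟨t, rfl⟩ : ∃ t : ℝ, θ = (t : S1) := ⟨θ.toReal, (Real.Angle.coe_toReal θ).symm⟩
    have hκ : IsPlot fun w : Eu 1 => γ ((w 0 : ℝ) : S1) :=
      γ.1.smooth _ _ (isPlot_angle contDiff_eu_apply)
    have h := Q.isConn.connection.act Q.principal.smooth_act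
      (IsPlot.loop (p := fun _ => a) isPlot_const (isPlot_angle contDiff_eu_apply)) hκ
      (euLine t) (EuclideanSpace.single 0 1)
    refine (invCaloronHiggs_coe Q _ t).trans (h.trans ?_)
    rw [maurerCartan_eq_mc hκ, logDeriv_coe, euLine_apply]
    refine congrArg₂ (· + ·) (congrArg _ (invCaloronHiggs_coe Q a t).symm) ?_
    have h2 := mc_comp (f := fun s : ℝ => γ (s : S1)) (k := fun w : Eu 1 => w 0) (x := euLine t)
      (smAt_loop γ _) (contDiff_eu_apply.differentiable (by simp)).differentiableAt
      (EuclideanSpace.single 0 1)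
    rw [fderiv_eu_apply, euLine_apply] at h2
    refine h2.trans ?_
    simp

end InverseTransform

/-! ### The transforms of bundle maps with connection -/

section Functoriality

variable {G : Man.{u}} [Group G] [LieGroup (𝓡 G.dim) ∞ G]

theorem caloronForm_map {P P' : LoopBundleC G} (f : P ⟶ P') {n : ℕ}
    {q : Eu n → P.bundle.Total × G × S1} (hq : IsPlot q) (x v : Eu n) :
    caloronForm P' (fun y => (f.1.toFun (q y).1, (q y).2)) x v = caloronForm P q x v := by
  have h : P'.conn (fun y => f.1.toFun (q y).1) x v = P.conn (fun y => (q y).1) x v :=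
    f.2.conn _ hq.1 x v
  simp only [caloronForm]
  rw [h, f.2.higgs]

theorem caloronConn_map {P P' : LoopBundleC G} (f : P ⟶ P')
    (hC : ∀ P : LoopBundle G, (caloronData P).IsPrincipal ∧
      IsFraming (caloronData P) (caloronFrame P)) {n : ℕ}
    {p : Eu n → (caloronData P.toLoopBundle).Total} (hp : IsPlot p) (x v : Eu n) :
    caloronConn P' ((caloronMap hC f.1).toFun ∘ p) x v = caloronConn P p x v := by
  obtain ⟨q, hq, h⟩ := (isPlot_caloronData_iff _).1 hp x
  rw [caloronConn_eq P hq h, ← caloronForm_map f hq]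
  exact caloronConn_eq P' (q := fun y => (f.1.toFun (q y).1, (q y).2))
    (isPlot_prodMk (f.1.smooth _ _ hq.1) hq.2)
    (h.mono fun y hy => congrArg (caloronMap hC f.1).toFun hy) v

theorem LoopBundleC.isIso_of_isIso {P Q : LoopBundleC G} (f : P ⟶ Q) [IsIso f.1] : IsIso f := by
  have h : ∀ q, f.1.toFun ((inv f.1).toFun q) = q := fun q =>
    congrFun (congrArg LoopBundle.Hom.toFun (IsIso.inv_hom_id f.1)) q
  refine ⟨⟨inv f.1, ⟨fun p hp x v => ?_, fun q => ?_⟩⟩, Subtype.ext (IsIso.hom_inv_id f.1),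
    Subtype.ext (IsIso.inv_hom_id f.1)⟩
  · rw [← f.2.conn _ ((inv f.1).smooth _ _ hp)]
    exact congrArg (fun r => Q.conn r x v) (funext fun y => h (p y))
  · rw [← f.2.higgs, h]

omit [LieGroup (𝓡 G.dim) ∞ G] in
theorem FramedBundleC.isIso_of_isIso {P Q : FramedBundleC G} (f : P ⟶ Q) [IsIso f.1] :
    IsIso f := by
  have h : ∀ q, f.1.toFun ((inv f.1).toFun q) = q := fun q =>
    congrFun (congrArg FramedBundle.Hom.toFun (IsIso.inv_hom_id f.1)) q
  refine ⟨⟨inv f.1, fun p hp x v => ?_⟩, Subtype.ext (IsIso.hom_inv_id f.1),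
    Subtype.ext (IsIso.inv_hom_id f.1)⟩
  rw [← f.2 _ ((inv f.1).smooth _ _ hp)]
  exact congrArg (fun r => Q.conn r x v) (funext fun y => h (p y))

end Functoriality

/-! ### The equivalence of the categories of bundles with connection -/

section EquivalenceC

variable {G : Man.{u}} [Group G] [LieGroup (𝓡 G.dim) ∞ G]
  (hC : ∀ P : LoopBundle G, (caloronData P).IsPrincipal ∧
    IsFraming (caloronData P) (caloronFrame P))
  (hF : ∀ Q : FramedBundle G, (invCaloronData Q).IsPrincipal)

/-- The caloron transform with connections. -/
noncomputable abbrev caloronWithConn : LoopBundleC G ⥤ FramedBundleC G :=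
  caloronC hC caloronConn_isFramedConnection fun _ _ f _ _ hp x v => caloronConn_map f hC hp x v

theorem invCaloronMap_preserves {Q R : FramedBundleC G} (f : Q ⟶ R) :
    LoopBundleC.Preserves
      ⟨(invCaloron hF).obj Q.toFramedBundle, invCaloronConn Q, invCaloronConn_isLoopConnection Q,
        invCaloronHiggs Q, invCaloronHiggs_isHiggs Q⟩
      ⟨(invCaloron hF).obj R.toFramedBundle, invCaloronConn R, invCaloronConn_isLoopConnection R,
        invCaloronHiggs R, invCaloronHiggs_isHiggs R⟩ ((invCaloron hF).map f.1) where
  conn _ hp x v := funext fun _ => f.2 _ (IsPlot.loop hp isPlot_const) x v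
  higgs a := funext fun _ => f.2 _ (IsPlot.loop (p := fun _ => a) isPlot_const
    (isPlot_circle_add isPlot_const (isPlot_angle contDiff_eu_apply))) _ _

/-- The inverse caloron transform with connections and Higgs fields. -/
noncomputable abbrev invCaloronWithConn : FramedBundleC G ⥤ LoopBundleC G :=
  invCaloronC hF invCaloronConn_isLoopConnection invCaloronHiggs_isHiggs
    fun _ _ f => invCaloronMap_preserves hF f

theorem toInvCaloronCaloron_preserves (P : LoopBundleC G) :
    LoopBundleC.Preserves P ((caloronWithConn hC ⋙ invCaloronWithConn hF).obj P)
      (toInvCaloronCaloron hC hF P.toLoopBundle) where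
  conn p hp x v := funext fun θ => by
    have hq : IsPlot fun y => (p y, (1 : G), θ) :=
      isPlot_prodMk hp (isPlot_prodMk isPlot_const isPlot_const)
    refine (caloronConn_eq P hq .rfl v).trans ?_
    rw [caloronForm_eq P hq]
    simp only
    rw [mc_const, dAngle_const, inv_one, Ad_one]
    simp
  higgs p := funext fun θ => by
    have hθ : IsPlot fun w : Eu 1 => θ + ((w 0 : ℝ) : S1) :=
      isPlot_circle_add isPlot_const (isPlot_angle contDiff_eu_apply)
    have hq : IsPlot fun w : Eu 1 => (p, (1 : G), θ + ((w 0 : ℝ) : S1)) :=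
      isPlot_prodMk isPlot_const (isPlot_prodMk isPlot_const hθ)
    refine (caloronConn_eq P hq .rfl _).trans ?_
    have hd : dAngle (fun w : Eu 1 => θ + ((w 0 : ℝ) : S1)) 0 (EuclideanSpace.single 0 1) = 1 := by
      rw [dAngle_eq_fderiv (f := fun w : Eu 1 => θ.toReal + w 0)
        (contDiff_const.add contDiff_eu_apply).continuous.continuousAt
        (.of_forall fun w => by simp), fderiv_const_add, fderiv_eu_apply]
      simp
    rw [caloronForm_eq P hq]
    simp only
    rw [mc_const, hd, inv_one, Ad_one, Ad_one, (P.isConn.form.isOneForm_apply _).const]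
    simp

/-- `β` preserves connections: the form at `f(θ)g` is computed by the Leibniz rule and by the
splitting of the form along the family of loops `f`. -/
theorem ofCaloronInvCaloron_preserves (Q : FramedBundleC G) :
    FramedBundleC.Preserves ((invCaloronWithConn hF ⋙ caloronWithConn hC).obj Q) Q
      (ofCaloronInvCaloron hC hF Q.toFramedBundle) := by
  intro n p hp x v
  let P := (invCaloronWithConn hF).obj Q
  have hp' : IsPlot (X := (caloronData P.toLoopBundle).Total) p := hp
  obtain ⟨q, hq, h⟩ := (isPlot_caloronData_iff P.toLoopBundle).1 hp' x
  have hl : IsPlot fun y => LoopTotal.loop (q y).1 (q y).2.2 := IsPlot.loop hq.1 hq.2.2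
  have h1 : Q.conn ((ofCaloronInvCaloron hC hF Q.toFramedBundle).toFun ∘ p) x v =
      Q.conn (fun y => Q.bundle.act (LoopTotal.loop (q y).1 (q y).2.2) (q y).2.1) x v :=
    Q.isConn.connection.form.congr_of_eventuallyEq
      ((ofCaloronInvCaloron hC hF Q.toFramedBundle).smooth _ _ hp)
      (Q.principal.isPlot_act hl hq.2.1)
      (h.mono fun y hy => congrArg (ofCaloronInvCaloron hC hF Q.toFramedBundle).toFun hy) v
  refine h1.trans (Eq.trans ?_ (caloronConn_eq P hq h v).symm)
  rw [Q.isConn.connection.act Q.principal.smooth_act hl hq.2.1, conn_loop_apply Q hq.1 hq.2.2,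
    Ad_add, Ad_smul, caloronForm]
  exact add_right_comm _ _ _

/-- The natural isomorphism `α` of bundles with connection and Higgs field. -/
noncomputable def caloronUnitIsoC :
    caloronWithConn hC ⋙ invCaloronWithConn hF ≅ 𝟭 (LoopBundleC G) :=
  (NatIso.ofComponents (F := 𝟭 (LoopBundleC G)) (fun P =>
    @asIso _ _ _ _ (⟨toInvCaloronCaloron hC hF P.toLoopBundle,
        toInvCaloronCaloron_preserves hC hF P⟩ :
      P ⟶ (caloronWithConn hC ⋙ invCaloronWithConn hF).obj P)
      (@LoopBundleC.isIso_of_isIso _ _ _ _ _ _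
        (isIso_toInvCaloronCaloron hC hF P.toLoopBundle)))
    fun f => Subtype.ext ((caloronUnitIso hC hF).inv.naturality f.1)).symm

theorem forget_map_caloronUnitIsoC_hom (P : LoopBundleC G) :
    (LoopBundleC.forget G).map ((caloronUnitIsoC hC hF).hom.app P) =
      (caloronUnitIso hC hF).hom.app P.toLoopBundle := by
  have h1 : (LoopBundleC.forget G).map ((caloronUnitIsoC hC hF).inv.app P) ≫
      (LoopBundleC.forget G).map ((caloronUnitIsoC hC hF).hom.app P) = 𝟙 _ := by
    rw [← Functor.map_comp, Iso.inv_hom_id_app]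
    rfl
  have h2 := (caloronUnitIso hC hF).inv_hom_id_app P.toLoopBundle
  exact (cancel_epi ((caloronUnitIso hC hF).inv.app P.toLoopBundle)).1 (h1.trans h2.symm)

/-- The natural isomorphism `β` of bundles with connection. -/
noncomputable def caloronCounitIsoC :
    invCaloronWithConn hF ⋙ caloronWithConn hC ≅ 𝟭 (FramedBundleC G) :=
  NatIso.ofComponents (G := 𝟭 (FramedBundleC G)) (fun Q =>
    @asIso _ _ _ _ (⟨ofCaloronInvCaloron hC hF Q.toFramedBundle,
        ofCaloronInvCaloron_preserves hC hF Q⟩ :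
      (invCaloronWithConn hF ⋙ caloronWithConn hC).obj Q ⟶ Q)
      (@FramedBundleC.isIso_of_isIso _ _ _ _ _
        (isIso_ofCaloronInvCaloron hC hF Q.toFramedBundle)))
    fun f => Subtype.ext ((caloronCounitIso hC hF).hom.naturality f.1)

end EquivalenceC

end Caloron

theorem propositionP (G : Caloron.Man.{u}) [Group G] [LieGroup (𝓡 G.dim) ∞ G]
    [CompactSpace G] [ConnectedSpace G] :
    -- the caloron correspondence: the two transforms are well defined on bundles
    ∃ (hC : ∀ P : Caloron.LoopBundle G, (Caloron.caloronData P).IsPrincipal ∧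
        Caloron.IsFraming (Caloron.caloronData P) (Caloron.caloronFrame P))
      (hF : ∀ Q : Caloron.FramedBundle G, (Caloron.invCaloronData Q).IsPrincipal)
      -- and inverse to each other up to the natural isomorphisms `α` and `β`
      (α : Caloron.caloron hC ⋙ Caloron.invCaloron hF ≅ 𝟭 (Caloron.LoopBundle G))
      (β : Caloron.invCaloron hF ⋙ Caloron.caloron hC ≅ 𝟭 (Caloron.FramedBundle G))
      -- the transforms of connections and Higgs fields are well defined and functorial
      (hA : ∀ P : Caloron.LoopBundleC G, Caloron.IsFramedConnection
        (Caloron.caloronData P.toLoopBundle) (Caloron.caloronFrame P.toLoopBundle)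
        (Caloron.caloronConn P))
      (hmap : ∀ (P P' : Caloron.LoopBundleC G) (f : P ⟶ P'), Caloron.FramedBundleC.Preserves
        ⟨(Caloron.caloron hC).obj P.toLoopBundle, Caloron.caloronConn P, hA P⟩
        ⟨(Caloron.caloron hC).obj P'.toLoopBundle, Caloron.caloronConn P', hA P'⟩
        ((Caloron.caloron hC).map f.1))
      (hA' : ∀ Q : Caloron.FramedBundleC G, Caloron.IsLoopConnection
        (Caloron.invCaloronData Q.toFramedBundle) (Caloron.invCaloronConn Q))
      (hΦ' : ∀ Q : Caloron.FramedBundleC G, Caloron.IsHiggs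
        (Caloron.invCaloronData Q.toFramedBundle) (Caloron.invCaloronHiggs Q))
      (hmap' : ∀ (Q Q' : Caloron.FramedBundleC G) (f : Q ⟶ Q'), Caloron.LoopBundleC.Preserves
        ⟨(Caloron.invCaloron hF).obj Q.toFramedBundle, Caloron.invCaloronConn Q, hA' Q,
          Caloron.invCaloronHiggs Q, hΦ' Q⟩
        ⟨(Caloron.invCaloron hF).obj Q'.toFramedBundle, Caloron.invCaloronConn Q', hA' Q',
          Caloron.invCaloronHiggs Q', hΦ' Q'⟩
        ((Caloron.invCaloron hF).map f.1))
      -- and inverse to each other up to natural isomorphisms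
      (αc : Caloron.caloronC hC hA hmap ⋙ Caloron.invCaloronC hF hA' hΦ' hmap' ≅
        𝟭 (Caloron.LoopBundleC G))
      (βc : Caloron.invCaloronC hF hA' hΦ' hmap' ⋙ Caloron.caloronC hC hA hmap ≅
        𝟭 (Caloron.FramedBundleC G)),
      -- `α⁻¹` is `p ↦ (θ ↦ [p, 1, θ])` and `β` is `[f, g, θ] ↦ f(θ)g`
      (∀ (P : Caloron.LoopBundle G) (p : P.bundle.Total) (θ : Caloron.S1),
        Caloron.LoopTotal.loop (Q := (Caloron.caloron hC).obj P) ((α.inv.app P).toFun p) θ =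
          Caloron.mk P p 1 θ) ∧
      (∀ (Q : Caloron.FramedBundle G) (a : Caloron.LoopTotal Q) (g : G) (θ : Caloron.S1),
        (β.hom.app Q).toFun (Caloron.mk ((Caloron.invCaloron hF).obj Q) a g θ) =
          Q.bundle.act (a.loop θ) g) ∧
      -- the connection on `(P × G × S¹) / ΩG` is given by `ad(g⁻¹)A + Θ + ad(g⁻¹)Φ dθ`
      (∀ (P : Caloron.LoopBundleC G) (n : ℕ)
        (q : Caloron.Eu n → P.bundle.Total × G × Caloron.S1), IsPlot q → ∀ x v,
        Caloron.caloronConn P (fun y => Caloron.mk P.toLoopBundle (q y).1 (q y).2.1 (q y).2.2) x v =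
          Caloron.caloronForm P q x v) ∧
      -- the natural isomorphisms are the same as those for bundles without connection
      (∀ P : Caloron.LoopBundleC G,
        (Caloron.LoopBundleC.forget G).map (αc.hom.app P) = α.hom.app P.toLoopBundle) ∧
      (∀ Q : Caloron.FramedBundleC G,
        (Caloron.FramedBundleC.forget G).map (βc.hom.app Q) = β.hom.app Q.toFramedBundle) := by
  have hC : ∀ P : Caloron.LoopBundle G, (Caloron.caloronData P).IsPrincipal ∧
      Caloron.IsFraming (Caloron.caloronData P) (Caloron.caloronFrame P) := fun P =>
    ⟨Caloron.caloronData_isPrincipal P, Caloron.caloronFrame_isFraming P⟩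
  have hF := Caloron.invCaloronData_isPrincipal (G := G)
  refine ⟨hC, hF, Caloron.caloronUnitIso hC hF, Caloron.caloronCounitIso hC hF,
    Caloron.caloronConn_isFramedConnection,
    fun _ _ f _ _ hp x v => Caloron.caloronConn_map f hC hp x v,
    Caloron.invCaloronConn_isLoopConnection, Caloron.invCaloronHiggs_isHiggs,
    fun _ _ f => Caloron.invCaloronMap_preserves hF f, Caloron.caloronUnitIsoC hC hF,
    Caloron.caloronCounitIsoC hC hF, fun _ _ _ => rfl, fun _ _ _ _ => rfl,
    fun P _ _ hq _ v => Caloron.caloronConn_eq P hq .rfl v,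
    Caloron.forget_map_caloronUnitIsoC_hom hC hF, fun _ => rfl⟩
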